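/- Let $\alpha\in(0,1)$, $0<a<b\le 1$, $\Lambda=(0,1)$, $\Lambda_T=\Lambda\times(0,T)$ and $w(r)=r^\alpha$. Let $H^1_0(\Lambda;w)$ be the closure of $C_0^\infty(\Lambda)$ in the norm $\left(\int_\Lambda u^2+w(\partial_r u)^2\,dr\right)^{1/2}$, and $H^{-1}(\Lambda;w)$ its dual. Let $\eta\in C^3([a,1])$ satisfy $$\eta(r)=r^{2-\alpha}\ \text{ on }\Big(0,\tfrac{2a+b}{3}\Big),\qquad \eta>0\ \text{ on }\Big(\tfrac{2a+b}{3},\tfrac{a+2b}{3}\Big),\qquad \eta(r)=(1-r)r^{-\alpha}\ \text{ on }\Big(\tfrac{a+2b}{3},1\Big),$$ and put $\gamma=\|\eta\|_{L^\infty(\Lambda)}+1$, $\Theta(t)=[t(T-t)]^{-4}$ and $\xi(r,t)=\Theta(t)\,(\gamma-\eta(r))$. Then there exist constants $C>0$ and $s_0\ge 1$, depending only on $\alpha$, $a$, $b$ and $\eta|_{(a,b)}$, such that for all $T>0$, all $n\in\mathbb N=\{0,1,2,\dots\}$, all $s\ge s_0\max\{1,T^{16}\}$, all $f\in L^2(\Lambda_T)$,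 all $\varphi^0\in L^2(\Lambda)$ and the weak solution $\varphi$ of $$\partial_t\varphi-\partial_r(r^\alpha\partial_r\varphi)+n^2\varphi=f\ \text{ in }\Lambda_T,\qquad \varphi=0\ \text{ on }\partial\Lambda\times(0,T),\qquad \varphi(0)=\varphi^0\ \text{ in }\Lambda,$$ one has $$s\iint_{\Lambda_T}\Theta\, r^\alpha(\partial_r\varphi)^2e^{-2s\xi}\,dr\,dt+s^3\iint_{\Lambda_T}\Theta^3r^{2-\alpha}\varphi^2e^{-2s\xi}\,dr\,dt\le C\left\|e^{-s\xi}f\right\|_{L^2(\Lambda_T)}^2+Cs^3\iint_{(a,b)\times(0,T)}\Theta^3\varphi^2e^{-2s\xi}\,dr\,dt.$$ Here a weak solution is a function $\varphi\in L^2(0,T;H^1_0(\Lambda;w))$ with $\partial_t\varphi\in L^2(0,T;H^{-1}(\Lambda;w))$ such that for each $v\in H^1_0(\Lambda;w)$ and almost every $t\in(0,T)$ $$\langle\partial_t\varphi(t),v\rangle+\int_\Lambda r^\alpha\,\partial_r\varphi(t)\,\partial_r v\,dr+n^2\int_\Lambda\varphi(t)\,v\,dr=\int_\Lambda f(t)\,v\,dr,$$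 and whose representative in $C([0,T];L^2(\Lambda))$ satisfies $\varphi(0)=\varphi^0$. -/

import Mathlib

open MeasureTheory Set Filter Topology
open scoped ContDiff ENNReal

noncomputable section

namespace DegenerateCarleman

/-- `L²(Λ)` for `Λ = (0, 1)` with Lebesgue measure. -/
abbrev L2 : Type := Lp ℝ 2 (volume.restrict (Ioo (0 : ℝ) 1))

/-- The measure `w(r) dr = r^α dr` on `Λ = (0, 1)`. -/
def weightMeasure (α : ℝ) : Measure ℝ :=
  (volume.restrict (Ioo (0 : ℝ) 1)).withDensity (fun r => ENNReal.ofReal (r ^ α))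

/-- `L²(Λ; w dr)`, the space of the radial derivatives. -/
abbrev L2w (α : ℝ) : Type := Lp ℝ 2 (weightMeasure α)

/-- The pairs `(v, v')` with `v ∈ C₀^∞(Λ)`, inside `L²(Λ) × L²(Λ; w dr)`. The norm of the
ambient space is `(∫ v² + ∫ w (v')²)^{1/2}`, the norm of `H¹(Λ; w)`. -/
def testPairs (α : ℝ) : Submodule ℝ (WithLp 2 (L2 × L2w α)) where
  carrier := {p | ∃ v : ℝ → ℝ, ContDiff ℝ ∞ v ∧ HasCompactSupport v ∧
    tsupport v ⊆ Ioo (0 : ℝ) 1 ∧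
    p.fst =ᵐ[volume.restrict (Ioo (0 : ℝ) 1)] v ∧ p.snd =ᵐ[weightMeasure α] deriv v}
  zero_mem' := by
    refine ⟨0, contDiff_const, HasCompactSupport.zero, by simp, ?_, ?_⟩
    · exact Lp.coeFn_zero ℝ 2 _
    · have h : deriv (0 : ℝ → ℝ) = 0 := by
        funext x
        exact deriv_const x (0 : ℝ)
      rw [h]
      exact Lp.coeFn_zero ℝ 2 _
  add_mem' := by
    rintro p q ⟨v, hv, hvc, hvs, hp1, hp2⟩ ⟨z, hz, hzc, hzs, hq1, hq2⟩
    refine ⟨v + z, hv.add hz, hvc.add hzc,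
      (tsupport_add v z).trans (union_subset hvs hzs), ?_, ?_⟩
    · exact (Lp.coeFn_add p.fst q.fst).trans (hp1.add hq1)
    · have h : deriv (v + z) = deriv v + deriv z := by
        funext x
        exact deriv_add ((hv.differentiable (by simp)) x) ((hz.differentiable (by simp)) x)
      rw [h]
      exact (Lp.coeFn_add p.snd q.snd).trans (hp2.add hq2)
  smul_mem' := by
    rintro c p ⟨v, hv, hvc, hvs, hp1, hp2⟩
    refine ⟨c • v, hv.const_smul c, hvc.smul_left (f := fun _ => c),
      (tsupport_smul_subset_right (fun _ => c) v).trans hvs, ?_, ?_⟩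
    · exact (Lp.coeFn_smul c p.fst).trans (hp1.const_smul c)
    · have h : deriv (c • v) = c • deriv v := by
        funext x
        exact deriv_const_smul c ((hv.differentiable (by simp)) x)
      rw [h]
      exact (Lp.coeFn_smul c p.snd).trans (hp2.const_smul c)

/-- The closure of `C₀^∞(Λ)` in the norm of `H¹(Λ; w)`, as a subspace. -/
def H01Submodule (α : ℝ) : Submodule ℝ (WithLp 2 (L2 × L2w α)) :=
  (testPairs α).topologicalClosure

/-- The Hilbert space `H₀¹(Λ; w)`: the closure of `C₀^∞(Λ)` in the norm of `H¹(Λ; w)`. An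
element is the pair of a function `u ∈ L²(Λ)` and its weak derivative `∂_r u ∈ L²(Λ; w dr)`;
the latter is determined by `u`, since `1 / w` is integrable on `Λ` for `α < 1`. -/
def H01 (α : ℝ) : Type := H01Submodule α

instance (α : ℝ) : NormedAddCommGroup (H01 α) :=
  inferInstanceAs (NormedAddCommGroup (H01Submodule α))

instance (α : ℝ) : InnerProductSpace ℝ (H01 α) :=
  inferInstanceAs (InnerProductSpace ℝ (H01Submodule α))

instance (α : ℝ) : CompleteSpace (H01 α) :=
  (testPairs α).isClosed_topologicalClosure.completeSpace_coe

/-- `H⁻¹(Λ; w)`: the dual space of `H₀¹(Λ; w)`. -/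
def Hneg (α : ℝ) : Type := StrongDual ℝ (H01 α)

instance (α : ℝ) : NormedAddCommGroup (Hneg α) :=
  inferInstanceAs (NormedAddCommGroup (StrongDual ℝ (H01 α)))

instance (α : ℝ) : NormedSpace ℝ (Hneg α) :=
  inferInstanceAs (NormedSpace ℝ (StrongDual ℝ (H01 α)))

instance (α : ℝ) : CompleteSpace (Hneg α) :=
  inferInstanceAs (CompleteSpace (StrongDual ℝ (H01 α)))

/-- The duality pairing `⟨l, v⟩` of `l ∈ H⁻¹(Λ; w)` and `v ∈ H₀¹(Λ; w)`. -/
def pairing {α : ℝ} (l : Hneg α) (v : H01 α) : ℝ := (show StrongDual ℝ (H01 α) from l) v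

/-- The inclusion of `H₀¹(Λ; w)` into `L²(Λ) × L²(Λ; w dr)`, `u ↦ (u, ∂_r u)`. -/
def toPair (α : ℝ) : H01 α →L[ℝ] WithLp 2 (L2 × L2w α) := (H01Submodule α).subtypeL

/-- The embedding `H₀¹(Λ; w) → L²(Λ)`. -/
def toL2 (α : ℝ) : H01 α →L[ℝ] L2 := (WithLp.fstL 2 ℝ L2 (L2w α)).comp (toPair α)

/-- The weak derivative `∂_r : H₀¹(Λ; w) → L²(Λ; w dr)`. -/
def dr (α : ℝ) : H01 α →L[ℝ] L2w α := (WithLp.sndL 2 ℝ L2 (L2w α)).comp (toPair α)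

/-- The embedding `H₀¹(Λ; w) → H⁻¹(Λ; w)`, `u ↦ (v ↦ ∫_Λ u v dr)`. -/
def toHneg (α : ℝ) : H01 α →L[ℝ] Hneg α :=
  show H01 α →L[ℝ] StrongDual ℝ (H01 α) from (innerSL ℝ).bilinearComp (toL2 α) (toL2 α)

/-- `g` is the weak derivative in time on `(0, T)` of `φ`, as functions with values in
`H⁻¹(Λ; w)`. -/
def IsWeakTimeDeriv (α T : ℝ) (φ : ℝ → H01 α) (g : ℝ → Hneg α) : Prop :=
  ∀ χ : ℝ → ℝ, ContDiff ℝ ∞ χ → HasCompactSupport χ → tsupport χ ⊆ Ioo 0 T →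
    ∫ t in Ioo 0 T, deriv χ t • toHneg α (φ t) = -∫ t in Ioo 0 T, χ t • g t

/-- `φ` is a weak solution of `∂_t φ - ∂_r (r^α ∂_r φ) + n² φ = f` in `Λ × (0, T)`, `φ = 0` on
`∂Λ × (0, T)`, `φ(0) = φ0` in `Λ`, where `L²(Λ × (0, T))` is read as `L²(0, T; L²(Λ))`:
`φ ∈ L²(0, T; H₀¹(Λ; w))`, `∂_t φ ∈ L²(0, T; H⁻¹(Λ; w))`, the equation holds against each
`v ∈ H₀¹(Λ; w)` at almost every time, and the representative of `φ` in `C([0, T]; L²(Λ))`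
takes the value `φ0` at time `0`. -/
structure IsWeakSolution (α T : ℝ) (n : ℕ) (f : ℝ → L2) (φ0 : L2) (φ : ℝ → H01 α) : Prop where
  memLp : MemLp φ 2 (volume.restrict (Ioo 0 T))
  equation : ∃ g : ℝ → Hneg α, MemLp g 2 (volume.restrict (Ioo 0 T)) ∧
    IsWeakTimeDeriv α T φ g ∧
    ∀ v : H01 α, ∀ᵐ t ∂(volume.restrict (Ioo 0 T)),
      pairing (g t) v + inner ℝ (dr α (φ t)) (dr α v) + (n : ℝ) ^ 2 * inner ℝ (toL2 α (φ t)) (toL2 α v)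
        = inner ℝ (f t) (toL2 α v)
  initial : ∃ U : ℝ → L2, ContinuousOn U (Icc 0 T) ∧
    (∀ᵐ t ∂(volume.restrict (Ioo 0 T)), U t = toL2 α (φ t)) ∧ U 0 = φ0

/-- The spatial weight function `η`. -/
structure IsEta (α a b : ℝ) (η : ℝ → ℝ) : Prop where
  contDiffOn : ContDiffOn ℝ 3 η (Icc a 1)
  left : ∀ r ∈ Ioo 0 ((2 * a + b) / 3), η r = r ^ (2 - α)
  middle : ∀ r ∈ Ioo ((2 * a + b) / 3) ((a + 2 * b) / 3), 0 < η r
  right : ∀ r ∈ Ioo ((a + 2 * b) / 3) 1, η r = (1 - r) * r ^ (-α)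

/-- `γ = |η|_∞ + 1`, with the norm of `L^∞(Λ)`. -/
def gam (η : ℝ → ℝ) : ℝ := (eLpNorm η ∞ (volume.restrict (Ioo (0 : ℝ) 1))).toReal + 1

/-- `Θ(t) = [t (T - t)]⁻⁴`. -/
def Theta (T t : ℝ) : ℝ := 1 / (t * (T - t)) ^ 4

/-- `ξ(r, t) = Θ(t) (γ - η(r))`. -/
def xi (T : ℝ) (η : ℝ → ℝ) (r t : ℝ) : ℝ := Theta T t * (gam η - η r)

end DegenerateCarleman

end

/-! Write `w = r^α`, `p = w η'`, `X = sΘ` and conjugate: `z = e^{-sξ} φ`. The conjugated equation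
reads `A + S = F` with `F = e^{-sξ} f`, `A = z_t + X (2 p z_r + p' z)` and `S = -(w z_r)_r + V z`,
where `V = sΘ' (γ - η) - X² p η' + n²`. Since `F² = A² + S² + 2SA`, the cross term satisfies `2SA ≤
F²`. Up to an `r`-derivative and a `t`-derivative, `2SA` is `2Xκ w z_r² + 2X³ κ p η' z²` plus lower
order terms, with `κ = 2p' - α p / r`. Near `r = 0` and near `r = 1` the explicit form of `η` bounds
`κ` below by a positive constant and `p η'` below by a multiple of `r^(2-α)`. The summand `n²`
enters `2SA` only through exact derivatives, which is why the constants do not depend on `n`.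

Three difficulties remain. In the middle third `κ` has no sign. There a cutoff `ζ` and the extra
multiplier `4 K₀ X ζ² z` supply `-4 K₀ X ζ² w z_r²`, so the local gradient is absorbed inside the
same identity and only `z²` on `(a, b)` is left. Second, `sΘ'' (γ - η) z²` is not controlled by `X³
r^(2-α) z²` at the degenerate point. A Hardy term, coming from the derivative of `w z² / r`,
supplies `X r^(α-2) z²`, and the two weights interpolate to `X² z²`. Third, the boundary terms:
everything vanishes at `r = 0`, and at `r = 1` only `-2X η'(1) (w z_r)² ≥ 0` survives. The pointwise
inequality is `carleman_pointwise`, and its integral is `carleman_classical`, for classical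
functions supported away from `t = 0` and `t = T`.

Weak solutions are reached by density. Let `ι` be the embedding of `H₀¹` into `L²` and `ι*` its
adjoint, which solves the static problem. In terms of `ι` the equation is `(ι*ι φ)' + φ + (n² - 1)
ι*ι φ = ι* f`. The pairs made of a separated sum `∑ c_i(t) ι* g_i` and its right-hand side span a
subspace whose closure is invariant under the bounded, symmetric, injective operator `(ι*ι, ιι*)`.
Applying that operator twice to a weak solution gives a pair regular enough to lie visibly in the
closure, and `mem_of_sq_mem` brings the solution itself back into it (`mem_closure_graphSpan`). The
weights `X^k e^{-2sξ}` are bounded, because `γ - η ≥ 1`, so both sides of the inequality are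
continuous on `L²(0,T; H₀¹) × L²(0,T; L²)`. They also vanish at `t = 0` and `t = T` fast enough for
time cutoffs to be removed, and so no initial datum appears in the estimate. -/

noncomputable section

/-! ### The divergence identity and inequality at a point. -/

namespace DegenerateCarleman

/-- On the left stand the `r`-derivative of the radial flux and the `t`-derivative of the energy, on
the right the products they come from. Treating functions and their derivatives as independent
letters turns the integrations by parts into polynomial algebra. Here `y` is `z_r`, `qr` is `(w
z_r)_r`, `ρ` is `1/r`, and `H1`, `H2`, `G` are `sΘ'`, `sΘ''`, `γ - η`. -/
theorem carleman_identity (α ρ w m p p1 p2 ζ ζ1 X H1 H2 G N K0 κ0 z y zt yt qr : ℝ) :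
    (-2 * qr * zt - 2 * w * y * yt - 2 * X * ((p1 - α * p * ρ) * w * y ^ 2 + 2 * p * y * qr)
      - 2 * X * (p2 * z * (w * y) + p1 * y * (w * y) + p1 * z * qr)
      + 2 * X * ((-H1 * m - X ^ 2 * m * (2 * p1 - α * p * ρ)) * p * z ^ 2
        + (H1 * G - X ^ 2 * (p * m) + N) * (p1 * z ^ 2 + 2 * p * z * y))
      + 4 * K0 * (X ^ 2 * (2 * ζ * ζ1 * p * z ^ 2 + ζ ^ 2 * p1 * z ^ 2 + ζ ^ 2 * p * (2 * z * y))
        - X * (2 * ζ * ζ1 * z * (w * y) + ζ ^ 2 * y * (w * y) + ζ ^ 2 * z * qr))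
      + κ0 / 2 * X * ((1 - α) / 2) * ((α - 1) * (w * ρ ^ 2) * z ^ 2 + 2 * (w * ρ) * z * y))
    + (2 * w * y * yt + (H2 * G - 2 * X * H1 * (p * m)) * z ^ 2
      + (H1 * G - X ^ 2 * (p * m) + N) * (2 * z * zt)
      + 2 * K0 * (H1 * ζ ^ 2 * z ^ 2 + X * ζ ^ 2 * (2 * z * zt)))
    = 2 * (-qr + (H1 * G - X ^ 2 * (p * m) + N) * z) * (zt + X * (2 * p * y + p1 * z))
      + 4 * K0 * X * ζ ^ 2 * z * (zt + X * (2 * p * y + p1 * z) +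
        (-qr + (H1 * G - X ^ 2 * (p * m) + N) * z))
      - 2 * X * (2 * p1 - α * p * ρ) * (w * y ^ 2) - 2 * X * p2 * z * (w * y)
      - 2 * X ^ 3 * ((2 * p1 - α * p * ρ) * (p * m)) * z ^ 2 - 4 * X * H1 * (p * m) * z ^ 2
      + H2 * G * z ^ 2
      - 4 * K0 * X * ζ ^ 2 * (w * y ^ 2) - 8 * K0 * X * ζ * ζ1 * z * (w * y)
      - 4 * K0 * N * X * ζ ^ 2 * z ^ 2
      - 4 * K0 * (-(H1 * ζ ^ 2) / 2 - 2 * X ^ 2 * ζ * ζ1 * p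
          + X * ζ ^ 2 * (H1 * G - X ^ 2 * (p * m))) * z ^ 2
      - κ0 / 2 * X * ((1 - α) ^ 2 / 2 * (w * ρ ^ 2 * z ^ 2) - (1 - α) * (w * ρ) * z * y) := by
  ring

set_option maxHeartbeats 1000000 in
/-- The divergence inequality behind the Carleman estimate, at a single point. -/
theorem carleman_pointwise
    {α r ρ w W m p p1 p2 ζ ζ1 ind X H1 H2 G N K0 κ0 Cb ε z y zt yt qr F : ℝ}
    (hr : r * ρ = 1) (hw : 0 < w) (hW : 0 < W) (hwW : W * w = r ^ 2) (hw1 : w ≤ 1) (hW1 : W ≤ 1)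
    (hp : p = w * m) (hκ0 : 0 < κ0) (hK0 : 0 < K0) (hN : 0 ≤ N)
    (hκ : κ0 ≤ (2 * p1 - α * p * ρ) + K0 * ζ ^ 2)
    (hκ2 : κ0 * W ≤ (2 * p1 - α * p * ρ) * (p * m) + K0 * ζ ^ 2)
    (hpm : p * m ≤ Cb * W) (hp2 : p2 ^ 2 * w ≤ Cb * W) (hG : |G| ≤ Cb) (hCb : 1 ≤ Cb)
    (hζ : ζ ^ 2 ≤ ind) (hind : ind ≤ 1) (hζ1 : ζ1 ^ 2 ≤ Cb * ind) (hpb : p ^ 2 ≤ Cb)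
    (hX : 1 ≤ X) (hH1 : |H1| ≤ ε * X ^ 2) (hH2 : |H2| ≤ ε * X ^ 2) (hεX : 1 ≤ ε * X ^ 2)
    (hε : 0 < ε) (hε1 : ε ≤ 1) (hε2 : 5 * ε * Cb + 2 * Cb * ε / κ0 ≤ κ0)
    (hε3 : 4 * ε * Cb ≤ κ0 * (1 - α) ^ 2)
    (hF : F = zt + X * (2 * p * y + p1 * z) - qr + (H1 * G - X ^ 2 * (p * m) + N) * z) :
    (-2 * qr * zt - 2 * w * y * yt - 2 * X * ((p1 - α * p * ρ) * w * y ^ 2 + 2 * p * y * qr)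
      - 2 * X * (p2 * z * (w * y) + p1 * y * (w * y) + p1 * z * qr)
      + 2 * X * ((-H1 * m - X ^ 2 * m * (2 * p1 - α * p * ρ)) * p * z ^ 2
        + (H1 * G - X ^ 2 * (p * m) + N) * (p1 * z ^ 2 + 2 * p * z * y))
      + 4 * K0 * (X ^ 2 * (2 * ζ * ζ1 * p * z ^ 2 + ζ ^ 2 * p1 * z ^ 2 + ζ ^ 2 * p * (2 * z * y))
        - X * (2 * ζ * ζ1 * z * (w * y) + ζ ^ 2 * y * (w * y) + ζ ^ 2 * z * qr))
      + κ0 / 2 * X * ((1 - α) / 2) * ((α - 1) * (w * ρ ^ 2) * z ^ 2 + 2 * (w * ρ) * z * y))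
    + (2 * w * y * yt + (H2 * G - 2 * X * H1 * (p * m)) * z ^ 2
      + (H1 * G - X ^ 2 * (p * m) + N) * (2 * z * zt)
      + 2 * K0 * (H1 * ζ ^ 2 * z ^ 2 + X * ζ ^ 2 * (2 * z * zt)))
    ≤ 2 * F ^ 2 + (16 * K0 ^ 2 + 6 * K0 + 24 * K0 * Cb) * (X ^ 3 * ind * z ^ 2)
      - κ0 * (X * (w * y ^ 2) + X ^ 3 * (W * z ^ 2)) := by
  set κ := 2 * p1 - α * p * ρ with hκdef
  set A := zt + X * (2 * p * y + p1 * z) with hA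
  set S := -qr + (H1 * G - X ^ 2 * (p * m) + N) * z with hS
  have hFAS : F = A + S := by rw [hF, hA, hS]; ring
  have hz2 := sq_nonneg z
  have hind0 : 0 ≤ ind := (sq_nonneg ζ).trans hζ
  have hX0 : 0 < X := by linarith
  have hpm0 : 0 ≤ p * m := by rw [hp]; nlinarith only [mul_nonneg hw.le (sq_nonneg m)]
  have hX23 : X ^ 2 ≤ X ^ 3 := pow_le_pow_right₀ hX (by norm_num)
  have hX13 : X ≤ X ^ 3 := by simpa using pow_le_pow_right₀ hX (show 1 ≤ 3 by norm_num)
  have hi2 : 0 ≤ ind * z ^ 2 := by positivity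
  have hζz : ζ ^ 2 * z ^ 2 ≤ ind * z ^ 2 := mul_le_mul_of_nonneg_right hζ hz2
  have hζz0 : 0 ≤ ζ ^ 2 * z ^ 2 := by positivity
  rw [hκdef, carleman_identity, ← hκdef, ← hA, ← hS, ← hFAS]
  -- The difference of the two sides is `S² + A²`.
  have e1 : 2 * S * A ≤ F ^ 2 := by rw [hFAS]; nlinarith only [sq_nonneg S, sq_nonneg A]
  have e2 : 4 * K0 * X * ζ ^ 2 * z * F ≤ F ^ 2 + 16 * K0 ^ 2 * (X ^ 3 * ind * z ^ 2) := by
    have h1 : 4 * K0 * X * ζ ^ 2 * z * F ≤ F ^ 2 + 4 * K0 ^ 2 * (X ^ 2 * (ζ ^ 2 * (ζ ^ 2 * z ^ 2))) := by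
      nlinarith only [sq_nonneg (F - 2 * K0 * X * ζ ^ 2 * z)]
    have h2 : ζ ^ 2 * (ζ ^ 2 * z ^ 2) ≤ ind * z ^ 2 :=
      (mul_le_of_le_one_left hζz0 (hζ.trans hind)).trans hζz
    have h3 : X ^ 2 * (ζ ^ 2 * (ζ ^ 2 * z ^ 2)) ≤ X ^ 3 * (ind * z ^ 2) :=
      mul_le_mul hX23 h2 (by positivity) (by positivity)
    have h4 : 0 ≤ X ^ 3 * (ind * z ^ 2) := by positivity
    nlinarith only [h1, mul_le_mul_of_nonneg_left h3 (sq_nonneg K0), mul_nonneg (sq_nonneg K0) h4]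
  have hP : 0 ≤ w * y ^ 2 := by positivity
  -- The local gradient lost here and the one lost in `e8` add up to exactly the `4 K0 X ζ² w y²`
  -- that the localised multiplier provides.
  have e3 : -(2 * X * κ * (w * y ^ 2)) ≤ 2 * K0 * X * ζ ^ 2 * (w * y ^ 2) - 2 * κ0 * (X * (w * y ^ 2)) := by
    nlinarith only [mul_le_mul_of_nonneg_right hκ (mul_nonneg hX0.le hP)]
  have e4 : -(2 * X * p2 * z * (w * y)) ≤ κ0 / 2 * (X * (w * y ^ 2))
      + 2 * Cb * ε / κ0 * (X ^ 3 * (W * z ^ 2)) := by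
    have h1 : -(2 * p2 * z * (w * y)) ≤ κ0 / 2 * (w * y ^ 2) + 2 / κ0 * (p2 ^ 2 * w * z ^ 2) := by
      have : 0 ≤ w * (2 / κ0) * (κ0 / 2 * y + p2 * z) ^ 2 := by positivity
      have h : w * (2 / κ0) * (κ0 / 2 * y + p2 * z) ^ 2 = κ0 / 2 * (w * y ^ 2) +
          2 / κ0 * (p2 ^ 2 * w * z ^ 2) + 2 * p2 * z * (w * y) := by field_simp; ring
      linarith only [this, h]
    have h2 : p2 ^ 2 * w * z ^ 2 ≤ Cb * W * z ^ 2 := mul_le_mul_of_nonneg_right hp2 hz2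
    have h3 : X ≤ ε * X ^ 3 := by nlinarith only [hεX, hX0]
    have h4 : X * (2 / κ0 * (p2 ^ 2 * w * z ^ 2)) ≤ ε * X ^ 3 * (2 / κ0 * (Cb * W * z ^ 2)) := by
      gcongr
    have h5 : ε * X ^ 3 * (2 / κ0 * (Cb * W * z ^ 2)) = 2 * Cb * ε / κ0 * (X ^ 3 * (W * z ^ 2)) := by ring
    nlinarith only [mul_le_mul_of_nonneg_left h1 hX0.le, h4, h5]
  have e5 : -(2 * X ^ 3 * (κ * (p * m)) * z ^ 2) ≤ 2 * K0 * (X ^ 3 * ind * z ^ 2)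
      - 2 * κ0 * (X ^ 3 * (W * z ^ 2)) := by
    have h0 : 0 ≤ X ^ 3 * z ^ 2 := by positivity
    have h1 := mul_le_mul_of_nonneg_right hκ2 h0
    have h2 : X ^ 3 * (ζ ^ 2 * z ^ 2) ≤ X ^ 3 * (ind * z ^ 2) := by gcongr
    nlinarith only [h1, mul_le_mul_of_nonneg_left h2 hK0.le]
  have e6 : -(4 * X * H1 * (p * m) * z ^ 2) ≤ 4 * ε * Cb * (X ^ 3 * (W * z ^ 2)) := by
    have h1 : -H1 ≤ ε * X ^ 2 := (neg_le_abs H1).trans hH1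
    have h2 : -H1 * (p * m) ≤ ε * X ^ 2 * (Cb * W) :=
      (mul_le_mul_of_nonneg_right h1 hpm0).trans (mul_le_mul_of_nonneg_left hpm (by positivity))
    have h3 : 0 ≤ 4 * X * z ^ 2 := by positivity
    nlinarith only [mul_le_mul_of_nonneg_right h2 h3]
  have hHG : ∀ H, |H| ≤ ε * X ^ 2 → |H * G| ≤ ε * Cb * X ^ 2 := fun H hH => by
    rw [abs_mul]
    calc |H| * |G| ≤ (ε * X ^ 2) * Cb := mul_le_mul hH hG (abs_nonneg _) (by positivity)
      _ = _ := by ring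
  have hB : (w * ρ ^ 2) * W = 1 := by
    calc (w * ρ ^ 2) * W = (W * w) * ρ ^ 2 := by ring
      _ = (r * ρ) ^ 2 := by rw [hwW]; ring
      _ = 1 := by rw [hr]; norm_num
  set b := w * ρ ^ 2 with hb
  have hbpos : 0 < b := by
    rcases lt_or_ge 0 b with h | h
    · exact h
    · nlinarith only [mul_nonneg (neg_nonneg.2 h) hW.le, hB]
  -- Since `b W = 1`, the arithmetic-geometric mean inequality gives `2X² ≤ X b + X³ W`. The first
  -- weight is the one of the Hardy term, the second is the weight being estimated.
  have e7 : H2 * G * z ^ 2 ≤ ε * Cb / 2 * (X * (b * z ^ 2)) + ε * Cb / 2 * (X ^ 3 * (W * z ^ 2)) := by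
    have h1 : H2 * G ≤ ε * Cb * X ^ 2 := (le_abs_self _).trans (hHG H2 hH2)
    have h2 : 2 * X ^ 2 ≤ X * b + X ^ 3 * W := by
      have h3 : X * W * (X * b) = X ^ 2 := by
        calc X * W * (X * b) = X ^ 2 * (b * W) := by ring
          _ = X ^ 2 := by rw [hB, mul_one]
      have : 0 ≤ X * b * (1 - X * W) ^ 2 := by positivity
      have h4 : X * b * (1 - X * W) ^ 2 = X * b - 2 * X ^ 2 * (b * W) + X ^ 3 * W * (b * W) := by ring
      rw [hB] at h4
      linarith only [this, h4]
    have h5 : ε * Cb * X ^ 2 * z ^ 2 ≤ ε * Cb / 2 * (X * b + X ^ 3 * W) * z ^ 2 := by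
      have : 0 ≤ ε * Cb / 2 * z ^ 2 := by positivity
      nlinarith only [mul_le_mul_of_nonneg_left h2 this]
    nlinarith only [mul_le_mul_of_nonneg_right h1 hz2, h5]
  have e8 : -(8 * K0 * X * ζ * ζ1 * z * (w * y)) ≤ 2 * K0 * X * ζ ^ 2 * (w * y ^ 2)
      + 8 * K0 * Cb * (X ^ 3 * ind * z ^ 2) := by
    have h1 : -(8 * K0 * X * ζ * ζ1 * z * (w * y)) ≤ 2 * K0 * X * ζ ^ 2 * (w * y ^ 2)
        + 8 * K0 * (X * (ζ1 ^ 2 * (w * z ^ 2))) := by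
      have : 0 ≤ 2 * K0 * X * w * (ζ * y + 2 * ζ1 * z) ^ 2 := by positivity
      nlinarith only [this]
    have h2 : ζ1 ^ 2 * (w * z ^ 2) ≤ Cb * ind * (z ^ 2) :=
      mul_le_mul hζ1 (mul_le_of_le_one_left hz2 hw1) (by positivity) (by positivity)
    have h3 : X * (ζ1 ^ 2 * (w * z ^ 2)) ≤ X ^ 3 * (Cb * ind * z ^ 2) :=
      mul_le_mul hX13 h2 (by positivity) (by positivity)
    nlinarith only [h1, mul_le_mul_of_nonneg_left h3 hK0.le]
  have e9 : 0 ≤ 4 * K0 * N * X * ζ ^ 2 * z ^ 2 := by positivity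
  have e10 : -(4 * K0 * (-(H1 * ζ ^ 2) / 2 - 2 * X ^ 2 * ζ * ζ1 * p
          + X * ζ ^ 2 * (H1 * G - X ^ 2 * (p * m))) * z ^ 2)
      ≤ (2 * K0 + 16 * K0 * Cb) * (X ^ 3 * ind * z ^ 2) + 2 * K0 * (X ^ 3 * ind * z ^ 2) := by
    have hH1' : H1 ≤ X ^ 3 := by
      have h := (le_abs_self H1).trans hH1
      have h' := mul_le_mul_of_nonneg_right hε1 (sq_nonneg X)
      linarith only [h, h', hX23]
    have a1 : H1 * (ζ ^ 2 * z ^ 2) ≤ X ^ 3 * (ind * z ^ 2) :=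
      (mul_le_mul_of_nonneg_right hH1' hζz0).trans (mul_le_mul_of_nonneg_left hζz (by positivity))
    have a2 : 2 * ζ * ζ1 * p ≤ 2 * (Cb * ind) := by
      have h1 : 2 * ζ * ζ1 * p ≤ ζ ^ 2 * p ^ 2 + ζ1 ^ 2 := by nlinarith only [sq_nonneg (ζ * p - ζ1)]
      have h2 : ζ ^ 2 * p ^ 2 ≤ ind * Cb := mul_le_mul hζ hpb (sq_nonneg _) hind0
      linarith only [h1, h2, hζ1]
    have a3 : X ^ 2 * (2 * ζ * ζ1 * p) * z ^ 2 ≤ X ^ 3 * (2 * (Cb * ind)) * z ^ 2 := by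
      have h1 : X ^ 2 * (2 * ζ * ζ1 * p) ≤ X ^ 3 * (2 * (Cb * ind)) :=
        (mul_le_mul_of_nonneg_left a2 (by positivity)).trans
          (mul_le_mul_of_nonneg_right hX23 (by positivity))
      exact mul_le_mul_of_nonneg_right h1 hz2
    have a4 : -(X * (H1 * G)) ≤ Cb * X ^ 3 := by
      have h1 := (neg_le_abs _).trans (hHG H1 hH1)
      have h2 : ε * Cb * X ^ 2 ≤ Cb * X ^ 2 := by
        have : 0 ≤ Cb * X ^ 2 := by positivity
        nlinarith only [this, hε1]
      nlinarith only [mul_le_mul_of_nonneg_left (h1.trans h2) hX0.le]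
    have a5 : -(X * (H1 * G)) * (ζ ^ 2 * z ^ 2) ≤ Cb * X ^ 3 * (ind * z ^ 2) :=
      (mul_le_mul_of_nonneg_right a4 hζz0).trans (mul_le_mul_of_nonneg_left hζz (by positivity))
    have a6 : p * m ≤ Cb := hpm.trans (mul_le_of_le_one_right (zero_le_one.trans hCb) hW1)
    have a7 : X ^ 3 * (p * m) * (ζ ^ 2 * z ^ 2) ≤ X ^ 3 * Cb * (ind * z ^ 2) :=
      mul_le_mul (mul_le_mul_of_nonneg_left a6 (by positivity)) hζz hζz0 (by positivity)
    nlinarith only [mul_le_mul_of_nonneg_left a1 hK0.le, mul_le_mul_of_nonneg_left a3 hK0.le,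
      mul_le_mul_of_nonneg_left a5 hK0.le, mul_le_mul_of_nonneg_left a7 hK0.le,
      mul_nonneg hK0.le (mul_nonneg (pow_pos hX0 3).le hi2)]
  -- Hardy's inequality before integration: the difference is a multiple of `w (y - (1 - α) z /
  -- (2r))²`.
  have e11 : -(κ0 / 2 * X * ((1 - α) ^ 2 / 2 * (b * z ^ 2) - (1 - α) * (w * ρ) * z * y))
      ≤ κ0 / 2 * (X * (w * y ^ 2)) - κ0 * (1 - α) ^ 2 / 8 * (X * (b * z ^ 2)) := by
    have : 0 ≤ κ0 / 2 * X * w * (y - (1 - α) / 2 * (ρ * z)) ^ 2 := by positivity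
    rw [hb]
    nlinarith only [this]
  have e12 : ε * Cb / 2 * (X * (b * z ^ 2)) ≤ κ0 * (1 - α) ^ 2 / 8 * (X * (b * z ^ 2)) := by
    have : 0 ≤ X * (b * z ^ 2) := by positivity
    exact mul_le_mul_of_nonneg_right (by linarith only [hε3]) this
  -- The balance: of the gain `2 κ0` for the gradient, `e4` and `e11` each use `κ0 / 2`. Of the gain
  -- `2 κ0` for `X³ W z²`, the errors collected here use at most `κ0`.
  have e13 : 4 * ε * Cb * (X ^ 3 * (W * z ^ 2)) + ε * Cb / 2 * (X ^ 3 * (W * z ^ 2))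
      + 2 * Cb * ε / κ0 * (X ^ 3 * (W * z ^ 2)) ≤ κ0 * (X ^ 3 * (W * z ^ 2)) := by
    have h0 : 0 ≤ X ^ 3 * (W * z ^ 2) := by positivity
    have h1 : 4 * ε * Cb + ε * Cb / 2 + 2 * Cb * ε / κ0 ≤ κ0 := by
      have : 0 ≤ ε * Cb := by positivity
      linarith only [this, hε2]
    calc _ = (4 * ε * Cb + ε * Cb / 2 + 2 * Cb * ε / κ0) * (X ^ 3 * (W * z ^ 2)) := by ring
      _ ≤ _ := mul_le_mul_of_nonneg_right h1 h0
  have e14 : 0 ≤ X ^ 3 * ind * z ^ 2 := by positivity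
  have e15 := mul_nonneg (mul_nonneg hK0.le (zero_le_one.trans hCb)) e14
  have e16 := mul_nonneg hK0.le e14
  linarith only [e1, e2, e3, e4, e5, e6, e7, e8, e9, e10, e11, e12, e13, e14, e15, e16]

/-! ### The spatial weight. -/

/-- The properties of the spatial weight that enter the Carleman estimate: `m = η'`,
`p = r^α η'`, and `p1`, `p2` are the first two derivatives of `p`. -/
structure SpatialWeight (α a b γ : ℝ) (η m p1 p2 ζ ζ1 : ℝ → ℝ) (κ0 K0 Cb : ℝ) : Prop where
  η_cont : ContinuousOn η (Icc 0 1)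
  m_cont : ContinuousOn m (Icc 0 1)
  p1_cont : ContinuousOn p1 (Icc 0 1)
  ζ_cont : Continuous ζ
  m_zero : m 0 = 0
  m_one : m 1 ≤ 0
  η_deriv : ∀ r ∈ Ioo (0 : ℝ) 1, HasDerivAt η (m r) r
  p_deriv : ∀ r ∈ Ioo (0 : ℝ) 1, HasDerivAt (fun x => x ^ α * m x) (p1 r) r
  p1_deriv : ∀ r ∈ Ioo (0 : ℝ) 1, HasDerivAt p1 (p2 r) r
  ζ_deriv : ∀ r ∈ Ioo (0 : ℝ) 1, HasDerivAt ζ (ζ1 r) r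
  κ0_pos : 0 < κ0
  K0_pos : 0 < K0
  one_le_Cb : 1 ≤ Cb
  coercive : ∀ r ∈ Ioo (0 : ℝ) 1, κ0 ≤ (2 * p1 r - α * (r ^ α * m r) * r⁻¹) + K0 * ζ r ^ 2
  coercive' : ∀ r ∈ Ioo (0 : ℝ) 1, κ0 * r ^ (2 - α) ≤
    (2 * p1 r - α * (r ^ α * m r) * r⁻¹) * (r ^ α * m r * m r) + K0 * ζ r ^ 2
  pm_le : ∀ r ∈ Ioo (0 : ℝ) 1, r ^ α * m r * m r ≤ Cb * r ^ (2 - α)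
  p2_le : ∀ r ∈ Ioo (0 : ℝ) 1, p2 r ^ 2 * r ^ α ≤ Cb * r ^ (2 - α)
  p_le : ∀ r ∈ Ioo (0 : ℝ) 1, (r ^ α * m r) ^ 2 ≤ Cb
  one_le : ∀ r ∈ Icc (0 : ℝ) 1, 1 ≤ γ - η r
  le_Cb : ∀ r ∈ Icc (0 : ℝ) 1, |γ - η r| ≤ Cb
  ζ_le : ∀ r, ζ r ^ 2 ≤ (Ioo a b).indicator 1 r
  ζ1_le : ∀ r, ζ1 r ^ 2 ≤ Cb * (Ioo a b).indicator 1 r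

/-- The constant `gam` is built from an essential supremum over the open interval, whereas the flux
argument needs `γ - η ≥ 1` pointwise up to the endpoints. An open null set is empty, and the bound
passes to the closure. -/
theorem le_of_ae_le_Ioo {h : ℝ → ℝ} {M : ℝ} (hc : ContinuousOn h (Icc 0 1))
    (hae : ∀ᵐ r ∂(volume.restrict (Ioo (0 : ℝ) 1)), h r ≤ M) : ∀ r ∈ Icc (0 : ℝ) 1, h r ≤ M := by
  have h1 : ∀ r ∈ Ioo (0 : ℝ) 1, h r ≤ M := by
    have ho : IsOpen (Ioo (0 : ℝ) 1 ∩ h ⁻¹' Ioi M) :=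
      (hc.mono Ioo_subset_Icc_self).isOpen_inter_preimage isOpen_Ioo isOpen_Ioi
    have hz : volume (Ioo (0 : ℝ) 1 ∩ h ⁻¹' Ioi M) = 0 := by
      rw [ae_restrict_iff' measurableSet_Ioo, ae_iff] at hae
      refine measure_mono_null ?_ hae
      rintro x ⟨hx, hx'⟩
      simp only [mem_ofPred_eq, not_forall, not_le]
      exact ⟨hx, hx'⟩
    rw [ho.measure_eq_zero_iff (μ := volume)] at hz
    intro r hr
    by_contra hlt
    exact (Set.eq_empty_iff_forall_notMem.1 hz r) ⟨hr, not_le.1 hlt⟩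
  have hcl : closure (Ioo (0 : ℝ) 1) = Icc 0 1 := closure_Ioo (by norm_num)
  intro r hr
  exact ContinuousWithinAt.closure_le (hcl ▸ hr) ((hc r hr).mono Ioo_subset_Icc_self) continuousWithinAt_const h1

/-- Three functions glued along the overlaps of `(-∞, l)`, `(0, 1)` and `(ρ, ∞)`. -/
def glue (l ρ : ℝ) (f g h : ℝ → ℝ) (r : ℝ) : ℝ := if r < l then f r else if ρ < r then g r else h r

section Glue
variable {l ρ : ℝ} {f g h : ℝ → ℝ}

theorem glue_left {r : ℝ} (hr : r < l) : glue l ρ f g h r = f r := if_pos hr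

theorem glue_right (hl : l < ρ) {r : ℝ} (hr : ρ < r) : glue l ρ f g h r = g r := by
  rw [glue, if_neg (by linarith), if_pos hr]

theorem glue_mid (hfh : ∀ r ∈ Ioo 0 l, f r = h r) (hgh : ∀ r ∈ Ioo ρ 1, g r = h r)
    {r : ℝ} (hr : r ∈ Ioo (0 : ℝ) 1) : glue l ρ f g h r = h r := by
  unfold glue
  split_ifs with h1 h2
  · exact hfh r ⟨hr.1, h1⟩
  · exact hgh r ⟨h2, hr.2⟩
  · rfl

theorem glue_continuousOn (hl0 : 0 < l) (hl : l < ρ) (hρ : ρ < 1)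
    (hfh : ∀ r ∈ Ioo 0 l, f r = h r) (hgh : ∀ r ∈ Ioo ρ 1, g r = h r) (hf : Continuous f)
    (hg : ∀ r, ρ < r → ContinuousAt g r) (hh : ContinuousOn h (Ioo 0 1)) :
    ContinuousOn (glue l ρ f g h) (Icc 0 1) := by
  intro r hr
  apply ContinuousAt.continuousWithinAt
  rcases lt_or_ge r l with h1 | h1
  · refine (hf.continuousAt (x := r)).congr ?_
    filter_upwards [Iio_mem_nhds h1] with x hx using (glue_left hx).symm
  rcases lt_or_ge ρ r with h2 | h2
  · refine (hg r h2).congr ?_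
    filter_upwards [Ioi_mem_nhds h2] with x hx using (glue_right hl hx).symm
  · have hr' : r ∈ Ioo (0 : ℝ) 1 := ⟨by linarith, by linarith⟩
    refine (hh.continuousAt (isOpen_Ioo.mem_nhds hr')).congr ?_
    filter_upwards [isOpen_Ioo.mem_nhds hr'] with x hx using (glue_mid hfh hgh hx).symm

end Glue

/-- The regularity assumed on `[a, 1]` and the power formula overlap because `(2a + b) / 3 > a`. -/
theorem IsEta.contDiffOn_Ioo {α a b : ℝ} {η : ℝ → ℝ} (hη : IsEta α a b η)
    (hab : a < b) : ContDiffOn ℝ 3 η (Ioo 0 1) := by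
  intro r hr
  apply ContDiffAt.contDiffWithinAt
  rcases lt_or_ge r ((2 * a + b) / 3) with h1 | h1
  · refine (Real.contDiffAt_rpow_const_of_ne (p := 2 - α) hr.1.ne').congr_of_eventuallyEq ?_
    filter_upwards [isOpen_Ioo.mem_nhds (show r ∈ Ioo 0 ((2 * a + b) / 3) from ⟨hr.1, h1⟩)]
      with x hx using hη.left x hx
  · exact hη.contDiffOn.contDiffAt (Icc_mem_nhds (by linarith) hr.2)

theorem hasDerivAt_left_weight {α r : ℝ} (hr : 0 < r) :
    HasDerivAt (fun x : ℝ => x ^ (2 - α)) ((2 - α) * r ^ (1 - α)) r := by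
  have := Real.hasDerivAt_rpow_const (x := r) (p := 2 - α) (Or.inl hr.ne')
  rwa [show 2 - α - 1 = 1 - α by ring] at this

theorem hasDerivAt_right_weight {α r : ℝ} (hr : 0 < r) :
    HasDerivAt (fun x : ℝ => (1 - x) * x ^ (-α)) (r ^ (-α) * (α - 1 - α / r)) r := by
  have h := ((hasDerivAt_id r).const_sub 1).mul
    (Real.hasDerivAt_rpow_const (x := r) (p := -α) (Or.inl hr.ne'))
  refine h.congr_deriv ?_
  rw [Real.rpow_sub_one hr.ne', id]
  field_simp
  ring

-- Near `0` the choice `η = r^(2-α)` makes `p = (2 - α) r` linear, so `p'' = 0`, `κ = (2 - α)²` and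
-- `p η' = (2 - α)² r^(2-α)`. Near `1`, `p = α - 1 - α / r`, whence `κ ≥ α` and `p η' ≥ 1`. On the
-- compact middle only boundedness is used, and `K0 ζ²` makes up for the missing sign. Gluing in the
-- explicit formulas supplies endpoint values with continuity on `[0, 1]`, which `η` itself need not
-- have.
set_option maxHeartbeats 2000000 in
theorem exists_spatialWeight {α a b : ℝ} {η : ℝ → ℝ} (hα0 : 0 < α) (hα1 : α < 1) (ha : 0 < a)
    (hab : a < b) (hb : b ≤ 1) (hη : IsEta α a b η) :
    ∃ (ηt m p1 p2 ζ ζ1 : ℝ → ℝ) (κ0 K0 Cb : ℝ), (∀ r ∈ Ioo (0 : ℝ) 1, ηt r = η r) ∧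
      SpatialWeight α a b (gam η) ηt m p1 p2 ζ ζ1 κ0 K0 Cb := by
  set l := (2 * a + b) / 3 with hl
  set ρ := (a + 2 * b) / 3 with hρ
  have hl0 : 0 < l := by rw [hl]; linarith
  have hlρ : l < ρ := by rw [hl, hρ]; linarith
  have hρ1 : ρ < 1 := by rw [hρ]; linarith
  have hρ0 : 0 < ρ := hl0.trans hlρ
  have hη3 := hη.contDiffOn_Ioo hab
  have hm2 : ContDiffOn ℝ 2 (deriv η) (Ioo 0 1) := hη3.deriv_of_isOpen isOpen_Ioo (by norm_num)
  have hw2 : ContDiffOn ℝ 2 (fun r : ℝ => r ^ α) (Ioo 0 1) := fun r hr =>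
    (Real.contDiffAt_rpow_const_of_ne hr.1.ne').contDiffWithinAt
  have hp2 : ContDiffOn ℝ 2 (fun r => r ^ α * deriv η r) (Ioo 0 1) := hw2.mul hm2
  set P := fun r => r ^ α * deriv η r with hP
  have hp1 : ContDiffOn ℝ 1 (deriv P) (Ioo 0 1) := hp2.deriv_of_isOpen isOpen_Ioo (by norm_num)
  have hp0 : ContDiffOn ℝ 0 (deriv (deriv P)) (Ioo 0 1) :=
    hp1.deriv_of_isOpen isOpen_Ioo (by norm_num)
  -- the weight in the two outer regions
  have mL : ∀ r ∈ Ioo 0 l, (2 - α) * r ^ (1 - α) = deriv η r := fun r hr => by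
    have : η =ᶠ[𝓝 r] fun x => x ^ (2 - α) := by
      filter_upwards [isOpen_Ioo.mem_nhds hr] with x hx using hη.left x hx
    rw [this.deriv_eq, (hasDerivAt_left_weight hr.1).deriv]
  have mR : ∀ r ∈ Ioo ρ 1, r ^ (-α) * (α - 1 - α / r) = deriv η r := fun r hr => by
    have : η =ᶠ[𝓝 r] fun x => (1 - x) * x ^ (-α) := by
      filter_upwards [isOpen_Ioo.mem_nhds hr] with x hx using hη.right x hx
    rw [this.deriv_eq, (hasDerivAt_right_weight (hρ0.trans hr.1)).deriv]
  have PL : ∀ r ∈ Ioo 0 l, P r = (2 - α) * r := fun r hr => by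
    have : r ^ α * r ^ (1 - α) = r := by
      rw [← Real.rpow_add hr.1, show α + (1 - α) = 1 by ring, Real.rpow_one]
    rw [hP]
    simp only
    rw [← mL r hr, mul_left_comm, this]
  have PR : ∀ r ∈ Ioo ρ 1, P r = α - 1 - α / r := fun r hr => by
    have hr0 := hρ0.trans hr.1
    rw [hP]
    simp only
    rw [← mR r hr, ← mul_assoc, ← Real.rpow_add hr0, add_neg_cancel, Real.rpow_zero, one_mul]
  have p1L : ∀ r ∈ Ioo 0 l, (2 - α) = deriv P r := fun r hr => by
    have : P =ᶠ[𝓝 r] fun x => (2 - α) * x := by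
      filter_upwards [isOpen_Ioo.mem_nhds hr] with x hx using PL x hx
    rw [this.deriv_eq, deriv_const_mul_id]
  have hdR : ∀ r : ℝ, 0 < r → HasDerivAt (fun x => α - 1 - α / x) (α / r ^ 2) r := fun r hr => by
    have := ((hasDerivAt_inv hr.ne').const_mul α).const_sub (α - 1)
    refine this.congr_deriv ?_
    field_simp
  have p1R : ∀ r ∈ Ioo ρ 1, α / r ^ 2 = deriv P r := fun r hr => by
    have : P =ᶠ[𝓝 r] fun x => α - 1 - α / x := by
      filter_upwards [isOpen_Ioo.mem_nhds hr] with x hx using PR x hx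
    rw [this.deriv_eq, (hdR r (hρ0.trans hr.1)).deriv]
  have p2L : ∀ r ∈ Ioo 0 l, deriv (deriv P) r = 0 := fun r hr => by
    have : deriv P =ᶠ[𝓝 r] fun _ => 2 - α := by
      filter_upwards [isOpen_Ioo.mem_nhds hr] with x hx using (p1L x hx).symm
    rw [this.deriv_eq, deriv_const]
  have p2R : ∀ r ∈ Ioo ρ 1, deriv (deriv P) r = -2 * α / r ^ 3 := fun r hr => by
    have hr0 := hρ0.trans hr.1
    have : deriv P =ᶠ[𝓝 r] fun x => α / x ^ 2 := by
      filter_upwards [isOpen_Ioo.mem_nhds hr] with x hx using (p1R x hx).symm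
    rw [this.deriv_eq]
    have h := ((hasDerivAt_pow 2 r).inv (pow_ne_zero 2 hr0.ne')).const_mul α
    have e : (fun x : ℝ => α / x ^ 2) = fun y => α * (fun x => x ^ 2)⁻¹ y := by
      funext x
      simp [div_eq_mul_inv]
    rw [e, h.deriv]
    field_simp
    norm_num
    ring
  -- the glued functions
  set ηt := glue l ρ (fun x => x ^ (2 - α)) (fun x => (1 - x) * x ^ (-α)) η with hηt
  set m := glue l ρ (fun r => (2 - α) * r ^ (1 - α)) (fun r => r ^ (-α) * (α - 1 - α / r))
    (deriv η) with hm
  set p1 := glue l ρ (fun _ => 2 - α) (fun r => α / r ^ 2) (deriv P) with hp1def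
  have eη : ∀ r ∈ Ioo (0 : ℝ) 1, ηt r = η r := fun r hr =>
    glue_mid (fun x hx => (hη.left x hx).symm) (fun x hx => (hη.right x hx).symm) hr
  have em : ∀ r ∈ Ioo (0 : ℝ) 1, m r = deriv η r := fun r hr => glue_mid mL mR hr
  have ep1 : ∀ r ∈ Ioo (0 : ℝ) 1, p1 r = deriv P r := fun r hr => glue_mid p1L p1R hr
  have eP : ∀ r ∈ Ioo (0 : ℝ) 1, r ^ α * m r = P r := fun r hr => by rw [em r hr]
  have cη : ContinuousOn ηt (Icc 0 1) :=
    glue_continuousOn hl0 hlρ hρ1 (fun x hx => (hη.left x hx).symm)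
      (fun x hx => (hη.right x hx).symm) (Real.continuous_rpow_const (by linarith))
      (fun r hr => (hasDerivAt_right_weight (hρ0.trans hr)).continuousAt) hη3.continuousOn
  have cm : ContinuousOn m (Icc 0 1) :=
    glue_continuousOn hl0 hlρ hρ1 mL mR
      (continuous_const.mul (Real.continuous_rpow_const (by linarith)))
      (fun r hr => (Real.continuousAt_rpow_const _ _ (Or.inl (hρ0.trans hr).ne')).mul
        (hdR r (hρ0.trans hr)).continuousAt) hm2.continuousOn
  have cp1 : ContinuousOn p1 (Icc 0 1) :=
    glue_continuousOn hl0 hlρ hρ1 p1L p1R continuous_const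
      (fun r hr => continuousAt_const.div (continuousAt_id.pow 2) (pow_ne_zero 2 (hρ0.trans hr).ne'))
      hp1.continuousOn
  have cw : Continuous fun r : ℝ => r ^ α := Real.continuous_rpow_const hα0.le
  -- bounds on compact sets
  have hK : Icc l ρ ⊆ Ioo (0 : ℝ) 1 := Icc_subset_Ioo hl0 hρ1
  have cκ : ContinuousOn (fun r => 2 * deriv P r - α * P r * r⁻¹) (Icc l ρ) :=
    (continuousOn_const.mul (hp1.continuousOn.mono hK)).sub
      ((continuousOn_const.mul (hp2.continuousOn.mono hK)).mul
        (continuousOn_inv₀.mono fun x hx => (hl0.trans_le hx.1).ne'))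
  obtain ⟨B1, hB1⟩ := isCompact_Icc.exists_bound_of_continuousOn cκ
  obtain ⟨B2, hB2⟩ := isCompact_Icc.exists_bound_of_continuousOn
    (cκ.mul ((hp2.continuousOn.mono hK).mul (hm2.continuousOn.mono hK)))
  obtain ⟨B3, hB3⟩ := (isCompact_Icc (a := l) (b := 1)).exists_bound_of_continuousOn
    (f := fun r => r ^ α * m r * m r)
    ((cw.continuousOn.mul (cm.mono (Icc_subset_Icc_left hl0.le))).mul
      (cm.mono (Icc_subset_Icc_left hl0.le)))
  obtain ⟨B4, hB4⟩ := isCompact_Icc.exists_bound_of_continuousOn (hp0.continuousOn.mono hK)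
  obtain ⟨B5, hB5⟩ := isCompact_Icc.exists_bound_of_continuousOn (cw.continuousOn.mul cm)
  obtain ⟨B6, hB6⟩ := isCompact_Icc.exists_bound_of_continuousOn cη
  -- the cutoff function
  let f : ContDiffBump ((a + b) / 2) := ⟨(b - a) / 6, (b - a) / 3, by linarith, by linarith⟩
  have hfs : tsupport f ⊆ Ioo a b := by
    rw [f.tsupport_eq, Real.closedBall_eq_Icc]
    show Icc ((a + b) / 2 - (b - a) / 3) ((a + b) / 2 + (b - a) / 3) ⊆ _
    exact Icc_subset_Ioo (by linarith) (by linarith)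
  have hf1 : ∀ r ∈ Icc l ρ, f r = 1 := fun r hr => by
    apply f.one_of_mem_closedBall
    rw [Real.closedBall_eq_Icc]
    show r ∈ Icc ((a + b) / 2 - (b - a) / 6) ((a + b) / 2 + (b - a) / 6)
    exact ⟨by linarith [hr.1], by linarith [hr.2]⟩
  have hfc : ContDiff ℝ 1 f := f.contDiff
  obtain ⟨B7, hB7⟩ := (hfc.continuous_deriv le_rfl).bounded_above_of_compact_support
    (f.hasCompactSupport.deriv)
  have hout : ∀ r, r ∉ Ioo a b → f r = 0 ∧ deriv f r = 0 := fun r hr => by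
    have h1 : r ∉ tsupport f := fun h => hr (hfs h)
    exact ⟨image_eq_zero_of_notMem_tsupport h1,
      Function.notMem_support.1 fun h => h1 (support_deriv_subset h)⟩
  -- facts about powers
  have hW1 : ∀ r ∈ Ioo (0 : ℝ) 1, r ^ (2 - α) ≤ 1 := fun r hr =>
    Real.rpow_le_one hr.1.le hr.2.le (by linarith)
  have hWl : ∀ r ∈ Ioo (0 : ℝ) 1, l ≤ r → l ^ 2 ≤ r ^ (2 - α) := fun r hr hlr => by
    calc l ^ 2 ≤ r ^ 2 := pow_le_pow_left₀ hl0.le hlr 2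
      _ = r ^ (2 : ℝ) := (Real.rpow_two r).symm
      _ ≤ r ^ (2 - α) := Real.rpow_le_rpow_of_exponent_ge hr.1 hr.2.le (by linarith)
  have hw1 : ∀ r ∈ Ioo (0 : ℝ) 1, r ^ α ≤ 1 := fun r hr => Real.rpow_le_one hr.1.le hr.2.le hα0.le
  have hw0 : ∀ r ∈ Ioo (0 : ℝ) 1, 0 < r ^ α := fun r hr => Real.rpow_pos_of_pos hr.1 _
  have l2 : 0 < l ^ 2 := by positivity
  have pmL : ∀ r ∈ Ioo 0 l, P r * deriv η r = (2 - α) ^ 2 * r ^ (2 - α) := fun r hr => by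
    rw [PL r hr, ← mL r hr, show 2 - α = 1 + (1 - α) by ring, Real.rpow_add hr.1, Real.rpow_one]
    ring
  have κL : ∀ r ∈ Ioo 0 l, 2 * deriv P r - α * P r * r⁻¹ = (2 - α) ^ 2 := fun r hr => by
    have := hr.1.ne'
    rw [PL r hr, ← p1L r hr]
    field_simp
  have κR : ∀ r ∈ Ioo ρ 1, α ≤ 2 * deriv P r - α * P r * r⁻¹ := fun r hr => by
    have h0 := hρ0.trans hr.1
    rw [PR r hr, ← p1R r hr]
    have : 2 * (α / r ^ 2) - α * (α - 1 - α / r) * r⁻¹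
        = (2 * α + α * (1 - α) * r + α * α) / r ^ 2 := by
      field_simp
      ring
    rw [this, le_div_iff₀ (by positivity)]
    have h1 : r ^ 2 ≤ 1 := pow_le_one₀ h0.le hr.2.le
    have h2 : 0 ≤ α * (1 - α) * r := mul_nonneg (mul_nonneg hα0.le (by linarith)) h0.le
    nlinarith [mul_pos hα0 hα0]
  have pmR : ∀ r ∈ Ioo ρ 1, 1 ≤ P r * deriv η r := fun r hr => by
    have h0 := hρ0.trans hr.1
    rw [PR r hr, ← mR r hr]
    have h1 : 1 ≤ r ^ (-α) := Real.one_le_rpow_of_pos_of_le_one_of_nonpos h0 hr.2.le (by linarith)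
    have h2 : α ≤ α / r := by rw [le_div_iff₀ h0]; nlinarith [hr.2]
    have h3 : 1 ≤ (α - 1 - α / r) * (α - 1 - α / r) := by nlinarith
    nlinarith
  have cases3 : ∀ r ∈ Ioo (0 : ℝ) 1, r ∈ Ioo 0 l ∨ r ∈ Icc l ρ ∨ r ∈ Ioo ρ 1 := fun r hr => by
    rcases lt_or_ge r l with h | h
    · exact Or.inl ⟨hr.1, h⟩
    rcases lt_or_ge ρ r with h' | h'
    · exact Or.inr (Or.inr ⟨h', hr.2⟩)
    · exact Or.inr (Or.inl ⟨h, h'⟩)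
  -- One summand for each upper bound required. The `4` covers `(2 - α)²`. The divisions by `l²`
  -- turn constants into multiples of `r^(2-α)`, which is at least `l²` for `r ≥ l`.
  set Cb := 4 + |B3| / l ^ 2 + |B4| ^ 2 / l ^ 2 + (2 / ρ ^ 3) ^ 2 / l ^ 2 + B5 ^ 2 +
    (|gam η| + |B6|) + B7 ^ 2 with hCb
  have q3 : 0 ≤ |B3| / l ^ 2 := by positivity
  have q4 : 0 ≤ |B4| ^ 2 / l ^ 2 := by positivity
  have q4' : 0 ≤ (2 / ρ ^ 3) ^ 2 / l ^ 2 := by positivity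
  have q5 := sq_nonneg B5
  have q6 : 0 ≤ |gam η| + |B6| := by positivity
  have q7 := sq_nonneg B7
  have hη_le : ∀ r ∈ Icc (0 : ℝ) 1, ηt r ≤ gam η - 1 := by
    apply le_of_ae_le_Ioo cη
    have hfin : eLpNorm η ⊤ (volume.restrict (Ioo (0 : ℝ) 1)) < ⊤ := by
      rw [eLpNorm_exponent_top]
      refine eLpNormEssSup_lt_top_of_ae_bound (C := B6) ?_
      filter_upwards [ae_restrict_mem measurableSet_Ioo] with r hr
      rw [← eη r hr]
      exact hB6 r (Ioo_subset_Icc_self hr)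
    filter_upwards [ae_restrict_mem measurableSet_Ioo,
      ae_le_eLpNormEssSup (f := η) (μ := volume.restrict (Ioo (0 : ℝ) 1))] with r hr h
    rw [← eLpNorm_exponent_top] at h
    have := ENNReal.toReal_mono hfin.ne h
    rw [toReal_enorm, Real.norm_eq_abs] at this
    rw [eη r hr, gam]
    linarith [le_abs_self (η r)]
  -- `κ0 = α` suits both outer regions, because `(2 - α)² ≥ 1 > α`. On `[l, ρ]`, where `ζ = 1`,
  -- adding `1 + |B1| + |B2|` lifts both coercive quantities above `1`.
  refine ⟨ηt, m, p1, deriv (deriv P), f, deriv f, α, 1 + |B1| + |B2|, Cb, eη, ?_⟩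
  refine
    { η_cont := cη
      m_cont := cm
      p1_cont := cp1
      ζ_cont := hfc.continuous
      m_zero := ?_
      m_one := ?_
      η_deriv := fun r hr => ?_
      p_deriv := fun r hr => ?_
      p1_deriv := fun r hr => ?_
      ζ_deriv := fun r _ => (hfc.differentiable one_ne_zero r).hasDerivAt
      κ0_pos := hα0
      K0_pos := by positivity
      one_le_Cb := by linarith only [hCb, q3, q4, q4', q5, q6, q7]
      coercive := fun r hr => ?_
      coercive' := fun r hr => ?_
      pm_le := fun r hr => ?_
      p2_le := fun r hr => ?_
      p_le := fun r hr => ?_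
      one_le := fun r hr => by linarith [hη_le r hr]
      le_Cb := fun r hr => ?_
      ζ_le := fun r => ?_
      ζ1_le := fun r => ?_ }
  · rw [hm, glue_left hl0]
    rw [Real.zero_rpow (by linarith), mul_zero]
  · rw [hm, glue_right hlρ hρ1]
    simp only [Real.one_rpow, div_one]
    linarith
  · have h : HasDerivAt η (deriv η r) r :=
      ((hη3.contDiffAt (isOpen_Ioo.mem_nhds hr)).differentiableAt (by norm_num)).hasDerivAt
    rw [em r hr]
    refine h.congr_of_eventuallyEq ?_
    filter_upwards [isOpen_Ioo.mem_nhds hr] with x hx using eη x hx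
  · have h : HasDerivAt P (deriv P r) r :=
      ((hp2.contDiffAt (isOpen_Ioo.mem_nhds hr)).differentiableAt (by norm_num)).hasDerivAt
    rw [ep1 r hr]
    refine h.congr_of_eventuallyEq ?_
    filter_upwards [isOpen_Ioo.mem_nhds hr] with x hx using eP x hx
  · have h : HasDerivAt (deriv P) (deriv (deriv P) r) r :=
      ((hp1.contDiffAt (isOpen_Ioo.mem_nhds hr)).differentiableAt (by norm_num)).hasDerivAt
    refine h.congr_of_eventuallyEq ?_
    filter_upwards [isOpen_Ioo.mem_nhds hr] with x hx using ep1 x hx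
  · rw [eP r hr, ep1 r hr]
    have hnn : 0 ≤ (1 + |B1| + |B2|) * f r ^ 2 := by positivity
    rcases cases3 r hr with h | h | h
    · rw [κL r h]
      nlinarith
    · rw [hf1 r h]
      have := (abs_le.1 (hB1 r h)).1
      linarith [le_abs_self B1, abs_nonneg B2]
    · linarith [κR r h]
  · rw [eP r hr, ep1 r hr, em r hr]
    have hnn : 0 ≤ (1 + |B1| + |B2|) * f r ^ 2 := by positivity
    have hW0 : 0 < r ^ (2 - α) := Real.rpow_pos_of_pos hr.1 _
    have hW := hW1 r hr
    have hαW : α * r ^ (2 - α) ≤ α := mul_le_of_le_one_right hα0.le hW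
    rcases cases3 r hr with h | h | h
    · rw [κL r h, pmL r h]
      have h1 : 1 ≤ (2 - α) ^ 2 := by nlinarith
      have h2 : r ^ (2 - α) ≤ (2 - α) ^ 2 * r ^ (2 - α) := by nlinarith
      nlinarith
    · rw [hf1 r h]
      have := (abs_le.1 (hB2 r h)).1
      simp only [Pi.mul_apply] at this
      linarith [le_abs_self B2, abs_nonneg B1]
    · have h1 := κR r h
      have h2 := pmR r h
      nlinarith
  · have hW0 : 0 < r ^ (2 - α) := Real.rpow_pos_of_pos hr.1 _
    rcases lt_or_ge r l with h | h
    · rw [eP r hr, em r hr, pmL r ⟨hr.1, h⟩]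
      have : (2 - α) ^ 2 ≤ 4 := by nlinarith
      exact mul_le_mul_of_nonneg_right (by linarith only [hCb, q3, q4, q4', q5, q6, q7, this]) hW0.le
    · have h1 := (le_abs_self _).trans ((hB3 r ⟨h, hr.2.le⟩).trans (le_abs_self _))
      have h2 : |B3| ≤ |B3| / l ^ 2 * r ^ (2 - α) := by
        rw [div_mul_eq_mul_div, le_div_iff₀ l2]
        exact mul_le_mul_of_nonneg_left (hWl r hr h) (abs_nonneg _)
      have h3 : |B3| / l ^ 2 * r ^ (2 - α) ≤ Cb * r ^ (2 - α) :=
        mul_le_mul_of_nonneg_right (by linarith only [hCb, q3, q4, q4', q5, q6, q7]) hW0.le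
      linarith only [h1, h2, h3]
  · have hW0 : 0 < r ^ (2 - α) := Real.rpow_pos_of_pos hr.1 _
    have key : ∀ B, 0 ≤ B → deriv (deriv P) r ^ 2 ≤ B → B / l ^ 2 ≤ Cb → l ≤ r →
        deriv (deriv P) r ^ 2 * r ^ α ≤ Cb * r ^ (2 - α) := fun B hB0 hB hBC hlr => by
      have h1 : deriv (deriv P) r ^ 2 * r ^ α ≤ B :=
        (mul_le_of_le_one_right (sq_nonneg _) (hw1 r hr)).trans hB
      have h2 : B ≤ B / l ^ 2 * r ^ (2 - α) := by
        rw [div_mul_eq_mul_div, le_div_iff₀ l2]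
        exact mul_le_mul_of_nonneg_left (hWl r hr hlr) hB0
      exact h1.trans (h2.trans (mul_le_mul_of_nonneg_right hBC hW0.le))
    rcases cases3 r hr with h | h | h
    · rw [p2L r h]
      have : 0 ≤ Cb * r ^ (2 - α) :=
        mul_nonneg (by linarith only [hCb, q3, q4, q4', q5, q6, q7]) hW0.le
      simpa using this
    · refine key (|B4| ^ 2) (by positivity) ?_ (by linarith only [hCb, q3, q4, q4', q5, q6, q7]) h.1
      exact sq_le_sq' (by linarith [(abs_le.1 (hB4 r h)).1, le_abs_self B4])
        ((le_abs_self _).trans ((hB4 r h).trans (le_abs_self _)))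
    · refine key ((2 / ρ ^ 3) ^ 2) (by positivity) ?_ (by linarith only [hCb, q3, q4, q4', q5, q6, q7]) (hlρ.trans h.1).le
      have h0 := hρ0.trans h.1
      rw [p2R r h, neg_mul, neg_div, neg_sq]
      refine pow_le_pow_left₀ (by positivity) ?_ 2
      exact div_le_div₀ (by norm_num) (by linarith) (by positivity)
        (pow_le_pow_left₀ hρ0.le h.1.le 3)
  · have h := hB5 r (Ioo_subset_Icc_self hr)
    have := sq_le_sq' (by linarith [(abs_le.1 h).1]) ((le_abs_self _).trans h)
    simp only [Pi.mul_apply] at this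
    linarith only [this, hCb, q3, q4, q4', q5, q6, q7]
  · have h1 := hB6 r hr
    rw [Real.norm_eq_abs] at h1
    have := abs_sub (gam η) (ηt r)
    linarith only [this, h1, hCb, q3, q4, q4', q5, q6, q7, le_abs_self B6]
  · by_cases hr : r ∈ Ioo a b
    · rw [indicator_of_mem hr]
      exact pow_le_one₀ f.nonneg f.le_one
    · rw [(hout r hr).1, indicator_of_notMem hr]
      norm_num
  · by_cases hr : r ∈ Ioo a b
    · rw [indicator_of_mem hr]
      have h := hB7 r
      have := sq_le_sq' (by linarith [(abs_le.1 h).1]) ((le_abs_self _).trans h)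
      simp only [Pi.one_apply, mul_one]
      linarith only [this, hCb, q3, q4, q4', q5, q6, q7]
    · rw [(hout r hr).2, indicator_of_notMem hr]
      norm_num

/-! ### The weight in time. -/

/-- The first derivative of `Θ`. -/
def Theta1 (T t : ℝ) : ℝ := -4 * (T - 2 * t) / (t * (T - t)) ^ 5

/-- The second derivative of `Θ`. -/
def Theta2 (T t : ℝ) : ℝ := 20 * (T - 2 * t) ^ 2 / (t * (T - t)) ^ 6 + 8 / (t * (T - t)) ^ 5

section Time
variable {T t : ℝ}

theorem hasDerivAt_time (T t : ℝ) : HasDerivAt (fun t => t * (T - t)) (T - 2 * t) t := by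
  have := (hasDerivAt_id t).fun_mul ((hasDerivAt_id t).const_sub T)
  refine this.congr_deriv ?_
  simp only [id]
  ring

theorem time_pos (ht : t ∈ Ioo 0 T) : 0 < t * (T - t) := mul_pos ht.1 (sub_pos.2 ht.2)

theorem hasDerivAt_Theta (ht : t ∈ Ioo 0 T) : HasDerivAt (Theta T) (Theta1 T t) t := by
  have h0 := (time_pos ht).ne'
  have h := ((hasDerivAt_time T t).fun_pow 4).fun_inv (pow_ne_zero 4 h0)
  have e : Theta T = fun t => ((t * (T - t)) ^ 4)⁻¹ := by funext x; rw [Theta, one_div]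
  rw [e]
  refine h.congr_deriv ?_
  rw [Theta1]
  generalize t * (T - t) = d at h0 ⊢
  field_simp
  norm_num
  ring

theorem hasDerivAt_Theta1 (ht : t ∈ Ioo 0 T) : HasDerivAt (Theta1 T) (Theta2 T t) t := by
  have h0 := (time_pos ht).ne'
  have h := ((((hasDerivAt_id t).const_mul 2).const_sub T).const_mul (-4)).fun_div
    ((hasDerivAt_time T t).fun_pow 5) (pow_ne_zero 5 h0)
  refine h.congr_deriv ?_
  rw [Theta2]
  simp only [id]
  generalize t * (T - t) = d at h0 ⊢
  field_simp
  push_cast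
  ring

/-- With `d = t (T - t) ≤ T²` one has `|Θ'| ≤ 4 T d⁻⁵` and `|Θ''| ≤ 22 T² d⁻⁶`, while `Θ² = d⁻⁸`.
The spare powers of `d` cost `T⁷` and `T⁶`, and `X ≥ s₀` costs `T⁸`. All of these are dominated by
`max 1 (T ^ 16)`. Taking `s₀ ≥ 22` large thus makes every time derivative a small multiple of `X²`.
-/
theorem Theta_bounds {s s₀ : ℝ} (hs₀ : 1 ≤ s₀) (hs : s₀ * max 1 (T ^ 16) ≤ s) (ht : t ∈ Ioo 0 T) :
    s₀ ≤ s * Theta T t ∧ |s * Theta1 T t| ≤ 22 / s₀ * (s * Theta T t) ^ 2 ∧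
      |s * Theta2 T t| ≤ 22 / s₀ * (s * Theta T t) ^ 2 := by
  have hT : 0 < T := ht.1.trans ht.2
  have hpos := time_pos ht
  set d := t * (T - t) with hd
  have hd4 : 4 * d ≤ T ^ 2 := by rw [hd]; nlinarith [sq_nonneg (T - 2 * t)]
  have hs0 : 0 < s₀ := by linarith
  have hM1 : (1 : ℝ) ≤ max 1 (T ^ 16) := le_max_left _ _
  have hpow : ∀ k, k ≤ 16 → T ^ k ≤ max 1 (T ^ 16) := fun k hk => by
    rcases le_or_gt T 1 with h | h
    · exact (pow_le_one₀ hT.le h).trans hM1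
    · exact (pow_le_pow_right₀ h.le hk).trans (le_max_right _ _)
  have hsT : ∀ k, k ≤ 16 → s₀ * T ^ k ≤ s := fun k hk =>
    (mul_le_mul_of_nonneg_left (hpow k hk) hs0.le).trans hs
  have hspos : 0 < s := lt_of_lt_of_le (by positivity) hs
  have hdT : d ≤ T ^ 2 := by nlinarith
  have hτ : |T - 2 * t| ≤ T := abs_le.2 ⟨by linarith [ht.2], by linarith [ht.1]⟩
  refine ⟨?_, ?_, ?_⟩
  · have h1 : d ^ 4 ≤ T ^ 8 := by
      calc d ^ 4 ≤ (T ^ 2) ^ 4 := pow_le_pow_left₀ hpos.le hdT 4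
        _ = T ^ 8 := by ring
    rw [Theta, ← hd, mul_one_div, le_div_iff₀ (by positivity)]
    exact (mul_le_mul_of_nonneg_left h1 hs0.le).trans (hsT 8 (by norm_num))
  · have h1 : |s * Theta1 T t| ≤ s * (4 * T / d ^ 5) := by
      rw [abs_mul, abs_of_pos hspos, Theta1, ← hd, abs_div, abs_of_pos (pow_pos hpos 5), abs_mul]
      gcongr
      norm_num
    refine h1.trans ?_
    have h2 : s * (4 * T / d ^ 5) = (4 * s * (s₀ * T * d ^ 3)) / (s₀ * d ^ 8) := by
      field_simp
    have h3 : 22 / s₀ * (s * Theta T t) ^ 2 = 22 * s * s / (s₀ * d ^ 8) := by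
      rw [Theta, ← hd]; field_simp
    rw [h2, h3]
    have h4 : s₀ * T * d ^ 3 ≤ s := by
      calc s₀ * T * d ^ 3 ≤ s₀ * T * (T ^ 2) ^ 3 := by gcongr
        _ = s₀ * T ^ 7 := by ring
        _ ≤ s := hsT 7 (by norm_num)
    gcongr
    norm_num
  · have h1 : |s * Theta2 T t| ≤ s * (22 * T ^ 2 / d ^ 6) := by
      rw [abs_mul, abs_of_pos hspos, Theta2, ← hd, abs_of_nonneg (by positivity)]
      -- This is `4d ≤ T²`, and `20 + 2` is the source of the constant `22`.
      have h5 : 8 / d ^ 5 ≤ 2 * T ^ 2 / d ^ 6 := by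
        rw [div_le_div_iff₀ (by positivity) (by positivity)]
        nlinarith [mul_le_mul_of_nonneg_left hd4 (pow_pos hpos 5).le]
      have h6 : (T - 2 * t) ^ 2 ≤ T ^ 2 := sq_le_sq' (abs_le.1 hτ).1 (abs_le.1 hτ).2
      have h7 : 20 * (T - 2 * t) ^ 2 / d ^ 6 ≤ 20 * T ^ 2 / d ^ 6 := by gcongr
      have h8 : 22 * T ^ 2 / d ^ 6 = 20 * T ^ 2 / d ^ 6 + 2 * T ^ 2 / d ^ 6 := by ring
      rw [h8]
      gcongr
    refine h1.trans ?_
    have h2 : s * (22 * T ^ 2 / d ^ 6) = (22 * s * (s₀ * T ^ 2 * d ^ 2)) / (s₀ * d ^ 8) := by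
      field_simp
    have h3 : 22 / s₀ * (s * Theta T t) ^ 2 = 22 * s * s / (s₀ * d ^ 8) := by
      rw [Theta, ← hd]; field_simp
    rw [h2, h3]
    have h4 : s₀ * T ^ 2 * d ^ 2 ≤ s := by
      calc s₀ * T ^ 2 * d ^ 2 ≤ s₀ * T ^ 2 * (T ^ 2) ^ 2 := by gcongr
        _ = s₀ * T ^ 6 := by ring
        _ ≤ s := hsT 6 (by norm_num)
    gcongr

end Time

/-! ### Classical solutions and the conjugated function. -/

/-- A classical solution of the degenerate equation, with flux `Q = r^α ∂_r φ`, that vanishes near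
the initial and the final time. -/
structure IsClassical (α T : ℝ) (φ Q φt Qt Qr : ℝ → ℝ → ℝ) : Prop where
  cφ : ContinuousOn (Function.uncurry φ) (univ ×ˢ Icc (0 : ℝ) 1)
  cQ : ContinuousOn (Function.uncurry Q) (univ ×ˢ Icc (0 : ℝ) 1)
  cφt : ContinuousOn (Function.uncurry φt) (univ ×ˢ Icc (0 : ℝ) 1)
  cQt : ContinuousOn (Function.uncurry Qt) (univ ×ˢ Icc (0 : ℝ) 1)
  cQr : ContinuousOn (Function.uncurry Qr) (univ ×ˢ Icc (0 : ℝ) 1)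
  φ_r : ∀ t, ∀ r ∈ Ioo (0 : ℝ) 1, HasDerivAt (φ t) ((r ^ α)⁻¹ * Q t r) r
  Q_r : ∀ t, ∀ r ∈ Ioo (0 : ℝ) 1, HasDerivAt (Q t) (Qr t r) r
  φt_r : ∀ t, ∀ r ∈ Ioo (0 : ℝ) 1, HasDerivAt (φt t) ((r ^ α)⁻¹ * Qt t r) r
  φ_t : ∀ t r, HasDerivAt (fun t => φ t r) (φt t r) t
  Q_t : ∀ t r, HasDerivAt (fun t => Q t r) (Qt t r) t
  φ_zero : ∀ t, φ t 0 = 0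
  φ_one : ∀ t, φ t 1 = 0
  φt_zero : ∀ t, φt t 0 = 0
  φt_one : ∀ t, φt t 1 = 0
  decay : ∀ t, ∃ C, ∀ r ∈ Ioo (0 : ℝ) 1, |φ t r| ≤ C * r ^ (1 - α)
  supp : ∃ δ > 0, ∀ t, t ∉ Icc δ (T - δ) → ∀ r, φ t r = 0 ∧ Q t r = 0 ∧ φt t r = 0 ∧
    Qt t r = 0 ∧ Qr t r = 0

/-- The derivative is stated in the same letters as the left side of `carleman_pointwise`, so that
the two chain without rearrangement. The flux `Q` is differentiated as one function: `z_r` itself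
may blow up at `0`, while `Q = w z_r` stays continuous. -/
theorem hasDerivAt_flux {α r ρ w y yt qr m p p1 p2 v v' ζ ζ1 X c1 c2 : ℝ}
    {Z Q Zt M P P1 V Z0 B : ℝ → ℝ}
    (hZ : HasDerivAt Z y r) (hQ : HasDerivAt Q qr r) (hZt : HasDerivAt Zt yt r)
    (hM : HasDerivAt M (w⁻¹ * (p1 - α * p * ρ)) r) (hP : HasDerivAt P p1 r)
    (hP1 : HasDerivAt P1 p2 r) (hV : HasDerivAt V v' r) (hζ : HasDerivAt Z0 ζ1 r)
    (hB : HasDerivAt B ((α - 1) * (w * ρ ^ 2)) r)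
    (hw : w ≠ 0) (eQ : Q r = w * y) (eM : M r = m) (eP : P r = p) (ep : p = w * m)
    (eP1 : P1 r = p1) (eV : V r = v) (eζ : Z0 r = ζ) (eB : B r = w * ρ) :
    HasDerivAt (fun x => -2 * (Q x * Zt x) - 2 * X * (M x * Q x ^ 2) - 2 * X * (P1 x * Z x * Q x)
        + 2 * X * (V x * P x * Z x ^ 2)
        + c1 * (X ^ 2 * (Z0 x ^ 2 * P x * Z x ^ 2) - X * (Z0 x ^ 2 * Z x * Q x))
        + c2 * (B x * Z x ^ 2))
      (-2 * qr * Zt r - 2 * w * y * yt - 2 * X * ((p1 - α * p * ρ) * w * y ^ 2 + 2 * p * y * qr)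
      - 2 * X * (p2 * Z r * (w * y) + p1 * y * (w * y) + p1 * Z r * qr)
      + 2 * X * (v' * p * Z r ^ 2 + v * (p1 * Z r ^ 2 + 2 * p * Z r * y))
      + c1 * (X ^ 2 * (2 * ζ * ζ1 * p * Z r ^ 2 + ζ ^ 2 * p1 * Z r ^ 2 + ζ ^ 2 * p * (2 * Z r * y))
        - X * (2 * ζ * ζ1 * Z r * (w * y) + ζ ^ 2 * y * (w * y) + ζ ^ 2 * Z r * qr))
      + c2 * ((α - 1) * (w * ρ ^ 2) * Z r ^ 2 + 2 * (w * ρ) * Z r * y)) r := by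
  have h := ((((((hQ.fun_mul hZt).const_mul (-2)).fun_sub
    ((hM.fun_mul (hQ.fun_pow 2)).const_mul (2 * X))).fun_sub
    (((hP1.fun_mul hZ).fun_mul hQ).const_mul (2 * X))).fun_add
    (((hV.fun_mul hP).fun_mul (hZ.fun_pow 2)).const_mul (2 * X))).fun_add
    ((((((hζ.fun_pow 2).fun_mul hP).fun_mul (hZ.fun_pow 2)).const_mul (X ^ 2)).fun_sub
      ((((hζ.fun_pow 2).fun_mul hZ).fun_mul hQ).const_mul X)).const_mul c1)).fun_add
    ((hB.fun_mul (hZ.fun_pow 2)).const_mul c2)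
  refine h.congr_deriv ?_
  rw [eQ, eM, eP, eP1, eV, eζ, eB, ep]
  have h1 : w⁻¹ * (p1 - α * (w * m) * ρ) * (w * y) ^ 2
      = (p1 - α * (w * m) * ρ) * w * y ^ 2 := by field_simp
  rw [h1]
  push_cast
  ring

/-- The weight `e^{-sξ}` with `ξ = Θ (γ - η)`. -/
def conjWeight (s T γ : ℝ) (η : ℝ → ℝ) (t r : ℝ) : ℝ :=
  Real.exp (-(s * Theta T t * (γ - η r)))

/-- The conjugated function `e^{-sξ} φ`. -/
def conjFun (s T γ : ℝ) (η : ℝ → ℝ) (φ : ℝ → ℝ → ℝ) (t r : ℝ) : ℝ :=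
  conjWeight s T γ η t r * φ t r

/-- The flux of the conjugated function. -/
def conjFlux (s T γ α : ℝ) (η m : ℝ → ℝ) (φ Q : ℝ → ℝ → ℝ) (t r : ℝ) : ℝ :=
  conjWeight s T γ η t r * (Q t r + s * Theta T t * (r ^ α * m r) * φ t r)

/-- The time derivative of the conjugated function. -/
def conjFunDt (s T γ : ℝ) (η : ℝ → ℝ) (φ φt : ℝ → ℝ → ℝ) (t r : ℝ) : ℝ :=
  conjWeight s T γ η t r * (φt t r - s * Theta1 T t * (γ - η r) * φ t r)

/-- The time derivative of the flux of the conjugated function. -/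
def conjFluxDt (s T γ α : ℝ) (η m : ℝ → ℝ) (φ Q φt Qt : ℝ → ℝ → ℝ) (t r : ℝ) : ℝ :=
  conjWeight s T γ η t r * (Qt t r + s * Theta1 T t * (r ^ α * m r) * φ t r
    + s * Theta T t * (r ^ α * m r) * φt t r
    - s * Theta1 T t * (γ - η r) * (Q t r + s * Theta T t * (r ^ α * m r) * φ t r))

/-- The radial derivative of the flux of the conjugated function. -/
def conjFluxDr (s T γ α : ℝ) (η m p1 : ℝ → ℝ) (φ Q Qr : ℝ → ℝ → ℝ) (t r : ℝ) : ℝ :=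
  conjWeight s T γ η t r * (Qr t r + s * Theta T t * p1 r * φ t r
    + s * Theta T t * (r ^ α * m r) * ((r ^ α)⁻¹ * Q t r)
    + s * Theta T t * m r * (Q t r + s * Theta T t * (r ^ α * m r) * φ t r))

/-- The potential of the symmetric part of the conjugated operator. -/
def conjPot (s T γ α N : ℝ) (η m : ℝ → ℝ) (t r : ℝ) : ℝ :=
  s * Theta1 T t * (γ - η r) - (s * Theta T t) ^ 2 * (r ^ α * m r * m r) + N

/-- The radial flux in the divergence inequality. -/
def radialFlux (s T γ α N κ0 K0 : ℝ) (η m p1 ζ : ℝ → ℝ) (φ Q φt : ℝ → ℝ → ℝ) (t x : ℝ) : ℝ :=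
  -2 * (conjFlux s T γ α η m φ Q t x * conjFunDt s T γ η φ φt t x)
    - 2 * (s * Theta T t) * (m x * conjFlux s T γ α η m φ Q t x ^ 2)
    - 2 * (s * Theta T t) * (p1 x * conjFun s T γ η φ t x * conjFlux s T γ α η m φ Q t x)
    + 2 * (s * Theta T t) * (conjPot s T γ α N η m t x * (x ^ α * m x) * conjFun s T γ η φ t x ^ 2)
    + 4 * K0 * ((s * Theta T t) ^ 2 * (ζ x ^ 2 * (x ^ α * m x) * conjFun s T γ η φ t x ^ 2)
      - s * Theta T t * (ζ x ^ 2 * conjFun s T γ η φ t x * conjFlux s T γ α η m φ Q t x))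
    + κ0 / 2 * (s * Theta T t) * ((1 - α) / 2) * (x ^ α * x⁻¹ * conjFun s T γ η φ t x ^ 2)

/-- The density of the energy in the divergence inequality. -/
def energyDensity (s T γ α N K0 : ℝ) (η m ζ : ℝ → ℝ) (φ Q : ℝ → ℝ → ℝ) (t r : ℝ) : ℝ :=
  (r ^ α)⁻¹ * conjFlux s T γ α η m φ Q t r ^ 2
    + conjPot s T γ α N η m t r * conjFun s T γ η φ t r ^ 2
    + 2 * K0 * (s * Theta T t * ζ r ^ 2 * conjFun s T γ η φ t r ^ 2)

/-- The time derivative of `energyDensity`. -/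
def energyDensityDt (s T γ α N K0 : ℝ) (η m ζ : ℝ → ℝ) (φ Q φt Qt : ℝ → ℝ → ℝ) (t r : ℝ) : ℝ :=
  2 * (r ^ α)⁻¹ * conjFlux s T γ α η m φ Q t r * conjFluxDt s T γ α η m φ Q φt Qt t r
    + (s * Theta2 T t * (γ - η r) - 2 * (s * Theta T t) * (s * Theta1 T t) * (r ^ α * m r * m r))
      * conjFun s T γ η φ t r ^ 2
    + conjPot s T γ α N η m t r * (2 * conjFun s T γ η φ t r * conjFunDt s T γ η φ φt t r)
    + 2 * K0 * (s * Theta1 T t * ζ r ^ 2 * conjFun s T γ η φ t r ^ 2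
      + s * Theta T t * ζ r ^ 2 * (2 * conjFun s T γ η φ t r * conjFunDt s T γ η φ φt t r))

section Calculus
variable {s T γ α N κ0 K0 Cb a b : ℝ} {η m p1 p2 ζ ζ1 : ℝ → ℝ} {φ Q φt Qt Qr : ℝ → ℝ → ℝ} {t r : ℝ}

theorem conjWeight_r (hη : HasDerivAt η (m r) r) :
    HasDerivAt (conjWeight s T γ η t) (conjWeight s T γ η t r * (s * Theta T t * m r)) r := by
  have h := ((hη.const_sub γ).const_mul (s * Theta T t)).fun_neg.exp
  refine h.congr_deriv ?_
  rw [conjWeight]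
  ring

theorem conjWeight_t (ht : t ∈ Ioo 0 T) :
    HasDerivAt (fun t => conjWeight s T γ η t r)
      (conjWeight s T γ η t r * (-(s * Theta1 T t * (γ - η r)))) t := by
  have h := (((hasDerivAt_Theta ht).const_mul s).mul_const (γ - η r)).fun_neg.exp
  exact h

theorem conjFun_t (ht : t ∈ Ioo 0 T) (hφ : HasDerivAt (fun t => φ t r) (φt t r) t) :
    HasDerivAt (fun t => conjFun s T γ η φ t r) (conjFunDt s T γ η φ φt t r) t := by
  refine ((conjWeight_t ht).fun_mul hφ).congr_deriv ?_
  rw [conjFunDt]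
  ring

theorem conjFlux_t (ht : t ∈ Ioo 0 T) (hφ : HasDerivAt (fun t => φ t r) (φt t r) t)
    (hQ : HasDerivAt (fun t => Q t r) (Qt t r) t) :
    HasDerivAt (fun t => conjFlux s T γ α η m φ Q t r)
      (conjFluxDt s T γ α η m φ Q φt Qt t r) t := by
  have h := (conjWeight_t (s := s) (γ := γ) (η := η) (r := r) ht).fun_mul
    (hQ.fun_add ((((hasDerivAt_Theta ht).const_mul s).mul_const (r ^ α * m r)).fun_mul hφ))
  refine h.congr_deriv ?_
  rw [conjFluxDt]
  ring

theorem conjFun_r (hr : 0 < r) (hη : HasDerivAt η (m r) r)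
    (hφ : HasDerivAt (φ t) ((r ^ α)⁻¹ * Q t r) r) :
    HasDerivAt (conjFun s T γ η φ t) ((r ^ α)⁻¹ * conjFlux s T γ α η m φ Q t r) r := by
  have hw := (Real.rpow_pos_of_pos hr α).ne'
  refine ((conjWeight_r hη).fun_mul hφ).congr_deriv ?_
  rw [conjFlux]
  field_simp
  ring

theorem conjFlux_r (hη : HasDerivAt η (m r) r)
    (hp : HasDerivAt (fun x => x ^ α * m x) (p1 r) r)
    (hφ : HasDerivAt (φ t) ((r ^ α)⁻¹ * Q t r) r) (hQ : HasDerivAt (Q t) (Qr t r) r) :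
    HasDerivAt (conjFlux s T γ α η m φ Q t) (conjFluxDr s T γ α η m p1 φ Q Qr t r) r := by
  have h := (conjWeight_r (s := s) (T := T) (γ := γ) (t := t) hη).fun_mul
    (hQ.fun_add ((hp.const_mul (s * Theta T t)).fun_mul hφ))
  refine h.congr_deriv ?_
  rw [conjFluxDr]
  ring

theorem conjFunDt_r (hr : 0 < r) (hη : HasDerivAt η (m r) r)
    (hφ : HasDerivAt (φ t) ((r ^ α)⁻¹ * Q t r) r)
    (hφt : HasDerivAt (φt t) ((r ^ α)⁻¹ * Qt t r) r) :
    HasDerivAt (conjFunDt s T γ η φ φt t) ((r ^ α)⁻¹ * conjFluxDt s T γ α η m φ Q φt Qt t r) r := by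
  have hw := (Real.rpow_pos_of_pos hr α).ne'
  have h := (conjWeight_r (s := s) (T := T) (γ := γ) (t := t) hη).fun_mul
    (hφt.fun_sub ((((hη.const_sub γ)).const_mul (s * Theta1 T t)).fun_mul hφ))
  refine h.congr_deriv ?_
  rw [conjFluxDt]
  field_simp
  ring

theorem energyDensity_t (ht : t ∈ Ioo 0 T) (hφ : HasDerivAt (fun t => φ t r) (φt t r) t)
    (hQ : HasDerivAt (fun t => Q t r) (Qt t r) t) :
    HasDerivAt (fun t => energyDensity s T γ α N K0 η m ζ φ Q t r)
      (energyDensityDt s T γ α N K0 η m ζ φ Q φt Qt t r) t := by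
  have hz := conjFun_t (s := s) (γ := γ) (η := η) ht hφ
  have hq := conjFlux_t (s := s) (γ := γ) (α := α) (m := m) (η := η) ht hφ hQ
  have hΘ := (hasDerivAt_Theta ht).const_mul s
  have hΘ1 := (hasDerivAt_Theta1 ht).const_mul s
  have hV := ((hΘ1.mul_const (γ - η r)).fun_sub
    ((hΘ.fun_pow 2).mul_const (r ^ α * m r * m r))).add_const N
  have h := (((hq.fun_pow 2).const_mul (r ^ α)⁻¹).fun_add (hV.fun_mul (hz.fun_pow 2))).fun_add
    (((hΘ.mul_const (ζ r ^ 2)).fun_mul (hz.fun_pow 2)).const_mul (2 * K0))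
  refine h.congr_deriv ?_
  rw [energyDensityDt, conjPot]
  push_cast
  ring

/-- Quotient rule for `m = p / w`. This is where the term `α p / r` of `κ` comes from. -/
theorem m_r (hr : 0 < r) (hp : HasDerivAt (fun x => x ^ α * m x) (p1 r) r) :
    HasDerivAt m ((r ^ α)⁻¹ * (p1 r - α * (r ^ α * m r) * r⁻¹)) r := by
  have hw := (Real.rpow_pos_of_pos hr α).ne'
  have h := hp.fun_div (Real.hasDerivAt_rpow_const (p := α) (Or.inl hr.ne')) hw
  have h2 : HasDerivAt m _ r := h.congr_of_eventuallyEq (by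
    filter_upwards [Ioi_mem_nhds hr] with x hx
    have := (Real.rpow_pos_of_pos hx α).ne'
    field_simp)
  refine h2.congr_deriv ?_
  rw [Real.rpow_sub_one hr.ne']
  field_simp

theorem conjPot_r (hr : 0 < r) (hη : HasDerivAt η (m r) r)
    (hp : HasDerivAt (fun x => x ^ α * m x) (p1 r) r) :
    HasDerivAt (conjPot s T γ α N η m t) (-(s * Theta1 T t) * m r
      - (s * Theta T t) ^ 2 * m r * (2 * p1 r - α * (r ^ α * m r) * r⁻¹)) r := by
  have hw := (Real.rpow_pos_of_pos hr α).ne'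
  have h := (((hη.const_sub γ).const_mul (s * Theta1 T t)).fun_sub
    ((hp.fun_mul (m_r hr hp)).const_mul ((s * Theta T t) ^ 2))).add_const N
  refine h.congr_deriv ?_
  field_simp
  ring

theorem hardy_weight_r (hr : 0 < r) :
    HasDerivAt (fun x : ℝ => x ^ α * x⁻¹) ((α - 1) * (r ^ α * r⁻¹ ^ 2)) r := by
  have h := (Real.hasDerivAt_rpow_const (p := α) (Or.inl hr.ne')).fun_mul (hasDerivAt_inv hr.ne')
  refine h.congr_deriv ?_
  rw [Real.rpow_sub_one hr.ne']
  field_simp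
  ring

/-- The computation behind the splitting into skew and symmetric parts: it identifies `F = A + S` in
`carleman_pointwise` with the weighted right-hand side. -/
theorem conjFluxDr_spec (hr : 0 < r) :
    conjFunDt s T γ η φ φt t r + s * Theta T t * (2 * (r ^ α * m r) *
        ((r ^ α)⁻¹ * conjFlux s T γ α η m φ Q t r) + p1 r * conjFun s T γ η φ t r)
      - conjFluxDr s T γ α η m p1 φ Q Qr t r
      + (s * Theta1 T t * (γ - η r) - (s * Theta T t) ^ 2 * (r ^ α * m r * m r) + N)
        * conjFun s T γ η φ t r
    = conjWeight s T γ η t r * (φt t r - Qr t r + N * φ t r) := by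
  have hw := (Real.rpow_pos_of_pos hr α).ne'
  rw [conjFunDt, conjFlux, conjFun, conjFluxDr]
  field_simp
  ring

/-- The divergence inequality for the conjugated function. -/
theorem radialFlux_le (hW : SpatialWeight α a b γ η m p1 p2 ζ ζ1 κ0 K0 Cb) (hα0 : 0 < α)
    (hα1 : α < 1) (hN : 0 ≤ N)
    {s₀ : ℝ} (hs₀ : 22 ≤ s₀) (hε2 : 5 * (22 / s₀) * Cb + 2 * Cb * (22 / s₀) / κ0 ≤ κ0)
    (hε3 : 4 * (22 / s₀) * Cb ≤ κ0 * (1 - α) ^ 2)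
    (hs : s₀ * max 1 (T ^ 16) ≤ s) (hc : IsClassical α T φ Q φt Qt Qr) (ht : t ∈ Ioo 0 T)
    (hr : r ∈ Ioo (0 : ℝ) 1) :
    ∃ D, HasDerivAt (radialFlux s T γ α N κ0 K0 η m p1 ζ φ Q φt t) D r ∧
      D ≤ 2 * (conjWeight s T γ η t r * (φt t r - Qr t r + N * φ t r)) ^ 2
        + (16 * K0 ^ 2 + 6 * K0 + 24 * K0 * Cb) * ((s * Theta T t) ^ 3 *
          (Ioo a b).indicator 1 r * conjFun s T γ η φ t r ^ 2)
        - κ0 * (s * Theta T t * ((r ^ α)⁻¹ * conjFlux s T γ α η m φ Q t r ^ 2)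
          + (s * Theta T t) ^ 3 * (r ^ (2 - α) * conjFun s T γ η φ t r ^ 2))
        - energyDensityDt s T γ α N K0 η m ζ φ Q φt Qt t r := by
  have hr0 := hr.1
  have hwp := Real.rpow_pos_of_pos hr0 α
  have hw := hwp.ne'
  have hη := hW.η_deriv r hr
  have hp := hW.p_deriv r hr
  have hφ := hc.φ_r t r hr
  have hD := hasDerivAt_flux (α := α) (X := s * Theta T t) (c1 := 4 * K0)
    (c2 := κ0 / 2 * (s * Theta T t) * ((1 - α) / 2)) (ρ := r⁻¹) (w := r ^ α)
    (conjFun_r (s := s) (T := T) (γ := γ) hr0 hη hφ)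
    (conjFlux_r (s := s) (T := T) (γ := γ) hη hp hφ (hc.Q_r t r hr))
    (conjFunDt_r (s := s) (T := T) (γ := γ) hr0 hη hφ (hc.φt_r t r hr))
    (m_r hr0 hp) hp (hW.p1_deriv r hr)
    (conjPot_r (s := s) (T := T) (γ := γ) (N := N) (t := t) hr0 hη hp) (hW.ζ_deriv r hr)
    (hardy_weight_r hr0) hw (by field_simp) rfl rfl rfl rfl rfl rfl rfl
  refine ⟨_, hD, ?_⟩
  obtain ⟨hX, hH1, hH2⟩ := Theta_bounds (by linarith) hs ht
  have hs0 : 0 < s₀ := by linarith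
  have hκ := hW.coercive r hr
  have key := carleman_pointwise (α := α) (r := r) (ρ := r⁻¹) (w := r ^ α) (W := r ^ (2 - α))
    (m := m r) (p := r ^ α * m r) (p1 := p1 r) (p2 := p2 r) (ζ := ζ r) (ζ1 := ζ1 r)
    (ind := (Ioo a b).indicator 1 r) (X := s * Theta T t) (H1 := s * Theta1 T t)
    (H2 := s * Theta2 T t) (G := γ - η r) (N := N) (K0 := K0) (κ0 := κ0) (Cb := Cb)
    (ε := 22 / s₀) (z := conjFun s T γ η φ t r)
    (y := (r ^ α)⁻¹ * conjFlux s T γ α η m φ Q t r)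
    (zt := conjFunDt s T γ η φ φt t r) (yt := (r ^ α)⁻¹ * conjFluxDt s T γ α η m φ Q φt Qt t r)
    (qr := conjFluxDr s T γ α η m p1 φ Q Qr t r)
    (F := conjWeight s T γ η t r * (φt t r - Qr t r + N * φ t r))
    (mul_inv_cancel₀ hr0.ne') hwp (Real.rpow_pos_of_pos hr0 _)
    (by rw [← Real.rpow_add hr0, sub_add_cancel, Real.rpow_two])
    (Real.rpow_le_one hr0.le hr.2.le hα0.le) (Real.rpow_le_one hr0.le hr.2.le (by linarith))
    rfl hW.κ0_pos hW.K0_pos hN hκ (hW.coercive' r hr) (hW.pm_le r hr) (hW.p2_le r hr)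
    (hW.le_Cb r (Ioo_subset_Icc_self hr)) hW.one_le_Cb (hW.ζ_le r)
    (indicator_le' (fun _ _ => le_rfl) (fun _ _ => zero_le_one) r) (hW.ζ1_le r) (hW.p_le r hr)
    (by linarith) hH1 hH2
    (by
      -- With `ε = 22 / s₀`, the requirement `1 ≤ ε X²` follows from `ε s₀² = 22 s₀`.
      have h1 : s₀ ^ 2 ≤ (s * Theta T t) ^ 2 := pow_le_pow_left₀ hs0.le hX 2
      have h2 : 22 / s₀ * s₀ ^ 2 ≤ 22 / s₀ * (s * Theta T t) ^ 2 := by gcongr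
      have h3 : 22 / s₀ * s₀ ^ 2 = 22 * s₀ := by field_simp
      linarith)
    (by positivity) (by rw [div_le_one hs0]; exact hs₀) hε2 hε3
    (conjFluxDr_spec hr0).symm
  have e1 : r ^ α * ((r ^ α)⁻¹ * conjFlux s T γ α η m φ Q t r) ^ 2
      = (r ^ α)⁻¹ * conjFlux s T γ α η m φ Q t r ^ 2 := by field_simp
  rw [e1] at key
  have e2 : energyDensityDt s T γ α N K0 η m ζ φ Q φt Qt t r
      = (2 * r ^ α * ((r ^ α)⁻¹ * conjFlux s T γ α η m φ Q t r)
          * ((r ^ α)⁻¹ * conjFluxDt s T γ α η m φ Q φt Qt t r)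
        + (s * Theta2 T t * (γ - η r) - 2 * (s * Theta T t) * (s * Theta1 T t)
          * (r ^ α * m r * m r)) * conjFun s T γ η φ t r ^ 2
        + (s * Theta1 T t * (γ - η r) - (s * Theta T t) ^ 2 * (r ^ α * m r * m r) + N)
          * (2 * conjFun s T γ η φ t r * conjFunDt s T γ η φ φt t r)
        + 2 * K0 * (s * Theta1 T t * ζ r ^ 2 * conjFun s T γ η φ t r ^ 2
          + s * Theta T t * ζ r ^ 2 * (2 * conjFun s T γ η φ t r * conjFunDt s T γ η φ φt t r))) := by
    rw [energyDensityDt, conjPot]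
    field_simp
  rw [e2]
  have := le_sub_iff_add_le.2 key
  refine this.trans' (le_of_eq ?_)
  rw [conjPot]

end Calculus

/-! ### Integration over the space-time rectangle. -/

/-- Lebesgue measure on `(0, T) × (0, 1)`. -/
def rectMeasure (T : ℝ) : Measure (ℝ × ℝ) :=
  (volume.restrict (Ioo 0 T)).prod (volume.restrict (Ioo (0 : ℝ) 1))

theorem rectMeasure_eq (T : ℝ) :
    rectMeasure T = (volume : Measure (ℝ × ℝ)).restrict (Ioo 0 T ×ˢ Ioo (0 : ℝ) 1) := by
  rw [rectMeasure, Measure.prod_restrict]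
  rfl

theorem ae_rectMeasure (T : ℝ) : ∀ᵐ x ∂(rectMeasure T), x ∈ Ioo 0 T ×ˢ Ioo (0 : ℝ) 1 := by
  rw [rectMeasure_eq]
  exact ae_restrict_mem (measurableSet_Ioo.prod measurableSet_Ioo)

theorem integrable_rpow_inv {α : ℝ} (hα1 : α < 1) :
    Integrable (fun r : ℝ => (r ^ α)⁻¹) (volume.restrict (Ioo (0 : ℝ) 1)) := by
  have h := (intervalIntegral.intervalIntegrable_rpow' (a := 0) (b := 1) (r := -α) (by linarith)).1
  refine (IntegrableOn.mono_set h Ioo_subset_Ioc_self).congr ?_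
  filter_upwards [ae_restrict_mem measurableSet_Ioo] with r hr
  rw [Real.rpow_neg hr.1.le]

/-- A continuous function is bounded on the compact set `[δ, T - δ] × [0, 1]`, and the singular
factor `r^(-α)` is integrable because `α < 1`. -/
theorem integrable_rect {α T δ : ℝ} (hα1 : α < 1) (hδ : 0 < δ) {k : ℝ × ℝ → ℝ}
    (hk : ContinuousOn k (Ioo 0 T ×ˢ Icc (0 : ℝ) 1))
    (hsupp : ∀ x, x.1 ∉ Icc δ (T - δ) → k x = 0) :
    Integrable (fun x => k x * (x.2 ^ α)⁻¹) (rectMeasure T) := by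
  have hsub : Icc δ (T - δ) ×ˢ Icc (0 : ℝ) 1 ⊆ Ioo 0 T ×ˢ Icc (0 : ℝ) 1 :=
    prod_mono (Icc_subset_Ioo hδ (by linarith)) le_rfl
  obtain ⟨M, hM⟩ := (isCompact_Icc.prod isCompact_Icc).exists_bound_of_continuousOn (hk.mono hsub)
  have hI : Integrable (fun x : ℝ × ℝ => |M| * (x.2 ^ α)⁻¹) (rectMeasure T) :=
    ((integrable_rpow_inv hα1).comp_snd (volume.restrict (Ioo 0 T))).const_mul |M|
  refine hI.mono' ?_ ?_
  · refine AEStronglyMeasurable.mul ?_ ((integrable_rpow_inv hα1).comp_snd (volume.restrict (Ioo 0 T))).1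
    rw [rectMeasure_eq]
    exact (hk.mono (prod_mono le_rfl Ioo_subset_Icc_self)).aestronglyMeasurable
      (measurableSet_Ioo.prod measurableSet_Ioo)
  · filter_upwards [ae_rectMeasure T] with x hx
    have h0 : 0 ≤ (x.2 ^ α)⁻¹ := inv_nonneg.2 (Real.rpow_nonneg hx.2.1.le _)
    rw [norm_mul, Real.norm_of_nonneg h0]
    refine mul_le_mul_of_nonneg_right ?_ h0
    by_cases h : x.1 ∈ Icc δ (T - δ)
    · exact (hM x ⟨h, Ioo_subset_Icc_self hx.2⟩).trans (le_abs_self M)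
    · rw [hsupp x h, norm_zero]
      exact abs_nonneg M

section
variable {s T γ α N κ0 K0 Cb a b : ℝ} {η m p1 p2 ζ ζ1 : ℝ → ℝ} {φ Q φt Qt Qr : ℝ → ℝ → ℝ} {t r : ℝ}

theorem continuousOn_Theta : ContinuousOn (Theta T) (Ioo 0 T) := fun _ ht =>
  (hasDerivAt_Theta ht).continuousAt.continuousWithinAt

theorem continuousOn_Theta1 : ContinuousOn (Theta1 T) (Ioo 0 T) := fun _ ht =>
  (hasDerivAt_Theta1 ht).continuousAt.continuousWithinAt

theorem continuousOn_Theta2 : ContinuousOn (Theta2 T) (Ioo 0 T) := by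
  have hd : ContinuousOn (fun t => t * (T - t)) (Ioo 0 T) := by fun_prop
  have h0 : ∀ k, ∀ t ∈ Ioo 0 T, (t * (T - t)) ^ k ≠ 0 := fun k t ht =>
    pow_ne_zero k (time_pos ht).ne'
  have h1 : ContinuousOn (fun t => 20 * (T - 2 * t) ^ 2) (Ioo 0 T) := by fun_prop
  exact (h1.div (hd.pow 6) (h0 6)).add (continuousOn_const.div (hd.pow 5) (h0 5))

/-- Only the Hardy term `r^(α-1) z²` is singular. The decay `|z| ≤ C r^(1-α)` bounds it by `C²
r^(1-α)`, so it is continuous at `0` with value `0`, which is also what Lean's `0⁻¹ = 0` yields. -/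
theorem radialFlux_continuousOn (hW : SpatialWeight α a b γ η m p1 p2 ζ ζ1 κ0 K0 Cb)
    (hα0 : 0 < α) (hα1 : α < 1) (hc : IsClassical α T φ Q φt Qt Qr) (hs : 0 ≤ s) :
    ContinuousOn (radialFlux s T γ α N κ0 K0 η m p1 ζ φ Q φt t) (Icc 0 1) := by
  have sec : ∀ {F : ℝ → ℝ → ℝ}, ContinuousOn (Function.uncurry F) (univ ×ˢ Icc (0 : ℝ) 1) →
      ContinuousOn (F t) (Icc 0 1) := fun hF =>
    hF.comp (f := fun r => (t, r)) (by fun_prop) fun r hr => ⟨mem_univ _, hr⟩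
  have c1 := sec hc.cφ
  have c2 := sec hc.cQ
  have c3 := sec hc.cφt
  have c4 := hW.η_cont
  have c5 := hW.m_cont
  have c6 := hW.p1_cont
  have c7 : ContinuousOn ζ (Icc 0 1) := hW.ζ_cont.continuousOn
  have c8 : ContinuousOn (fun x : ℝ => x ^ α) (Icc 0 1) :=
    (Real.continuous_rpow_const hα0.le).continuousOn
  have d0 : ContinuousOn (conjWeight s T γ η t) (Icc 0 1) := by unfold conjWeight; fun_prop
  have d1 : ContinuousOn (conjFun s T γ η φ t) (Icc 0 1) := d0.mul c1
  have d3 : ContinuousOn (conjFunDt s T γ η φ φt t) (Icc 0 1) := by unfold conjFunDt; fun_prop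
  have c9 : ContinuousOn (fun x : ℝ => x ^ α * m x) (Icc 0 1) := c8.mul c5
  have d2 : ContinuousOn (conjFlux s T γ α η m φ Q t) (Icc 0 1) :=
    d0.mul (c2.add ((continuousOn_const.mul c9).mul c1))
  have d4 : ContinuousOn (conjPot s T γ α N η m t) (Icc 0 1) :=
    ((continuousOn_const.mul (continuousOn_const.sub c4)).sub
      (continuousOn_const.mul (c9.mul c5))).add continuousOn_const
  have d5 : ContinuousOn (fun x => x ^ α * x⁻¹ * conjFun s T γ η φ t x ^ 2) (Icc 0 1) := by
    intro x hx
    rcases hx.1.eq_or_lt with h | h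
    · obtain ⟨C, hC⟩ := hc.decay t
      subst h
      have hz : (0 : ℝ) ^ α * 0⁻¹ * conjFun s T γ η φ t 0 ^ 2 = 0 := by simp
      have hlim : Tendsto (fun x : ℝ => C ^ 2 * x ^ (1 - α)) (𝓝[Icc 0 1] 0) (𝓝 0) := by
        have : Continuous fun x : ℝ => C ^ 2 * x ^ (1 - α) :=
          continuous_const.mul (Real.continuous_rpow_const (by linarith))
        have h2 := this.tendsto 0
        rw [Real.zero_rpow (by linarith), mul_zero] at h2
        exact h2.mono_left nhdsWithin_le_nhds
      rw [ContinuousWithinAt, hz]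
      refine squeeze_zero_norm' ?_ hlim
      filter_upwards [self_mem_nhdsWithin, mem_nhdsWithin_of_mem_nhds (Iio_mem_nhds zero_lt_one)]
        with x hx hx1
      rcases hx.1.eq_or_lt with h0 | h0
      · rw [← h0, hz, norm_zero]
        exact mul_nonneg (sq_nonneg _) (Real.rpow_nonneg le_rfl _)
      · have hw : 0 < x ^ α := Real.rpow_pos_of_pos h0 _
        have he : conjWeight s T γ η t x ≤ 1 := by
          rw [conjWeight, Real.exp_le_one_iff, neg_nonpos]
          have := hW.one_le x hx
          have hΘ : 0 ≤ Theta T t := by rw [Theta]; positivity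
          exact mul_nonneg (mul_nonneg hs hΘ) (by linarith)
        have he0 : 0 < conjWeight s T γ η t x := Real.exp_pos _
        have h1 : |conjFun s T γ η φ t x| ≤ C * x ^ (1 - α) := by
          rw [conjFun, abs_mul, abs_of_pos he0]
          exact (mul_le_of_le_one_left (abs_nonneg _) he).trans (hC x ⟨h0, hx1⟩)
        have h2 : conjFun s T γ η φ t x ^ 2 ≤ (C * x ^ (1 - α)) ^ 2 := by
          rw [← sq_abs (conjFun s T γ η φ t x)]
          exact pow_le_pow_left₀ (abs_nonneg _) h1 2
        rw [Real.norm_of_nonneg (by positivity)]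
        refine (mul_le_mul_of_nonneg_left h2 (by positivity)).trans (le_of_eq ?_)
        rw [show 1 - α = 1 + -α by ring, Real.rpow_add h0, Real.rpow_one, Real.rpow_neg h0.le]
        field_simp
    · exact ((c8 x hx).mul (continuousAt_inv₀ h.ne').continuousWithinAt).mul ((d1 x hx).pow 2)
  exact (((((continuousOn_const.mul (d2.mul d3)).sub
    (continuousOn_const.mul (c5.mul (d2.pow 2)))).sub
    (continuousOn_const.mul ((c6.mul d1).mul d2))).add
    (continuousOn_const.mul ((d4.mul c9).mul (d1.pow 2)))).add
    (continuousOn_const.mul ((continuousOn_const.mul (((c7.pow 2).mul c9).mul (d1.pow 2))).sub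
      (continuousOn_const.mul (((c7.pow 2).mul d1).mul d2))))).add (continuousOn_const.mul d5)

/-- The Dirichlet condition kills every term except `m Q²`, and that one vanishes because `η'(0) =
0`. The flux at the degenerate point need not vanish. -/
theorem radialFlux_zero (hW : SpatialWeight α a b γ η m p1 p2 ζ ζ1 κ0 K0 Cb)
    (hc : IsClassical α T φ Q φt Qt Qr) :
    radialFlux s T γ α N κ0 K0 η m p1 ζ φ Q φt t 0 = 0 := by
  simp [radialFlux, conjFunDt, conjFun, hc.φ_zero, hc.φt_zero, hW.m_zero]

/-- The surviving boundary term is discarded thanks to `η'(1) ≤ 0`, so that no boundary observation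
is needed. -/
theorem radialFlux_one (hW : SpatialWeight α a b γ η m p1 p2 ζ ζ1 κ0 K0 Cb)
    (hc : IsClassical α T φ Q φt Qt Qr) (hs : 0 ≤ s) :
    0 ≤ radialFlux s T γ α N κ0 K0 η m p1 ζ φ Q φt t 1 := by
  have h : radialFlux s T γ α N κ0 K0 η m p1 ζ φ Q φt t 1
      = 2 * (s * Theta T t) * (-m 1 * conjFlux s T γ α η m φ Q t 1 ^ 2) := by
    simp [radialFlux, conjFunDt, conjFun, hc.φ_one, hc.φt_one]
  rw [h]
  have hΘ : 0 ≤ Theta T t := by rw [Theta]; positivity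
  have := hW.m_one
  have hm : 0 ≤ -m 1 := by linarith
  positivity

end

section
variable {s T γ α N κ0 K0 Cb a b : ℝ} {η m p1 p2 ζ ζ1 : ℝ → ℝ} {φ Q φt Qt Qr : ℝ → ℝ → ℝ}

theorem integrable_rect' {δ : ℝ} (hα0 : 0 < α) (hα1 : α < 1) (hδ : 0 < δ) {k : ℝ × ℝ → ℝ}
    (hk : ContinuousOn k (Ioo 0 T ×ˢ Icc (0 : ℝ) 1))
    (hsupp : ∀ x, x.1 ∉ Icc δ (T - δ) → k x = 0) : Integrable k (rectMeasure T) := by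
  have hw : Continuous fun x : ℝ × ℝ => x.2 ^ α :=
    (Real.continuous_rpow_const hα0.le).comp continuous_snd
  refine (integrable_rect hα1 hδ (k := fun x => k x * x.2 ^ α) (hk.mul hw.continuousOn)
    (fun x hx => by simp [hsupp x hx])).congr ?_
  filter_upwards [ae_rectMeasure T] with x hx
  have := (Real.rpow_pos_of_pos hx.2.1 α).ne'
  field_simp

theorem integral_rect {h : ℝ × ℝ → ℝ} (hh : Integrable h (rectMeasure T)) :
    ∫ t in Ioo 0 T, ∫ r in Ioo (0 : ℝ) 1, h (t, r) = ∫ x, h x ∂(rectMeasure T) :=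
  (integral_prod (μ := volume.restrict (Ioo 0 T)) (ν := volume.restrict (Ioo (0 : ℝ) 1)) _ hh).symm

theorem integral_dt_eq_zero {F F' : ℝ → ℝ} {δ : ℝ} (hδ : 0 < δ) (hT : 0 < T)
    (hF : ∀ t ∈ Ioo 0 T, HasDerivAt F (F' t) t) (hsupp : ∀ t, t ∉ Icc δ (T - δ) → F t = 0)
    (hint : Integrable F' (volume.restrict (Ioo 0 T))) : ∫ t in Ioo 0 T, F' t = 0 := by
  have hint' : IntervalIntegrable F' volume 0 T := by
    rw [intervalIntegrable_iff_integrableOn_Ioo_of_le hT.le]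
    exact hint
  have h0 : Tendsto F (𝓝[>] 0) (𝓝 0) := by
    refine tendsto_const_nhds.congr' ?_
    filter_upwards [mem_nhdsWithin_of_mem_nhds (Iio_mem_nhds hδ)] with t ht
    exact (hsupp t fun h => absurd h.1 (not_le.2 ht)).symm
  have h1 : Tendsto F (𝓝[<] T) (𝓝 0) := by
    refine tendsto_const_nhds.congr' ?_
    filter_upwards [mem_nhdsWithin_of_mem_nhds (Ioi_mem_nhds (show T - δ < T by linarith))] with t ht
    exact (hsupp t fun h => absurd h.2 (not_le.2 ht)).symm
  have h := intervalIntegral.integral_eq_sub_of_hasDerivAt_of_tendsto hT hF hint' h0 h1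
  rwa [intervalIntegral.integral_of_le hT.le, integral_Ioc_eq_integral_Ioo, sub_zero] at h

theorem integrable_integral_combination {X : Type*} [MeasurableSpace X] {μ : Measure X}
    {f1 f2 f3 f4 f5 : X → ℝ} (c κ : ℝ) (h1 : Integrable f1 μ) (h2 : Integrable f2 μ)
    (h3 : Integrable f3 μ) (h4 : Integrable f4 μ) (h5 : Integrable f5 μ) :
    Integrable (fun x => 2 * f1 x + c * f2 x - κ * (f3 x + f4 x) - f5 x) μ ∧
      ∫ x, (2 * f1 x + c * f2 x - κ * (f3 x + f4 x) - f5 x) ∂μ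
        = 2 * (∫ x, f1 x ∂μ) + c * (∫ x, f2 x ∂μ) - κ * ((∫ x, f3 x ∂μ) + ∫ x, f4 x ∂μ)
          - ∫ x, f5 x ∂μ := by
  have a1 : Integrable (fun x => 2 * f1 x + c * f2 x) μ := (h1.const_mul 2).add (h2.const_mul c)
  have a2 : Integrable (fun x => κ * (f3 x + f4 x)) μ := (h3.add h4).const_mul κ
  have a3 : Integrable (fun x => 2 * f1 x + c * f2 x - κ * (f3 x + f4 x)) μ := a1.sub a2
  refine ⟨a3.sub h5, ?_⟩
  rw [integral_sub a3 h5, integral_sub a1 a2, integral_add (h1.const_mul 2) (h2.const_mul c),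
    integral_const_mul, integral_const_mul, integral_const_mul, integral_add h3 h4]

set_option maxHeartbeats 1000000 in
/-- The Carleman estimate for classical solutions. -/
theorem carleman_classical (hW : SpatialWeight α a b γ η m p1 p2 ζ ζ1 κ0 K0 Cb) (hα0 : 0 < α)
    (hα1 : α < 1) (ha : 0 < a) (hb : b ≤ 1) (hN : 0 ≤ N) (hT : 0 < T)
    {s₀ : ℝ} (hs₀ : 22 ≤ s₀) (hε2 : 5 * (22 / s₀) * Cb + 2 * Cb * (22 / s₀) / κ0 ≤ κ0)
    (hε3 : 4 * (22 / s₀) * Cb ≤ κ0 * (1 - α) ^ 2)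
    (hs : s₀ * max 1 (T ^ 16) ≤ s) (hc : IsClassical α T φ Q φt Qt Qr) :
    (∫ t in Ioo 0 T, ∫ r in Ioo (0 : ℝ) 1,
        s * Theta T t * ((r ^ α)⁻¹ * Q t r ^ 2) * conjWeight s T γ η t r ^ 2)
      + (∫ t in Ioo 0 T, ∫ r in Ioo (0 : ℝ) 1,
        (s * Theta T t) ^ 3 * (r ^ (2 - α) * φ t r ^ 2) * conjWeight s T γ η t r ^ 2)
    ≤ (2 * Cb + 1) * (2 + (16 * K0 ^ 2 + 6 * K0 + 24 * K0 * Cb)) / κ0 *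
      ((∫ t in Ioo 0 T, ∫ r in Ioo (0 : ℝ) 1,
          (conjWeight s T γ η t r * (φt t r - Qr t r + N * φ t r)) ^ 2)
        + (∫ t in Ioo 0 T, ∫ r in Ioo a b,
          (s * Theta T t) ^ 3 * φ t r ^ 2 * conjWeight s T γ η t r ^ 2)) := by
  obtain ⟨δ, hδ, hsupp⟩ := hc.supp
  have hs0 : 0 ≤ s := by
    have : (1 : ℝ) ≤ max 1 (T ^ 16) := le_max_left _ _
    nlinarith
  have hmt : MapsTo (Prod.fst : ℝ × ℝ → ℝ) (Ioo 0 T ×ˢ Icc (0 : ℝ) 1) (Ioo 0 T) := fun x hx => hx.1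
  have hmr : MapsTo (Prod.snd : ℝ × ℝ → ℝ) (Ioo 0 T ×ˢ Icc (0 : ℝ) 1) (Icc 0 1) := fun x hx => hx.2
  have jt : ∀ {F : ℝ → ℝ}, ContinuousOn F (Ioo 0 T) →
      ContinuousOn (fun x : ℝ × ℝ => F x.1) (Ioo 0 T ×ˢ Icc (0 : ℝ) 1) := fun hF =>
    hF.comp continuousOn_fst hmt
  have jr : ∀ {F : ℝ → ℝ}, ContinuousOn F (Icc 0 1) →
      ContinuousOn (fun x : ℝ × ℝ => F x.2) (Ioo 0 T ×ˢ Icc (0 : ℝ) 1) := fun hF =>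
    hF.comp continuousOn_snd hmr
  have j2 : ∀ {F : ℝ → ℝ → ℝ}, ContinuousOn (Function.uncurry F) (univ ×ˢ Icc (0 : ℝ) 1) →
      ContinuousOn (fun x : ℝ × ℝ => F x.1 x.2) (Ioo 0 T ×ˢ Icc (0 : ℝ) 1) := fun hF =>
    hF.mono (prod_mono (subset_univ _) le_rfl)
  have cΘ := jt (continuousOn_Theta (T := T))
  have cΘ1 := jt (continuousOn_Theta1 (T := T))
  have cΘ2 := jt (continuousOn_Theta2 (T := T))
  have cη := jr hW.η_cont
  have cm := jr hW.m_cont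
  have cζ := jr hW.ζ_cont.continuousOn
  have cw : ContinuousOn (fun x : ℝ × ℝ => x.2 ^ α) (Ioo 0 T ×ˢ Icc (0 : ℝ) 1) :=
    jr (Real.continuous_rpow_const hα0.le).continuousOn
  have cW : ContinuousOn (fun x : ℝ × ℝ => x.2 ^ (2 - α)) (Ioo 0 T ×ˢ Icc (0 : ℝ) 1) :=
    jr (Real.continuous_rpow_const (by linarith)).continuousOn
  have cφ := j2 hc.cφ
  have cQ := j2 hc.cQ
  have cφt := j2 hc.cφt
  have cQt := j2 hc.cQt
  have cQr := j2 hc.cQr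
  have cG : ContinuousOn (fun x : ℝ × ℝ => γ - η x.2) (Ioo 0 T ×ˢ Icc (0 : ℝ) 1) :=
    continuousOn_const.sub cη
  have cX : ContinuousOn (fun x : ℝ × ℝ => s * Theta T x.1) (Ioo 0 T ×ˢ Icc (0 : ℝ) 1) :=
    continuousOn_const.mul cΘ
  have cH1 : ContinuousOn (fun x : ℝ × ℝ => s * Theta1 T x.1) (Ioo 0 T ×ˢ Icc (0 : ℝ) 1) :=
    continuousOn_const.mul cΘ1
  have cH2 : ContinuousOn (fun x : ℝ × ℝ => s * Theta2 T x.1) (Ioo 0 T ×ˢ Icc (0 : ℝ) 1) :=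
    continuousOn_const.mul cΘ2
  have cp : ContinuousOn (fun x : ℝ × ℝ => x.2 ^ α * m x.2) (Ioo 0 T ×ˢ Icc (0 : ℝ) 1) := cw.mul cm
  have ce : ContinuousOn (fun x : ℝ × ℝ => conjWeight s T γ η x.1 x.2)
      (Ioo 0 T ×ˢ Icc (0 : ℝ) 1) := (cX.mul cG).neg.rexp
  have cz : ContinuousOn (fun x : ℝ × ℝ => conjFun s T γ η φ x.1 x.2)
      (Ioo 0 T ×ˢ Icc (0 : ℝ) 1) := ce.mul cφ
  have cq : ContinuousOn (fun x : ℝ × ℝ => conjFlux s T γ α η m φ Q x.1 x.2)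
      (Ioo 0 T ×ˢ Icc (0 : ℝ) 1) := ce.mul (cQ.add ((cX.mul cp).mul cφ))
  have czt : ContinuousOn (fun x : ℝ × ℝ => conjFunDt s T γ η φ φt x.1 x.2)
      (Ioo 0 T ×ˢ Icc (0 : ℝ) 1) := ce.mul (cφt.sub ((cH1.mul cG).mul cφ))
  have cqt : ContinuousOn (fun x : ℝ × ℝ => conjFluxDt s T γ α η m φ Q φt Qt x.1 x.2)
      (Ioo 0 T ×ˢ Icc (0 : ℝ) 1) :=
    ce.mul (((cQt.add ((cH1.mul cp).mul cφ)).add ((cX.mul cp).mul cφt)).sub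
      ((cH1.mul cG).mul (cQ.add ((cX.mul cp).mul cφ))))
  have cV : ContinuousOn (fun x : ℝ × ℝ => conjPot s T γ α N η m x.1 x.2)
      (Ioo 0 T ×ˢ Icc (0 : ℝ) 1) :=
    ((cH1.mul cG).sub ((cX.pow 2).mul (cp.mul cm))).add continuousOn_const
  have hz0 : ∀ t r, t ∉ Icc δ (T - δ) → conjFun s T γ η φ t r = 0 := fun t r h => by
    rw [conjFun, (hsupp t h r).1, mul_zero]
  have hq0 : ∀ t r, t ∉ Icc δ (T - δ) → conjFlux s T γ α η m φ Q t r = 0 := fun t r h => by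
    rw [conjFlux, (hsupp t h r).1, (hsupp t h r).2.1]
    ring
  -- integrability
  have i1 : Integrable (fun x : ℝ × ℝ => (conjWeight s T γ η x.1 x.2 *
      (φt x.1 x.2 - Qr x.1 x.2 + N * φ x.1 x.2)) ^ 2) (rectMeasure T) :=
    integrable_rect' hα0 hα1 hδ ((ce.mul ((cφt.sub cQr).add (continuousOn_const.mul cφ))).pow 2)
      (fun x hx => by
        obtain ⟨h1, _, h3, _, h5⟩ := hsupp x.1 hx x.2
        simp [h1, h3, h5])
  have i2' : Integrable (fun x : ℝ × ℝ => (s * Theta T x.1) ^ 3 * conjFun s T γ η φ x.1 x.2 ^ 2)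
      (rectMeasure T) :=
    integrable_rect' hα0 hα1 hδ ((cX.pow 3).mul (cz.pow 2)) (fun x hx => by simp [hz0 x.1 x.2 hx])
  have i2 : Integrable (fun x : ℝ × ℝ => (s * Theta T x.1) ^ 3 * (Ioo a b).indicator 1 x.2 *
      conjFun s T γ η φ x.1 x.2 ^ 2) (rectMeasure T) := by
    refine (i2'.indicator (measurable_snd (measurableSet_Ioo (a := a) (b := b)))).congr
      (Eventually.of_forall fun x => ?_)
    by_cases h : x.2 ∈ Ioo a b
    · simp only
      rw [indicator_of_mem (show x ∈ Prod.snd ⁻¹' Ioo a b from h), indicator_of_mem h, Pi.one_apply,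
        mul_one]
    · simp only
      rw [indicator_of_notMem (show x ∉ Prod.snd ⁻¹' Ioo a b from h), indicator_of_notMem h]
      ring
  have i3 : Integrable (fun x : ℝ × ℝ => s * Theta T x.1 *
      ((x.2 ^ α)⁻¹ * conjFlux s T γ α η m φ Q x.1 x.2 ^ 2)) (rectMeasure T) :=
    (integrable_rect hα1 hδ (cX.mul (cq.pow 2)) (fun x hx => by simp [hq0 x.1 x.2 hx])).congr
      (Eventually.of_forall fun x => by simp only [Pi.mul_apply, Pi.pow_apply]; ring)
  have i4 : Integrable (fun x : ℝ × ℝ => (s * Theta T x.1) ^ 3 *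
      (x.2 ^ (2 - α) * conjFun s T γ η φ x.1 x.2 ^ 2)) (rectMeasure T) :=
    integrable_rect' hα0 hα1 hδ ((cX.pow 3).mul (cW.mul (cz.pow 2)))
      (fun x hx => by simp [hz0 x.1 x.2 hx])
  have i5 : Integrable (fun x : ℝ × ℝ =>
      energyDensityDt s T γ α N K0 η m ζ φ Q φt Qt x.1 x.2) (rectMeasure T) := by
    have h1 := integrable_rect hα1 hδ ((continuousOn_const (c := (2 : ℝ))).mul (cq.mul cqt))
      (fun x hx => by simp [hq0 x.1 x.2 hx])
    have h2 := integrable_rect' hα0 hα1 hδ ((((cH2.mul cG).sub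
      ((continuousOn_const.mul cX).mul cH1 |>.mul (cp.mul cm) : ContinuousOn
        (fun x : ℝ × ℝ => 2 * (s * Theta T x.1) * (s * Theta1 T x.1) * (x.2 ^ α * m x.2 * m x.2)) _)).mul
        (cz.pow 2)).add (cV.mul ((continuousOn_const.mul cz).mul czt : ContinuousOn
        (fun x : ℝ × ℝ => 2 * conjFun s T γ η φ x.1 x.2 * conjFunDt s T γ η φ φt x.1 x.2) _)))
      (fun x hx => by simp [hz0 x.1 x.2 hx])
    have h3 := integrable_rect' hα0 hα1 hδ ((continuousOn_const (c := 2 * K0)).mul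
      (((cH1.mul (cζ.pow 2)).mul (cz.pow 2)).add ((cX.mul (cζ.pow 2)).mul
        ((continuousOn_const (c := (2 : ℝ))).mul cz |>.mul czt))))
      (fun x hx => by simp [hz0 x.1 x.2 hx])
    refine ((h1.add h2).add h3).congr (Eventually.of_forall fun x => ?_)
    simp only [Pi.add_apply, Pi.sub_apply, Pi.mul_apply, Pi.pow_apply]
    rw [energyDensityDt]
    ring
  have i6 : Integrable (fun x : ℝ × ℝ => s * Theta T x.1 * ((x.2 ^ α)⁻¹ * Q x.1 x.2 ^ 2) *
      conjWeight s T γ η x.1 x.2 ^ 2) (rectMeasure T) :=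
    (integrable_rect hα1 hδ ((cX.mul (cQ.pow 2)).mul (ce.pow 2))
      (fun x hx => by simp [(hsupp x.1 hx x.2).2.1])).congr
      (Eventually.of_forall fun x => by simp only [Pi.mul_apply, Pi.pow_apply]; ring)
  -- the energy term integrates to zero
  have z5 : ∫ x, energyDensityDt s T γ α N K0 η m ζ φ Q φt Qt x.1 x.2 ∂(rectMeasure T) = 0 := by
    rw [rectMeasure, integral_prod_symm _ i5]
    refine integral_eq_zero_of_ae ?_
    filter_upwards [i5.prod_left_ae] with r hr
    refine integral_dt_eq_zero hδ hT (F := fun t => energyDensity s T γ α N K0 η m ζ φ Q t r)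
      (fun t ht => energyDensity_t ht (hc.φ_t t r) (hc.Q_t t r)) (fun t ht => ?_) hr
    simp only [energyDensity, hz0 t r ht, hq0 t r ht]
    ring
  -- the integrated divergence inequality
  set C' := 16 * K0 ^ 2 + 6 * K0 + 24 * K0 * Cb with hC'
  obtain ⟨iR, eR⟩ := integrable_integral_combination C' κ0 i1 i2 i3 i4 i5
  have hR : 0 ≤ ∫ x, 2 * (conjWeight s T γ η x.1 x.2 *
      (φt x.1 x.2 - Qr x.1 x.2 + N * φ x.1 x.2)) ^ 2 +
      C' * ((s * Theta T x.1) ^ 3 * (Ioo a b).indicator 1 x.2 * conjFun s T γ η φ x.1 x.2 ^ 2)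
      - κ0 * (s * Theta T x.1 * ((x.2 ^ α)⁻¹ * conjFlux s T γ α η m φ Q x.1 x.2 ^ 2)
        + (s * Theta T x.1) ^ 3 * (x.2 ^ (2 - α) * conjFun s T γ η φ x.1 x.2 ^ 2))
      - energyDensityDt s T γ α N K0 η m ζ φ Q φt Qt x.1 x.2 ∂(rectMeasure T) := by
    rw [rectMeasure, integral_prod _ iR]
    refine integral_nonneg_of_ae ?_
    filter_upwards [iR.prod_right_ae, ae_restrict_mem measurableSet_Ioo] with t hti ht
    have hcont := radialFlux_continuousOn (N := N) (t := t) hW hα0 hα1 hc hs0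
    choose! D hD using fun r (hr : r ∈ Ioo (0 : ℝ) 1) =>
      radialFlux_le hW hα0 hα1 hN hs₀ hε2 hε3 hs hc ht hr
    -- This one-sided form of the fundamental theorem of calculus needs an integrable upper bound of
    -- the derivative only, so integrability of `D` never has to be shown.
    have h := intervalIntegral.sub_le_integral_of_hasDeriv_right_of_le zero_le_one hcont
      (fun r hr => (hD r hr).1.hasDerivWithinAt) ((integrableOn_Icc_iff_integrableOn_Ioo (by simp) (by simp)).2 hti)
      (fun r hr => (hD r hr).2)
    rw [intervalIntegral.integral_of_le zero_le_one, integral_Ioc_eq_integral_Ioo,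
      radialFlux_zero hW hc, sub_zero] at h
    exact (radialFlux_one hW hc hs0).trans h
  rw [eR, z5] at hR
  -- back to the original function
  have e4 : ∀ t r, (s * Theta T t) ^ 3 * (r ^ (2 - α) * φ t r ^ 2) * conjWeight s T γ η t r ^ 2
      = (s * Theta T t) ^ 3 * (r ^ (2 - α) * conjFun s T γ η φ t r ^ 2) := fun t r => by
    rw [conjFun]; ring
  have e2 : ∫ t in Ioo 0 T, ∫ r in Ioo a b,
      (s * Theta T t) ^ 3 * φ t r ^ 2 * conjWeight s T γ η t r ^ 2
      = ∫ x, (s * Theta T x.1) ^ 3 * (Ioo a b).indicator 1 x.2 * conjFun s T γ η φ x.1 x.2 ^ 2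
        ∂(rectMeasure T) := by
    rw [← integral_rect i2]
    congr 1
    funext t
    have : ∀ r, (s * Theta T t) ^ 3 * (Ioo a b).indicator 1 r * conjFun s T γ η φ t r ^ 2
        = (Ioo a b).indicator (fun r => (s * Theta T t) ^ 3 * φ t r ^ 2 *
          conjWeight s T γ η t r ^ 2) r := fun r => by
      by_cases h : r ∈ Ioo a b
      · rw [indicator_of_mem h, indicator_of_mem h, conjFun, Pi.one_apply]; ring
      · rw [indicator_of_notMem h, indicator_of_notMem h]; ring
    simp_rw [this]
    rw [setIntegral_indicator measurableSet_Ioo,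
      inter_eq_self_of_subset_right (Ioo_subset_Ioo ha.le hb)]
  simp_rw [e4]
  have f6 := integral_rect i6
  have f4 := integral_rect i4
  have f1 := integral_rect i1
  dsimp only at f6 f4 f1
  rw [f6, f4, f1, e2]
  have hCb := hW.one_le_Cb
  have hκ := hW.κ0_pos
  -- Undoing the conjugation: `e Q` is the conjugated flux minus `X p z`, and `w⁻¹ (X p z)² = X² (p
  -- m) z²` is controlled by the zeroth order term since `p m ≤ Cb r^(2-α)`.
  have l6 : ∫ x, s * Theta T x.1 * ((x.2 ^ α)⁻¹ * Q x.1 x.2 ^ 2) *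
      conjWeight s T γ η x.1 x.2 ^ 2 ∂(rectMeasure T)
      ≤ 2 * (∫ x, s * Theta T x.1 * ((x.2 ^ α)⁻¹ * conjFlux s T γ α η m φ Q x.1 x.2 ^ 2)
        ∂(rectMeasure T)) + 2 * Cb * ∫ x, (s * Theta T x.1) ^ 3 *
        (x.2 ^ (2 - α) * conjFun s T γ η φ x.1 x.2 ^ 2) ∂(rectMeasure T) := by
    rw [← integral_const_mul, ← integral_const_mul,
      ← integral_add (i3.const_mul 2) (i4.const_mul (2 * Cb))]
    refine integral_mono_ae i6 ((i3.const_mul 2).add (i4.const_mul (2 * Cb))) ?_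
    filter_upwards [ae_rectMeasure T] with x hx
    have hw := Real.rpow_pos_of_pos hx.2.1 α
    have hX : 0 ≤ s * Theta T x.1 := mul_nonneg hs0 (by rw [Theta]; positivity)
    have hpm := hW.pm_le x.2 hx.2
    set X := s * Theta T x.1
    set w := x.2 ^ α
    set e := conjWeight s T γ η x.1 x.2
    show X * (w⁻¹ * Q x.1 x.2 ^ 2) * e ^ 2 ≤
      2 * (X * (w⁻¹ * (e * (Q x.1 x.2 + X * (w * m x.2) * φ x.1 x.2)) ^ 2)) +
      2 * Cb * (X ^ 3 * (x.2 ^ (2 - α) * (e * φ x.1 x.2) ^ 2))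
    have h1 : Q x.1 x.2 ^ 2 ≤ 2 * (Q x.1 x.2 + X * (w * m x.2) * φ x.1 x.2) ^ 2
        + 2 * (X * (w * m x.2) * φ x.1 x.2) ^ 2 := by
      nlinarith [sq_nonneg (Q x.1 x.2 + 2 * (X * (w * m x.2) * φ x.1 x.2))]
    have h2 : X * (w⁻¹ * (X * (w * m x.2) * φ x.1 x.2) ^ 2) * e ^ 2
        = (w * m x.2 * m x.2) * (X ^ 3 * (e * φ x.1 x.2) ^ 2) := by
      field_simp
    have h3 : (w * m x.2 * m x.2) * (X ^ 3 * (e * φ x.1 x.2) ^ 2)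
        ≤ (Cb * x.2 ^ (2 - α)) * (X ^ 3 * (e * φ x.1 x.2) ^ 2) :=
      mul_le_mul_of_nonneg_right hpm (by positivity)
    have h4 : X * (w⁻¹ * Q x.1 x.2 ^ 2) * e ^ 2 ≤ X * (w⁻¹ *
        (2 * (Q x.1 x.2 + X * (w * m x.2) * φ x.1 x.2) ^ 2
        + 2 * (X * (w * m x.2) * φ x.1 x.2) ^ 2)) * e ^ 2 := by gcongr
    linarith
  have n3 : 0 ≤ ∫ x, s * Theta T x.1 * ((x.2 ^ α)⁻¹ * conjFlux s T γ α η m φ Q x.1 x.2 ^ 2)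
      ∂(rectMeasure T) := by
    refine integral_nonneg_of_ae ?_
    filter_upwards [ae_rectMeasure T] with x hx
    have hw := Real.rpow_pos_of_pos hx.2.1 α
    have hX : 0 ≤ s * Theta T x.1 := mul_nonneg hs0 (by rw [Theta]; positivity)
    show 0 ≤ s * Theta T x.1 * ((x.2 ^ α)⁻¹ * conjFlux s T γ α η m φ Q x.1 x.2 ^ 2)
    positivity
  have n1 : 0 ≤ ∫ x, (conjWeight s T γ η x.1 x.2 *
      (φt x.1 x.2 - Qr x.1 x.2 + N * φ x.1 x.2)) ^ 2 ∂(rectMeasure T) :=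
    integral_nonneg fun x => sq_nonneg _
  have n2 : 0 ≤ ∫ x, (s * Theta T x.1) ^ 3 * (Ioo a b).indicator 1 x.2 *
      conjFun s T γ η φ x.1 x.2 ^ 2 ∂(rectMeasure T) := by
    refine integral_nonneg fun x => ?_
    have hX : 0 ≤ s * Theta T x.1 := mul_nonneg hs0 (by rw [Theta]; positivity)
    exact mul_nonneg (mul_nonneg (pow_nonneg hX 3)
      (indicator_nonneg (fun _ _ => zero_le_one) _)) (sq_nonneg _)
  have hC0 : 0 ≤ C' := by have := hW.K0_pos; positivity
  rw [div_mul_eq_mul_div, le_div_iff₀ hκ]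
  generalize (∫ x, s * Theta T x.1 * ((x.2 ^ α)⁻¹ * Q x.1 x.2 ^ 2) *
      conjWeight s T γ η x.1 x.2 ^ 2 ∂(rectMeasure T)) = I6 at *
  generalize (∫ x, s * Theta T x.1 * ((x.2 ^ α)⁻¹ * conjFlux s T γ α η m φ Q x.1 x.2 ^ 2)
      ∂(rectMeasure T)) = I3 at *
  generalize (∫ x, (s * Theta T x.1) ^ 3 *
        (x.2 ^ (2 - α) * conjFun s T γ η φ x.1 x.2 ^ 2) ∂(rectMeasure T)) = I4 at *
  generalize (∫ x, (conjWeight s T γ η x.1 x.2 *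
      (φt x.1 x.2 - Qr x.1 x.2 + N * φ x.1 x.2)) ^ 2 ∂(rectMeasure T)) = I1 at *
  generalize (∫ x, (s * Theta T x.1) ^ 3 * (Ioo a b).indicator 1 x.2 *
      conjFun s T γ η φ x.1 x.2 ^ 2 ∂(rectMeasure T)) = I2 at *
  have s1 : I6 + I4 ≤ (2 * Cb + 1) * (I3 + I4) := by
    nlinarith only [l6, mul_nonneg (sub_nonneg.2 hCb) n3, n3]
  have s2 : κ0 * (I3 + I4) ≤ 2 * I1 + C' * I2 := by linarith only [hR]
  have s3 : 2 * I1 + C' * I2 ≤ (2 + C') * (I1 + I2) := by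
    nlinarith only [mul_nonneg hC0 n1, n2]
  calc (I6 + I4) * κ0 ≤ (2 * Cb + 1) * (I3 + I4) * κ0 := mul_le_mul_of_nonneg_right s1 hκ.le
    _ = (2 * Cb + 1) * (κ0 * (I3 + I4)) := by ring
    _ ≤ (2 * Cb + 1) * ((2 + C') * (I1 + I2)) :=
        mul_le_mul_of_nonneg_left (s2.trans s3) (by linarith)
    _ = _ := by ring

end

/-! ### Weak derivatives of vector-valued functions of one variable. -/

section
variable {E : Type*} [NormedAddCommGroup E] [NormedSpace ℝ E] {T : ℝ}

/-- Integration by parts against the primitive of an integrable function. -/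
theorem integral_deriv_smul_primitive [CompleteSpace E] {g : ℝ → E} (hT : 0 < T)
    (hg : IntegrableOn g (Ioo 0 T)) {χ : ℝ → ℝ} (hχ : ContDiff ℝ 1 χ) :
    ∫ t in Ioo 0 T, deriv χ t • (∫ s in Ioo 0 t, g s)
      = χ T • (∫ s in Ioo 0 T, g s) - ∫ t in Ioo 0 T, χ t • g t := by
  set μ := volume.restrict (Ioo 0 T) with hμ
  have hdc : Continuous (deriv χ) := hχ.continuous_deriv le_rfl
  obtain ⟨M, hM⟩ := (isCompact_Icc (a := 0) (b := T)).exists_bound_of_continuousOn hdc.continuousOn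
  -- Fubini on the triangle `s < t`: integrating in `t` first produces `χ T - χ s`.
  let F : ℝ × ℝ → E := fun x => ({x : ℝ × ℝ | x.2 < x.1}.indicator (fun x => deriv χ x.1) x) • g x.2
  have hms : MeasurableSet {x : ℝ × ℝ | x.2 < x.1} := measurableSet_lt measurable_snd measurable_fst
  have hF : Integrable F (μ.prod μ) := by
    refine ((Integrable.comp_snd hg μ).norm.const_mul |M|).mono' ?_ ?_
    · exact (((hdc.measurable.comp measurable_fst).indicator hms).aestronglyMeasurable).smul
        (Integrable.comp_snd hg μ).1
    · have : ∀ᵐ x ∂(μ.prod μ), x.1 ∈ Ioo 0 T :=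
        Measure.quasiMeasurePreserving_fst.ae (ae_restrict_mem measurableSet_Ioo)
      filter_upwards [this] with x hx
      rw [norm_smul]
      refine mul_le_mul_of_nonneg_right ?_ (norm_nonneg _)
      refine (norm_indicator_le_norm_self _ _).trans ?_
      exact (hM _ (Ioo_subset_Icc_self hx)).trans (le_abs_self M)
  have h1 : ∫ t in Ioo 0 T, deriv χ t • (∫ s in Ioo 0 t, g s) = ∫ t, ∫ s, F (t, s) ∂μ ∂μ := by
    refine setIntegral_congr_fun measurableSet_Ioo fun t ht => ?_
    have e : ∀ s, F (t, s) = (Iio t).indicator (fun s => deriv χ t • g s) s := fun s => by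
      by_cases h : s < t
      · simp [F, indicator, h]
      · simp [F, indicator, h]
    simp_rw [e]
    rw [setIntegral_indicator measurableSet_Iio, integral_smul]
    congr 3
    ext x
    exact ⟨fun hx => ⟨⟨hx.1, hx.2.trans ht.2⟩, hx.2⟩, fun hx => ⟨hx.1.1, hx.2⟩⟩
  have h2 : ∫ s, ∫ t, F (t, s) ∂μ ∂μ = ∫ s in Ioo 0 T, (χ T - χ s) • g s := by
    refine setIntegral_congr_fun measurableSet_Ioo fun s hs => ?_
    have e : ∀ t, F (t, s) = ((Ioi s).indicator (deriv χ) t) • g s := fun t => by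
      by_cases h : s < t
      · simp [F, indicator, h]
      · simp [F, indicator, h]
    simp_rw [e]
    rw [integral_smul_const, setIntegral_indicator measurableSet_Ioi]
    congr 1
    have e2 : Ioo 0 T ∩ Ioi s = Ioo s T := by
      ext x
      exact ⟨fun hx => ⟨hx.2, hx.1.2⟩, fun hx => ⟨⟨hs.1.trans hx.1, hx.2⟩, hx.1⟩⟩
    rw [e2, ← integral_Ioc_eq_integral_Ioo, ← intervalIntegral.integral_of_le hs.2.le]
    exact intervalIntegral.integral_deriv_eq_sub
      (fun x _ => hχ.differentiable one_ne_zero x) (hdc.intervalIntegrable _ _)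
  have hχg : Integrable (fun s => χ s • g s) μ := by
    obtain ⟨M', hM'⟩ := (isCompact_Icc (a := 0) (b := T)).exists_bound_of_continuousOn
      hχ.continuous.continuousOn
    refine (hg.norm.const_mul |M'|).mono' (hχ.continuous.aestronglyMeasurable.smul hg.1) ?_
    filter_upwards [ae_restrict_mem measurableSet_Ioo] with x hx
    rw [norm_smul]
    exact mul_le_mul_of_nonneg_right ((hM' _ (Ioo_subset_Icc_self hx)).trans (le_abs_self M'))
      (norm_nonneg _)
  rw [h1, integral_integral_swap hF, h2]
  simp_rw [sub_smul]
  have hgT : Integrable (fun s => χ T • g s) μ := hg.smul (χ T)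
  rw [integral_sub hgT hχg, integral_smul]

theorem exists_Icc_of_isCompact {K : Set ℝ} (hT : 0 < T) (hK : IsCompact K) (hKT : K ⊆ Ioo 0 T) :
    ∃ c d, 0 < c ∧ d < T ∧ c ≤ d ∧ K ⊆ Icc c d := by
  have hK' : IsCompact (insert (T / 2) K) := hK.insert _
  have hne : (insert (T / 2) K).Nonempty := insert_nonempty _ _
  have hsub : insert (T / 2) K ⊆ Ioo 0 T :=
    insert_subset ⟨by linarith, by linarith⟩ hKT
  refine ⟨sInf (insert (T / 2) K), sSup (insert (T / 2) K), (hsub (hK'.sInf_mem hne)).1,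
    (hsub (hK'.sSup_mem hne)).2, ?_, fun x hx => ?_⟩
  · exact csInf_le_csSup hne hK'.bddBelow hK'.bddAbove
  · exact ⟨csInf_le hK'.bddBelow (mem_insert_of_mem _ hx),
      le_csSup hK'.bddAbove (mem_insert_of_mem _ hx)⟩

/-- A test function with vanishing integral is the derivative of a test function. -/
theorem exists_test_primitive {θ : ℝ → ℝ} (hT : 0 < T) (hθ : ContDiff ℝ ∞ θ)
    (hθc : HasCompactSupport θ) (hθs : tsupport θ ⊆ Ioo 0 T) (hθ0 : ∫ x, θ x = 0) :
    ∃ χ : ℝ → ℝ, ContDiff ℝ ∞ χ ∧ HasCompactSupport χ ∧ tsupport χ ⊆ Ioo 0 T ∧ deriv χ = θ := by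
  obtain ⟨c, d, hc, hd, hcd, hsub⟩ := exists_Icc_of_isCompact hT hθc hθs
  have hz : ∀ x, x ∉ Icc c d → θ x = 0 := fun x hx =>
    image_eq_zero_of_notMem_tsupport fun h => hx (hsub h)
  set χ : ℝ → ℝ := fun t => ∫ x in (0 : ℝ)..t, θ x with hχ
  have hder : ∀ t, HasDerivAt χ (θ t) t := fun t =>
    (hθ.continuous.integral_hasStrictDerivAt 0 t).hasDerivAt
  have hderiv : deriv χ = θ := funext fun t => (hder t).deriv
  have hsupp : Function.support χ ⊆ Icc c d := by
    intro t ht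
    by_contra h
    refine ht ?_
    rcases lt_or_ge t c with h1 | h1
    · rw [hχ]
      refine intervalIntegral.integral_zero_ae (Eventually.of_forall fun x hx => ?_)
      refine hz x fun h' => ?_
      have := hx.2
      have := h'.1
      rcases le_total 0 t with h2 | h2
      · rw [max_eq_right h2] at *; linarith
      · rw [max_eq_left h2] at *; linarith
    · have h2 : d < t := by
        by_contra h3
        exact h ⟨h1, not_lt.1 h3⟩
      have hs : Function.support θ ⊆ Ioc 0 t := fun x hx => by
        have := hsub (subset_tsupport _ hx)
        exact ⟨hc.trans_le this.1, this.2.trans h2.le⟩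
      rw [hχ]
      simp only
      rw [intervalIntegral.integral_eq_integral_of_support_subset hs, hθ0]
  have hts : tsupport χ ⊆ Icc c d := closure_minimal hsupp isClosed_Icc
  refine ⟨χ, ?_, HasCompactSupport.of_support_subset_isCompact isCompact_Icc hsupp,
    hts.trans (Icc_subset_Ioo hc hd), hderiv⟩
  rw [contDiff_infty_iff_deriv, hderiv]
  exact ⟨fun t => (hder t).differentiableAt, hθ⟩

theorem integrableOn_smul_of_continuous {χ : ℝ → ℝ} {g : ℝ → E} (hχ : Continuous χ)
    (hg : IntegrableOn g (Ioo 0 T)) : IntegrableOn (fun t => χ t • g t) (Ioo 0 T) := by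
  obtain ⟨M, hM⟩ := (isCompact_Icc (a := 0) (b := T)).exists_bound_of_continuousOn hχ.continuousOn
  refine (hg.norm.const_mul |M|).mono' (hχ.aestronglyMeasurable.smul hg.1) ?_
  filter_upwards [ae_restrict_mem measurableSet_Ioo] with x hx
  rw [norm_smul]
  exact mul_le_mul_of_nonneg_right ((hM _ (Ioo_subset_Icc_self hx)).trans (le_abs_self M))
    (norm_nonneg _)

theorem continuous_primitive [CompleteSpace E] {g : ℝ → E} (hg : IntegrableOn g (Ioo 0 T)) :
    ContinuousOn (fun t => ∫ s in Ioo 0 t, g s) (Icc 0 T) := by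
  have hg' : IntegrableOn g (Icc 0 T) := (integrableOn_Icc_iff_integrableOn_Ioo (by simp) (by simp)).2 hg
  refine (intervalIntegral.continuousOn_primitive hg').congr fun t _ => ?_
  exact integral_Ioc_eq_integral_Ioo.symm

/-- A function with an integrable weak derivative is a primitive of it. -/
theorem exists_eq_primitive_of_weakDeriv [CompleteSpace E] {y g : ℝ → E} (hT : 0 < T)
    (hy : IntegrableOn y (Ioo 0 T)) (hg : IntegrableOn g (Ioo 0 T))
    (h : ∀ χ : ℝ → ℝ, ContDiff ℝ ∞ χ → HasCompactSupport χ → tsupport χ ⊆ Ioo 0 T →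
      ∫ t in Ioo 0 T, deriv χ t • y t = -∫ t in Ioo 0 T, χ t • g t) :
    ∃ y0 : E, ∀ᵐ t ∂(volume.restrict (Ioo 0 T)), y t = y0 + ∫ s in Ioo 0 t, g s := by
  set G : ℝ → E := fun t => ∫ s in Ioo 0 t, g s with hG
  have hGi : IntegrableOn G (Ioo 0 T) :=
    ((continuous_primitive hg).integrableOn_compact isCompact_Icc).mono_set Ioo_subset_Icc_self
  set k : ℝ → E := fun t => y t - G t with hk
  have hki : IntegrableOn k (Ioo 0 T) := hy.sub hGi
  have h0 : ∀ χ : ℝ → ℝ, ContDiff ℝ ∞ χ → HasCompactSupport χ → tsupport χ ⊆ Ioo 0 T →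
      ∫ t in Ioo 0 T, deriv χ t • k t = 0 := by
    intro χ h1 h2 h3
    have hd : Continuous (deriv χ) := h1.continuous_deriv (by simp)
    have e : ∫ t in Ioo 0 T, deriv χ t • k t
        = (∫ t in Ioo 0 T, deriv χ t • y t) - ∫ t in Ioo 0 T, deriv χ t • G t := by
      rw [← integral_sub (integrableOn_smul_of_continuous hd hy)
        (integrableOn_smul_of_continuous hd hGi)]
      simp only [hk, smul_sub]
    have hχT : χ T = 0 := image_eq_zero_of_notMem_tsupport fun hmem => lt_irrefl _ (h3 hmem).2
    rw [e, h χ h1 h2 h3, integral_deriv_smul_primitive hT hg (h1.of_le (by simp)), hχT]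
    simp
  let f : ContDiffBump (T / 2) := ⟨T / 8, T / 4, by linarith, by linarith⟩
  set ρ : ℝ → ℝ := f.normed volume with hρ
  have hρs : tsupport ρ ⊆ Ioo 0 T := by
    rw [hρ, f.tsupport_normed_eq, Real.closedBall_eq_Icc]
    show Icc (T / 2 - T / 4) (T / 2 + T / 4) ⊆ _
    exact Icc_subset_Ioo (by linarith) (by linarith)
  have hρd : ContDiff ℝ ∞ ρ := f.contDiff_normed
  have hρc : HasCompactSupport ρ := f.hasCompactSupport_normed
  have hρ1 : ∫ x, ρ x = 1 := f.integral_normed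
  refine ⟨∫ t in Ioo 0 T, ρ t • k t, ?_⟩
  set y0 := ∫ t in Ioo 0 T, ρ t • k t with hy0
  have hloc : LocallyIntegrableOn (fun t => k t - y0) (Ioo 0 T) :=
    (hki.sub (integrableOn_const (by simp))).locallyIntegrableOn
  have hz := isOpen_Ioo.ae_eq_zero_of_integral_contDiff_smul_eq_zero hloc (fun ψ h1 h2 h3 => by
    -- Subtracting `c ρ` removes the mean of `ψ`. The remainder is then the derivative of a test
    -- function, against which `k` integrates to zero.
    set c := ∫ x, ψ x with hc
    have hθd : ContDiff ℝ ∞ (fun x => ψ x - c * ρ x) := h1.sub (contDiff_const.mul hρd)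
    have hts : tsupport (fun x => ψ x - c * ρ x) ⊆ tsupport ψ ∪ tsupport ρ := by
      refine closure_minimal (fun x hx => ?_) ((isClosed_tsupport ψ).union (isClosed_tsupport ρ))
      by_contra hn
      rw [mem_union, not_or] at hn
      refine hx ?_
      simp only
      rw [image_eq_zero_of_notMem_tsupport hn.1, image_eq_zero_of_notMem_tsupport hn.2]
      ring
    have hθc : HasCompactSupport (fun x => ψ x - c * ρ x) :=
      (h2.isCompact.union hρc.isCompact).of_isClosed_subset (isClosed_tsupport _) hts
    have hψi : Integrable ψ := h1.continuous.integrable_of_hasCompactSupport h2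
    have hρi : Integrable ρ := hρd.continuous.integrable_of_hasCompactSupport hρc
    obtain ⟨χ, c1, c2, c3, c4⟩ := exists_test_primitive hT hθd hθc
      (hts.trans (union_subset h3 hρs))
      (by rw [integral_sub hψi (hρi.const_mul c), integral_const_mul, hρ1, hc]; ring)
    have := h0 χ c1 c2 c3
    rw [c4] at this
    have hψk := integrableOn_smul_of_continuous h1.continuous hki
    have hρk := integrableOn_smul_of_continuous hρd.continuous hki
    have e1 : ∫ t in Ioo 0 T, (ψ t - c * ρ t) • k t = (∫ t in Ioo 0 T, ψ t • k t) - c • y0 := by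
      have hρk' : IntegrableOn (fun t => c • ρ t • k t) (Ioo 0 T) := hρk.smul c
      rw [hy0, ← integral_smul, ← integral_sub hψk hρk']
      simp only [sub_smul, mul_smul]
    have e2 : ∫ t, ψ t • (k t - y0) = ∫ t in Ioo 0 T, ψ t • (k t - y0) := by
      refine (setIntegral_eq_integral_of_forall_compl_eq_zero fun x hx => ?_).symm
      rw [image_eq_zero_of_notMem_tsupport fun hmem => hx (h3 hmem), zero_smul]
    have e3 : ∫ t in Ioo 0 T, ψ t • (k t - y0) = (∫ t in Ioo 0 T, ψ t • k t)
        - (∫ t in Ioo 0 T, ψ t) • y0 := by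
      rw [← integral_smul_const, ← integral_sub hψk (hψi.integrableOn.smul_const y0)]
      simp only [smul_sub]
    have e4 : ∫ t in Ioo 0 T, ψ t = c := by
      refine setIntegral_eq_integral_of_forall_compl_eq_zero fun x hx => ?_
      rw [image_eq_zero_of_notMem_tsupport fun hmem => hx (h3 hmem)]
    rw [e2, e3, e4, ← e1, this])
  rw [ae_restrict_iff' measurableSet_Ioo]
  filter_upwards [hz] with t ht hmem
  have := ht hmem
  rw [hk] at this
  simp only at this
  rw [sub_sub, sub_eq_zero] at this
  rw [this, add_comm]

end

/-! ### The weighted space: primitives, boundary values and test functions. -/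

section
variable {α : ℝ}

theorem H01_inner (x y : H01 α) :
    inner ℝ x y = inner ℝ (toL2 α x) (toL2 α y) + inner ℝ (dr α x) (dr α y) :=
  WithLp.prod_inner_apply (toPair α x) (toPair α y)

theorem measurable_density (α : ℝ) : Measurable fun r : ℝ => ENNReal.ofReal (r ^ α) :=
  (measurable_id.pow_const α).ennreal_ofReal

theorem ae_weightMeasure_iff {p : ℝ → Prop} :
    (∀ᵐ r ∂(weightMeasure α), p r) ↔ ∀ᵐ r ∂(volume.restrict (Ioo (0 : ℝ) 1)), p r := by
  constructor
  · intro h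
    refine (withDensity_absolutelyContinuous' (measurable_density α).aemeasurable ?_).ae_le h
    filter_upwards [ae_restrict_mem measurableSet_Ioo] with r hr
    simpa using Real.rpow_pos_of_pos hr.1 α
  · intro h
    exact (withDensity_absolutelyContinuous _ _).ae_le h

theorem integral_weightMeasure (f : ℝ → ℝ) :
    ∫ r, f r ∂(weightMeasure α) = ∫ r in Ioo (0 : ℝ) 1, r ^ α * f r := by
  rw [weightMeasure, integral_withDensity_eq_integral_toReal_smul (measurable_density α)
    (Eventually.of_forall fun _ => ENNReal.ofReal_lt_top)]
  refine setIntegral_congr_fun measurableSet_Ioo fun r hr => ?_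
  simp [ENNReal.toReal_ofReal (Real.rpow_nonneg hr.1.le α)]

theorem integrable_weightMeasure_iff {f : ℝ → ℝ} :
    Integrable f (weightMeasure α) ↔ IntegrableOn (fun r => r ^ α * f r) (Ioo (0 : ℝ) 1) := by
  rw [weightMeasure, integrable_withDensity_iff_integrable_smul₀' (measurable_density α).aemeasurable
    (Eventually.of_forall fun _ => ENNReal.ofReal_lt_top)]
  refine integrable_congr ?_
  filter_upwards [ae_restrict_mem measurableSet_Ioo] with r hr
  simp [ENNReal.toReal_ofReal (Real.rpow_nonneg hr.1.le α)]

theorem L2_inner (u v : L2) : inner ℝ u v = ∫ r in Ioo (0 : ℝ) 1, u r * v r := by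
  rw [L2.inner_def]
  refine integral_congr_ae (Eventually.of_forall fun r => ?_)
  simp [mul_comm]

theorem L2w_inner (u v : L2w α) : inner ℝ u v = ∫ r in Ioo (0 : ℝ) 1, r ^ α * (u r * v r) := by
  rw [L2.inner_def, ← integral_weightMeasure]
  refine integral_congr_ae (Eventually.of_forall fun r => ?_)
  simp [mul_comm]

/-- Square and weight combine to `φ² r^(-α)`, which is integrable for `α < 1`. Hence unweighted
integrals of an element of `L²(w)` against continuous functions are continuous functionals. -/
theorem memLp_inv_weight (hα1 : α < 1) {φ : ℝ → ℝ} (hφ : Continuous φ) :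
    MemLp (fun r => (r ^ α)⁻¹ * φ r) 2 (weightMeasure α) := by
  have hm : Measurable fun r => (r ^ α)⁻¹ * φ r :=
    (measurable_id.pow_const α).inv.mul hφ.measurable
  rw [memLp_two_iff_integrable_sq hm.aestronglyMeasurable, integrable_weightMeasure_iff]
  obtain ⟨M, hM⟩ := (isCompact_Icc (a := (0 : ℝ)) (b := 1)).exists_bound_of_continuousOn
    hφ.continuousOn
  refine ((integrable_rpow_inv hα1).const_mul (M ^ 2)).mono'
    ((measurable_id.pow_const α).mul (hm.pow_const 2)).aestronglyMeasurable ?_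
  filter_upwards [ae_restrict_mem measurableSet_Ioo] with r hr
  have hw := Real.rpow_pos_of_pos hr.1 α
  have h1 : φ r ^ 2 ≤ M ^ 2 := by
    rw [← sq_abs]
    exact pow_le_pow_left₀ (abs_nonneg _) (hM r (Ioo_subset_Icc_self hr)) 2
  have e : r ^ α * ((r ^ α)⁻¹ * φ r) ^ 2 = φ r ^ 2 * (r ^ α)⁻¹ := by field_simp
  rw [e, Real.norm_of_nonneg (by positivity)]
  exact mul_le_mul_of_nonneg_right h1 (by positivity)

theorem L2_integrableOn (u : L2) : IntegrableOn u (Ioo (0 : ℝ) 1) :=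
  (Lp.memLp u).integrable (by norm_num)

theorem L2w_integrableOn (hα1 : α < 1) (u : L2w α) : IntegrableOn u (Ioo (0 : ℝ) 1) := by
  have h := (memLp_inv_weight hα1 (φ := fun _ => 1) continuous_const).integrable_mul (Lp.memLp u)
  rw [integrable_weightMeasure_iff] at h
  refine h.congr ?_
  filter_upwards [ae_restrict_mem measurableSet_Ioo] with r hr
  have hw := (Real.rpow_pos_of_pos hr.1 α).ne'
  simp only [Pi.mul_apply]
  field_simp

theorem integral_test_by_parts {v φ : ℝ → ℝ} (hv : ContDiff ℝ ∞ v)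
    (hvs : tsupport v ⊆ Ioo (0 : ℝ) 1) (hφ : ContDiff ℝ ∞ φ) :
    ∫ r in Ioo (0 : ℝ) 1, v r * deriv φ r = -∫ r in Ioo (0 : ℝ) 1, deriv v r * φ r := by
  have hz : ∀ x, x ∉ Ioo (0 : ℝ) 1 → v x = 0 := fun x hx =>
    image_eq_zero_of_notMem_tsupport fun h => hx (hvs h)
  have h := intervalIntegral.integral_mul_deriv_eq_deriv_mul (a := 0) (b := 1) (u := v) (v := φ)
    (fun x _ => (hv.differentiable (by simp) x).hasDerivAt)
    (fun x _ => (hφ.differentiable (by simp) x).hasDerivAt)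
    ((hv.continuous_deriv (by simp)).intervalIntegrable _ _)
    ((hφ.continuous_deriv (by simp)).intervalIntegrable _ _)
  rw [hz 1 (by simp), hz 0 (by simp), intervalIntegral.integral_of_le zero_le_one,
    intervalIntegral.integral_of_le zero_le_one, integral_Ioc_eq_integral_Ioo,
    integral_Ioc_eq_integral_Ioo] at h
  simpa using h

/-- The weak derivative of an element of `H₀¹`, tested against functions that need not vanish at
the boundary. -/
theorem H01_by_parts (hα1 : α < 1) (u : H01 α) {φ : ℝ → ℝ} (hφ : ContDiff ℝ ∞ φ) :
    ∫ r in Ioo (0 : ℝ) 1, deriv φ r * toL2 α u r = -∫ r in Ioo (0 : ℝ) 1, φ r * dr α u r := by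
  have hd : Continuous (deriv φ) := hφ.continuous_deriv (by simp)
  have hm1 : MemLp (deriv φ) 2 (volume.restrict (Ioo (0 : ℝ) 1)) := by
    obtain ⟨M, hM⟩ := (isCompact_Icc (a := (0 : ℝ)) (b := 1)).exists_bound_of_continuousOn
      hd.continuousOn
    refine MemLp.of_bound hd.aestronglyMeasurable M ?_
    filter_upwards [ae_restrict_mem measurableSet_Ioo] with r hr
    exact hM r (Ioo_subset_Icc_self hr)
  have hm2 := memLp_inv_weight hα1 hφ.continuous
  -- The integration by parts formula is the vanishing of a continuous functional, so it passes from
  -- test pairs to their closure, even for `φ` not vanishing at the boundary.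
  let Λ : WithLp 2 (L2 × L2w α) → ℝ := fun p =>
    inner ℝ (hm1.toLp _) p.fst + inner ℝ (hm2.toLp _) p.snd
  have hΛ : Continuous Λ :=
    ((innerSL ℝ (hm1.toLp _)).comp (WithLp.fstL 2 ℝ L2 (L2w α))).continuous.add
      ((innerSL ℝ (hm2.toLp _)).comp (WithLp.sndL 2 ℝ L2 (L2w α))).continuous
  have e : ∀ p, Λ p = (∫ r in Ioo (0 : ℝ) 1, deriv φ r * p.fst r)
      + ∫ r in Ioo (0 : ℝ) 1, φ r * p.snd r := by
    intro p
    simp only [Λ]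
    rw [L2_inner, L2w_inner]
    congr 1
    · refine integral_congr_ae ?_
      filter_upwards [hm1.coeFn_toLp] with r hr
      rw [hr]
    · refine integral_congr_ae ?_
      filter_upwards [ae_weightMeasure_iff.1 hm2.coeFn_toLp, ae_restrict_mem measurableSet_Ioo]
        with r hr hr0
      have hw := (Real.rpow_pos_of_pos hr0.1 α).ne'
      rw [hr]
      field_simp
  have hcl : IsClosed {p | Λ p = 0} := isClosed_eq hΛ continuous_const
  have hsub : (testPairs α : Set (WithLp 2 (L2 × L2w α))) ⊆ {p | Λ p = 0} := by
    rintro p ⟨v, hv, hvc, hvs, h1, h2⟩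
    show Λ p = 0
    rw [e]
    have a1 : ∫ r in Ioo (0 : ℝ) 1, deriv φ r * p.fst r = ∫ r in Ioo (0 : ℝ) 1, v r * deriv φ r := by
      refine integral_congr_ae ?_
      filter_upwards [h1] with r hr
      rw [hr, mul_comm]
    have a2 : ∫ r in Ioo (0 : ℝ) 1, φ r * p.snd r = ∫ r in Ioo (0 : ℝ) 1, deriv v r * φ r := by
      refine integral_congr_ae ?_
      filter_upwards [ae_weightMeasure_iff.1 h2] with r hr
      rw [hr, mul_comm]
    rw [a1, a2, integral_test_by_parts hv hvs hφ, neg_add_cancel]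
  have hmem : toPair α u ∈ {p | Λ p = 0} :=
    (hcl.closure_subset_iff.2 hsub) (show toPair α u ∈ closure _ from u.2)
  have := e (toPair α u)
  rw [show Λ (toPair α u) = 0 from hmem] at this
  exact eq_neg_of_add_eq_zero_left this.symm

/-- Testing with the constant `1` encodes the boundary values: combined with `H01_eq_primitive`, it
says that the representative vanishing at `0` also vanishes at `1`. -/
theorem H01_integral_dr (hα1 : α < 1) (u : H01 α) : ∫ r in Ioo (0 : ℝ) 1, dr α u r = 0 := by
  have h := H01_by_parts hα1 u (φ := fun _ => 1) contDiff_const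
  simpa using h.symm

/-- An element of `H₀¹` is the primitive of its weak derivative. -/
theorem H01_eq_primitive (hα1 : α < 1) (u : H01 α) :
    ∀ᵐ x ∂(volume.restrict (Ioo (0 : ℝ) 1)), toL2 α u x = ∫ r in Ioo 0 x, dr α u r := by
  have hg := L2w_integrableOn hα1 (dr α u)
  have hU : IntegrableOn (fun x => ∫ r in Ioo 0 x, dr α u r) (Ioo (0 : ℝ) 1) :=
    ((continuous_primitive hg).integrableOn_compact isCompact_Icc).mono_set Ioo_subset_Icc_self
  have hloc : LocallyIntegrableOn (fun x => toL2 α u x - ∫ r in Ioo 0 x, dr α u r)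
      (Ioo (0 : ℝ) 1) := ((L2_integrableOn (toL2 α u)).sub hU).locallyIntegrableOn
  have hz := isOpen_Ioo.ae_eq_zero_of_integral_contDiff_smul_eq_zero hloc (fun ψ h1 h2 h3 => by
    set φ : ℝ → ℝ := fun t => ∫ x in (0 : ℝ)..t, ψ x with hφdef
    have hder : ∀ t, HasDerivAt φ (ψ t) t := fun t =>
      (h1.continuous.integral_hasStrictDerivAt 0 t).hasDerivAt
    have hderiv : deriv φ = ψ := funext fun t => (hder t).deriv
    have hφ : ContDiff ℝ ∞ φ := by
      rw [contDiff_infty_iff_deriv, hderiv]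
      exact ⟨fun t => (hder t).differentiableAt, h1⟩
    have a1 := H01_by_parts hα1 u hφ
    have a2 := integral_deriv_smul_primitive zero_lt_one hg (hφ.of_le (by simp) : ContDiff ℝ 1 φ)
    rw [hderiv] at a1 a2
    rw [H01_integral_dr hα1 u] at a2
    have e : ∫ x, ψ x • (toL2 α u x - ∫ r in Ioo 0 x, dr α u r)
        = ∫ x in Ioo (0 : ℝ) 1, ψ x • (toL2 α u x - ∫ r in Ioo 0 x, dr α u r) := by
      refine (setIntegral_eq_integral_of_forall_compl_eq_zero fun x hx => ?_).symm
      rw [image_eq_zero_of_notMem_tsupport fun hmem => hx (h3 hmem), zero_smul]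
    rw [e]
    simp only [smul_sub]
    rw [integral_sub (integrableOn_smul_of_continuous h1.continuous (L2_integrableOn _))
      (integrableOn_smul_of_continuous h1.continuous hU), a2]
    simp only [smul_eq_mul] at a1 ⊢
    rw [a1]
    ring)
  rw [ae_restrict_iff' measurableSet_Ioo]
  filter_upwards [hz] with x hx hmem
  exact sub_eq_zero.1 (hx hmem)

/-- An element of the closure is a pair, and integration by parts shows that its second entry is
determined by the first. -/
theorem toL2_injective (hα1 : α < 1) : Function.Injective (toL2 α) := by
  rw [injective_iff_map_eq_zero]
  intro u hu
  have hg := L2w_integrableOn hα1 (dr α u)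
  have h0 : ∀ᵐ x ∂(volume.restrict (Ioo (0 : ℝ) 1)), toL2 α u x = 0 := by
    rw [hu]
    exact Lp.coeFn_zero ℝ 2 _
  have hz := isOpen_Ioo.ae_eq_zero_of_integral_contDiff_smul_eq_zero
    (hg.locallyIntegrableOn : LocallyIntegrableOn (dr α u) (Ioo (0 : ℝ) 1)) (fun ψ h1 h2 h3 => by
      have a1 := H01_by_parts hα1 u h1
      have e : ∫ x, ψ x • dr α u x = ∫ x in Ioo (0 : ℝ) 1, ψ x • dr α u x := by
        refine (setIntegral_eq_integral_of_forall_compl_eq_zero fun x hx => ?_).symm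
        rw [image_eq_zero_of_notMem_tsupport fun hmem => hx (h3 hmem), zero_smul]
      have e0 : ∫ r in Ioo (0 : ℝ) 1, deriv ψ r * toL2 α u r = 0 := by
        refine integral_eq_zero_of_ae ?_
        filter_upwards [h0] with r hr
        rw [hr, mul_zero, Pi.zero_apply]
      rw [e]
      simp only [smul_eq_mul]
      linarith)
  have hdr : dr α u = 0 := by
    rw [Lp.ext_iff]
    refine EventuallyEq.trans ?_ (Lp.coeFn_zero ℝ 2 _).symm
    rw [EventuallyEq, ae_weightMeasure_iff, ae_restrict_iff' measurableSet_Ioo]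
    filter_upwards [hz] with x hx hmem using hx hmem
  have : inner ℝ u u = 0 := by rw [H01_inner, hu, hdr]; simp
  exact inner_self_eq_zero.1 this

/-- The element of `H₀¹` given by a test function. -/
theorem exists_H01_test {v : ℝ → ℝ} (hα0 : 0 < α) (hv : ContDiff ℝ ∞ v) (hvc : HasCompactSupport v)
    (hvs : tsupport v ⊆ Ioo (0 : ℝ) 1) :
    ∃ u : H01 α, toL2 α u =ᵐ[volume.restrict (Ioo (0 : ℝ) 1)] v ∧
      dr α u =ᵐ[volume.restrict (Ioo (0 : ℝ) 1)] deriv v := by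
  have hd : Continuous (deriv v) := hv.continuous_deriv (by simp)
  have hm1 : MemLp v 2 (volume.restrict (Ioo (0 : ℝ) 1)) :=
    (hv.continuous.memLp_of_hasCompactSupport hvc).restrict _
  have hm2 : MemLp (deriv v) 2 (weightMeasure α) := by
    have h : MemLp (deriv v) 2 (volume.restrict (Ioo (0 : ℝ) 1)) :=
      (hd.memLp_of_hasCompactSupport hvc.deriv).restrict _
    refine h.mono_measure ?_
    rw [weightMeasure]
    refine (withDensity_mono ?_).trans_eq withDensity_one
    filter_upwards [ae_restrict_mem measurableSet_Ioo] with r hr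
    simpa using Real.rpow_le_one hr.1.le hr.2.le hα0.le
  let p : WithLp 2 (L2 × L2w α) := WithLp.toLp 2 (hm1.toLp _, hm2.toLp _)
  have hp : p ∈ testPairs α := ⟨v, hv, hvc, hvs, hm1.coeFn_toLp, hm2.coeFn_toLp⟩
  refine ⟨⟨p, subset_closure hp⟩, hm1.coeFn_toLp, ae_weightMeasure_iff.1 hm2.coeFn_toLp⟩

end

/-! ### The static problem and separated classical solutions. -/

/-- The solution operator `g ↦ v` of `v - ∂_r (r^α ∂_r v) = g` with Dirichlet conditions. -/
def solOp (α : ℝ) : L2 →L[ℝ] H01 α := ContinuousLinearMap.adjoint (toL2 α)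

section
variable {α : ℝ}

theorem solOp_inner_left (g : L2) (u : H01 α) : inner ℝ (solOp α g) u = inner ℝ g (toL2 α u) :=
  ContinuousLinearMap.adjoint_inner_left _ _ _

/-- If `ι* g = 0`, then `g` is orthogonal to all test functions. Equivalently, `ι` has dense range.
-/
theorem solOp_injective (hα0 : 0 < α) : Function.Injective (solOp α) := by
  rw [injective_iff_map_eq_zero]
  intro g hg
  have hz := isOpen_Ioo.ae_eq_zero_of_integral_contDiff_smul_eq_zero
    ((L2_integrableOn g).locallyIntegrableOn : LocallyIntegrableOn g (Ioo (0 : ℝ) 1))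
    (fun ψ h1 h2 h3 => by
      obtain ⟨u, hu, -⟩ := exists_H01_test hα0 h1 h2 h3
      have h := solOp_inner_left g u
      rw [hg, inner_zero_left, L2_inner] at h
      have e : ∫ x, ψ x • g x = ∫ x in Ioo (0 : ℝ) 1, ψ x • g x := by
        refine (setIntegral_eq_integral_of_forall_compl_eq_zero fun x hx => ?_).symm
        rw [image_eq_zero_of_notMem_tsupport fun hmem => hx (h3 hmem), zero_smul]
      rw [e]
      refine Eq.trans ?_ h.symm
      refine integral_congr_ae ?_
      filter_upwards [hu] with r hr
      rw [hr, smul_eq_mul, mul_comm])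
  rw [Lp.ext_iff]
  refine EventuallyEq.trans ?_ (Lp.coeFn_zero ℝ 2 _).symm
  rw [EventuallyEq, ae_restrict_iff' measurableSet_Ioo]
  filter_upwards [hz] with x hx hmem using hx hmem

theorem hasDerivAt_setIntegral_Ioo {h : ℝ → ℝ} (hh : IntegrableOn h (Ioo (0 : ℝ) 1))
    (hc : ContinuousOn h (Ioo 0 1)) {r : ℝ} (hr : r ∈ Ioo (0 : ℝ) 1) :
    HasDerivAt (fun x => ∫ s in Ioo 0 x, h s) (h r) r := by
  have hca : ContinuousAt h r := hc.continuousAt (isOpen_Ioo.mem_nhds hr)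
  have hi : IntervalIntegrable h volume 0 r := by
    rw [intervalIntegrable_iff_integrableOn_Ioo_of_le hr.1.le]
    exact hh.mono_set (Ioo_subset_Ioo_right hr.2.le)
  have hm : StronglyMeasurableAtFilter h (𝓝 r) :=
    ⟨Ioo 0 1, isOpen_Ioo.mem_nhds hr, hh.1⟩
  refine (intervalIntegral.integral_hasDerivAt_right hi hm hca).congr_of_eventuallyEq ?_
  filter_upwards [isOpen_Ioo.mem_nhds hr] with x hx
  rw [intervalIntegral.integral_of_le hx.1.le, integral_Ioc_eq_integral_Ioo]

theorem integral_rpow_inv {x : ℝ} (hα1 : α < 1) (hx : 0 ≤ x) :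
    ∫ r in Ioo 0 x, (r ^ α)⁻¹ = x ^ (1 - α) / (1 - α) := by
  have h := integral_rpow (a := 0) (b := x) (r := -α) (Or.inl (by linarith))
  rw [intervalIntegral.integral_of_le hx, integral_Ioc_eq_integral_Ioo, neg_add_eq_sub,
    Real.zero_rpow (by linarith), sub_zero] at h
  rw [← h]
  refine setIntegral_congr_fun measurableSet_Ioo fun r hr => ?_
  exact (Real.rpow_neg hr.1.le α).symm

/-- A classical solution of `v - (r^α v')' = γ` with Dirichlet conditions, with flux
`q = r^α v'`. -/
structure IsClassicalStatic (α : ℝ) (γ v q : ℝ → ℝ) : Prop where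
  cγ : ContinuousOn γ (Icc 0 1)
  cv : ContinuousOn v (Icc 0 1)
  cq : ContinuousOn q (Icc 0 1)
  v_r : ∀ r ∈ Ioo (0 : ℝ) 1, HasDerivAt v ((r ^ α)⁻¹ * q r) r
  q_r : ∀ r ∈ Ioo (0 : ℝ) 1, HasDerivAt q (v r - γ r) r
  v_zero : v 0 = 0
  v_one : v 1 = 0
  decay : ∃ C, ∀ r ∈ Ioo (0 : ℝ) 1, |v r| ≤ C * r ^ (1 - α)

/-- One-dimensional elliptic regularity: the flux is a primitive of the continuous function `v - γ`,
hence `C¹` inside and bounded up to the boundary. Then `v` is a primitive of `r^(-α)` times a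
bounded function, which also gives the decay `r^(1-α)` at `0`. -/
theorem exists_isClassicalStatic (hα0 : 0 < α) (hα1 : α < 1) (g : L2) {γ : ℝ → ℝ}
    (hγ : ContinuousOn γ (Icc 0 1)) (hg : g =ᵐ[volume.restrict (Ioo (0 : ℝ) 1)] γ) :
    ∃ v q : ℝ → ℝ, IsClassicalStatic α γ v q ∧
      toL2 α (solOp α g) =ᵐ[volume.restrict (Ioo (0 : ℝ) 1)] v ∧
      dr α (solOp α g) =ᵐ[volume.restrict (Ioo (0 : ℝ) 1)] fun r => (r ^ α)⁻¹ * q r := by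
  set u := solOp α g with hu
  have hdi := L2w_integrableOn hα1 (dr α u)
  have hcw : Continuous fun r : ℝ => r ^ α := Real.continuous_rpow_const hα0.le
  have hfi : IntegrableOn (fun r => r ^ α * dr α u r) (Ioo (0 : ℝ) 1) :=
    integrableOn_smul_of_continuous hcw hdi
  have hsi : IntegrableOn (fun r => toL2 α u r - g r) (Ioo (0 : ℝ) 1) :=
    (L2_integrableOn _).sub (L2_integrableOn _)
  -- The defining property of the adjoint, tested on `χ`, says that `r^α ∂_r u` has weak derivative
  -- `u - g`.
  obtain ⟨q0, hq0⟩ := exists_eq_primitive_of_weakDeriv zero_lt_one hfi hsi (fun χ h1 h2 h3 => by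
    obtain ⟨z, hz, hz'⟩ := exists_H01_test (α := α) hα0 h1 h2 h3
    have h := solOp_inner_left g z
    rw [← hu, H01_inner, L2_inner, L2w_inner, L2_inner] at h
    have e1 : ∫ r in Ioo (0 : ℝ) 1, toL2 α u r * toL2 α z r
        = ∫ r in Ioo (0 : ℝ) 1, χ r * toL2 α u r := by
      refine integral_congr_ae ?_
      filter_upwards [hz] with r hr
      rw [hr, mul_comm]
    have e2 : ∫ r in Ioo (0 : ℝ) 1, r ^ α * (dr α u r * dr α z r)
        = ∫ r in Ioo (0 : ℝ) 1, deriv χ r • (r ^ α * dr α u r) := by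
      refine integral_congr_ae ?_
      filter_upwards [hz'] with r hr
      rw [hr, smul_eq_mul]
      ring
    have e3 : ∫ r in Ioo (0 : ℝ) 1, g r * toL2 α z r = ∫ r in Ioo (0 : ℝ) 1, χ r * g r := by
      refine integral_congr_ae ?_
      filter_upwards [hz] with r hr
      rw [hr, mul_comm]
    have i1 : IntegrableOn (fun r => χ r * toL2 α u r) (Ioo (0 : ℝ) 1) :=
      integrableOn_smul_of_continuous h1.continuous (L2_integrableOn _)
    have i2 : IntegrableOn (fun r => χ r * g r) (Ioo (0 : ℝ) 1) :=
      integrableOn_smul_of_continuous h1.continuous (L2_integrableOn _)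
    simp only [smul_eq_mul, mul_sub] at *
    rw [integral_sub i1 i2]
    linarith)
  set v : ℝ → ℝ := fun x => ∫ r in Ioo 0 x, dr α u r with hv
  have hvu : toL2 α u =ᵐ[volume.restrict (Ioo (0 : ℝ) 1)] v := H01_eq_primitive hα1 u
  have hcv : ContinuousOn v (Icc 0 1) := continuous_primitive hdi
  set q : ℝ → ℝ := fun x => q0 + ∫ s in Ioo 0 x, (v s - γ s) with hq
  have hvγi : IntegrableOn (fun s => v s - γ s) (Ioo (0 : ℝ) 1) :=
    ((hcv.sub hγ).integrableOn_compact isCompact_Icc).mono_set Ioo_subset_Icc_self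
  have hcq : ContinuousOn q (Icc 0 1) := continuousOn_const.add (continuous_primitive hvγi)
  have hdr : dr α u =ᵐ[volume.restrict (Ioo (0 : ℝ) 1)] fun r => (r ^ α)⁻¹ * q r := by
    filter_upwards [hq0, ae_restrict_mem measurableSet_Ioo] with r hr hr0
    have hw := (Real.rpow_pos_of_pos hr0.1 α).ne'
    have e : ∫ s in Ioo 0 r, (toL2 α u s - g s) = ∫ s in Ioo 0 r, (v s - γ s) := by
      refine integral_congr_ae ?_
      have h1 := ae_restrict_of_ae_restrict_of_subset (Ioo_subset_Ioo_right hr0.2.le) hvu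
      have h2 := ae_restrict_of_ae_restrict_of_subset (Ioo_subset_Ioo_right hr0.2.le) hg
      filter_upwards [h1, h2] with s hs1 hs2
      rw [hs1, hs2]
    rw [e] at hr
    rw [hq]
    simp only
    rw [← hr]
    field_simp
  have hvq : ∀ x ∈ Icc (0 : ℝ) 1, v x = ∫ r in Ioo 0 x, (r ^ α)⁻¹ * q r := fun x hx =>
    integral_congr_ae (ae_restrict_of_ae_restrict_of_subset (Ioo_subset_Ioo_right hx.2) hdr)
  have hwq : IntegrableOn (fun r => (r ^ α)⁻¹ * q r) (Ioo (0 : ℝ) 1) := hdi.congr hdr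
  have hcwq : ContinuousOn (fun r => (r ^ α)⁻¹ * q r) (Ioo 0 1) :=
    (hcw.continuousOn.inv₀ fun r hr => (Real.rpow_pos_of_pos hr.1 α).ne').mul
      (hcq.mono Ioo_subset_Icc_self)
  refine ⟨v, q, ⟨hγ, hcv, hcq, fun r hr => ?_, fun r hr => ?_, ?_, ?_, ?_⟩, hvu, hdr⟩
  · refine (hasDerivAt_setIntegral_Ioo hwq hcwq hr).congr_of_eventuallyEq ?_
    filter_upwards [isOpen_Ioo.mem_nhds hr] with x hx using hvq x (Ioo_subset_Icc_self hx)
  · exact (hasDerivAt_setIntegral_Ioo hvγi ((hcv.sub hγ).mono Ioo_subset_Icc_self) hr).const_add q0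
  · simp [hv]
  · exact H01_integral_dr hα1 u
  · obtain ⟨M, hM⟩ := isCompact_Icc.exists_bound_of_continuousOn hcq
    refine ⟨M / (1 - α), fun x hx => ?_⟩
    rw [hvq x (Ioo_subset_Icc_self hx), div_mul_eq_mul_div, mul_div_assoc,
      ← integral_rpow_inv hα1 hx.1.le, ← integral_const_mul, ← Real.norm_eq_abs]
    refine norm_integral_le_of_norm_le
      (((integrable_rpow_inv hα1).mono_measure
        (Measure.restrict_mono (Ioo_subset_Ioo_right hx.2.le) le_rfl)).const_mul M) ?_
    filter_upwards [ae_restrict_mem measurableSet_Ioo] with r hr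
    have hw := Real.rpow_pos_of_pos hr.1 α
    rw [norm_mul, Real.norm_of_nonneg (by positivity), mul_comm]
    exact mul_le_mul_of_nonneg_right (hM r ⟨hr.1.le, (hr.2.trans hx.2).le⟩) (by positivity)

end

/-- Finite sums of products of test functions in time and static solutions are classical. -/
theorem isClassical_sum {α T : ℝ} {ι : Type*} (F : Finset ι) {c : ι → ℝ → ℝ} {γ v q : ι → ℝ → ℝ}
    (hT : 0 < T) (hc : ∀ i, ContDiff ℝ 1 (c i))
    (hcs : ∀ i, HasCompactSupport (c i)) (hcT : ∀ i, tsupport (c i) ⊆ Ioo 0 T)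
    (hv : ∀ i, IsClassicalStatic α (γ i) (v i) (q i)) :
    IsClassical α T (fun t r => ∑ i ∈ F, c i t * v i r) (fun t r => ∑ i ∈ F, c i t * q i r)
      (fun t r => ∑ i ∈ F, deriv (c i) t * v i r) (fun t r => ∑ i ∈ F, deriv (c i) t * q i r)
      (fun t r => ∑ i ∈ F, c i t * (v i r - γ i r)) := by
  have joint : ∀ {a : ι → ℝ → ℝ} {h : ι → ℝ → ℝ}, (∀ i, Continuous (a i)) →
      (∀ i, ContinuousOn (h i) (Icc 0 1)) →
      ContinuousOn (Function.uncurry fun t r => ∑ i ∈ F, a i t * h i r)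
        (univ ×ˢ Icc (0 : ℝ) 1) := fun ha hh =>
    continuousOn_finsetSum F fun i _ =>
      ((ha i).comp continuous_fst).continuousOn.mul
        ((hh i).comp continuousOn_snd fun x hx => hx.2)
  have c0 : ∀ i, Continuous (c i) := fun i => (hc i).continuous
  have c1 : ∀ i, Continuous (deriv (c i)) := fun i => (hc i).continuous_deriv le_rfl
  have cd : ∀ i t, HasDerivAt (c i) (deriv (c i) t) t := fun i t =>
    ((hc i).differentiable one_ne_zero t).hasDerivAt
  refine
    { cφ := joint c0 fun i => (hv i).cv
      cQ := joint c0 fun i => (hv i).cq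
      cφt := joint c1 fun i => (hv i).cv
      cQt := joint c1 fun i => (hv i).cq
      cQr := joint c0 fun i => (hv i).cv.sub (hv i).cγ
      φ_r := fun t r hr => ?_
      Q_r := fun t r hr => ?_
      φt_r := fun t r hr => ?_
      φ_t := fun t r => ?_
      Q_t := fun t r => ?_
      φ_zero := fun t => by simp [(hv _).v_zero]
      φ_one := fun t => by simp [(hv _).v_one]
      φt_zero := fun t => by simp [(hv _).v_zero]
      φt_one := fun t => by simp [(hv _).v_one]
      decay := fun t => ?_
      supp := ?_ }
  · have h := HasDerivAt.fun_sum (u := F) fun i _ => ((hv i).v_r r hr).const_mul (c i t)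
    refine h.congr_deriv ?_
    rw [Finset.mul_sum]
    exact Finset.sum_congr rfl fun i _ => by ring
  · exact HasDerivAt.fun_sum (u := F) fun i _ => ((hv i).q_r r hr).const_mul (c i t)
  · have h := HasDerivAt.fun_sum (u := F) fun i _ => ((hv i).v_r r hr).const_mul (deriv (c i) t)
    refine h.congr_deriv ?_
    rw [Finset.mul_sum]
    exact Finset.sum_congr rfl fun i _ => by ring
  · exact HasDerivAt.fun_sum (u := F) fun i _ => (cd i t).mul_const (v i r)
  · exact HasDerivAt.fun_sum (u := F) fun i _ => (cd i t).mul_const (q i r)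
  · choose C hC using fun i => (hv i).decay
    refine ⟨∑ i ∈ F, |c i t| * C i, fun r hr => ?_⟩
    refine (Finset.abs_sum_le_sum_abs _ _).trans ?_
    rw [Finset.sum_mul]
    refine Finset.sum_le_sum fun i _ => ?_
    rw [abs_mul, mul_assoc]
    exact mul_le_mul_of_nonneg_left (hC i r hr) (abs_nonneg _)
  · have hK : IsCompact (⋃ i ∈ F, tsupport (c i)) := F.isCompact_biUnion fun i _ => hcs i
    obtain ⟨l, d, hl, hd, -, hsub⟩ := exists_Icc_of_isCompact hT hK
      (iUnion₂_subset fun i _ => hcT i)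
    refine ⟨min l (T - d), lt_min hl (by linarith), fun t ht r => ?_⟩
    have hnot : ∀ i ∈ F, t ∉ tsupport (c i) := fun i hi hmem => by
      have := hsub (mem_iUnion₂.2 ⟨i, hi, hmem⟩)
      refine ht ⟨(min_le_left _ _).trans this.1, ?_⟩
      linarith [this.2, min_le_right l (T - d)]
    have z0 : ∀ i ∈ F, c i t = 0 := fun i hi => image_eq_zero_of_notMem_tsupport (hnot i hi)
    have z1 : ∀ i ∈ F, deriv (c i) t = 0 := fun i hi =>
      Function.notMem_support.1 fun h => hnot i hi (support_deriv_subset h)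
    refine ⟨?_, ?_, ?_, ?_, ?_⟩ <;>
      exact Finset.sum_eq_zero fun i hi => by simp [z0 i hi, z1 i hi]

/-! ### Time-dependent quadratic forms on `L²(0, T; X)`. -/

/-- A measurable family of bounded quadratic forms. -/
structure IsQuadFamily {X : Type*} [NormedAddCommGroup X] (μ : Measure ℝ) (B : ℝ → X → ℝ)
    (M : ℝ) : Prop where
  meas : ∀ x, AEStronglyMeasurable (fun t => B t x) μ
  lip : ∀ᵐ t ∂μ, ∀ x y, |B t x - B t y| ≤ M * (‖x - y‖ * (‖x‖ + ‖y‖))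
  zero : ∀ t, B t 0 = 0

namespace IsQuadFamily

variable {X : Type*} [NormedAddCommGroup X] {μ : Measure ℝ} {B : ℝ → X → ℝ} {M : ℝ}

theorem abs_le (hB : IsQuadFamily μ B M) : ∀ᵐ t ∂μ, ∀ x, |B t x| ≤ M * ‖x‖ ^ 2 := by
  filter_upwards [hB.lip] with t ht x
  have h := ht x 0
  rw [hB.zero] at h
  simpa [sq] using h

theorem aestronglyMeasurable (hB : IsQuadFamily μ B M) {φ : ℝ → X} (hφ : AEStronglyMeasurable φ μ) :
    AEStronglyMeasurable (fun t => B t (φ t)) μ := by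
  obtain ⟨ψ, hψ, hφψ⟩ := hφ
  have h1 : AEStronglyMeasurable (fun t => B t (ψ t)) μ := by
    -- A simple function takes finitely many values, so measurability at fixed vectors suffices for
    -- it. The Lipschitz bound then passes to the limit.
    refine aestronglyMeasurable_of_tendsto_ae (u := atTop) (f := fun n t => B t (hψ.approx n t))
      (fun n => ?_) ?_
    · classical
      have e : (fun t => B t (hψ.approx n t)) = fun t =>
          ∑ x ∈ (hψ.approx n).range, ((hψ.approx n) ⁻¹' {x}).indicator (fun t => B t x) t := by
        funext t
        rw [Finset.sum_eq_single (hψ.approx n t)]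
        · simp
        · intro x _ hx
          rw [indicator_of_notMem]
          simpa using fun h => hx h.symm
        · intro h
          exact absurd (SimpleFunc.mem_range_self _ t) h
      rw [e]
      refine Finset.aestronglyMeasurable_fun_sum _ fun x _ => ?_
      exact (hB.meas x).indicator (SimpleFunc.measurableSet_fiber _ _)
    · filter_upwards [hB.lip] with t ht
      have hl := hψ.tendsto_approx t
      rw [tendsto_iff_norm_sub_tendsto_zero]
      refine squeeze_zero (fun _ => norm_nonneg _) (fun n => ht _ _) ?_
      have a1 := tendsto_iff_norm_sub_tendsto_zero.1 hl
      have a2 := hl.norm.add_const ‖ψ t‖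
      simpa using (a1.mul a2).const_mul M
  refine h1.congr ?_
  filter_upwards [hφψ] with t ht
  rw [ht]

theorem integrable (hB : IsQuadFamily μ B M) {φ : ℝ → X} (hφ : MemLp φ 2 μ) :
    Integrable (fun t => B t (φ t)) μ := by
  refine (hφ.integrable_norm_pow two_ne_zero |>.const_mul M).mono'
    (hB.aestronglyMeasurable hφ.1) ?_
  filter_upwards [hB.abs_le] with t ht using ht _

variable [InnerProductSpace ℝ X]

theorem integral_norm_mul_le {φ ψ : ℝ → X} (hφ : MemLp φ 2 μ) (hψ : MemLp ψ 2 μ) :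
    ∫ t, ‖φ t‖ * ‖ψ t‖ ∂μ ≤ ‖hφ.toLp φ‖ * ‖hψ.toLp ψ‖ := by
  have h := real_inner_le_norm (hφ.norm.toLp _) (hψ.norm.toLp _)
  have e : inner ℝ (hφ.norm.toLp (fun t => ‖φ t‖)) (hψ.norm.toLp (fun t => ‖ψ t‖))
      = ∫ t, ‖φ t‖ * ‖ψ t‖ ∂μ := by
    rw [L2.inner_def]
    refine integral_congr_ae ?_
    filter_upwards [hφ.norm.coeFn_toLp, hψ.norm.coeFn_toLp] with t h1 h2
    simp [h1, h2, mul_comm]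
  rw [e] at h
  simpa [Lp.norm_toLp, eLpNorm_norm] using h

/-- The local Lipschitz bound of the forms, integrated with Cauchy-Schwarz, is a local Lipschitz
bound in `L²`. It is used to pass to the limit in each of the four integrals of the estimate. -/
theorem continuous_integral (hB : IsQuadFamily μ B M) (hM : 0 ≤ M) :
    Continuous fun φ : Lp X 2 μ => ∫ t, B t (φ t) ∂μ := by
  rw [continuous_iff_continuousAt]
  intro φ
  rw [ContinuousAt, tendsto_iff_norm_sub_tendsto_zero]
  have key : ∀ ψ : Lp X 2 μ, ‖(∫ t, B t (ψ t) ∂μ) - ∫ t, B t (φ t) ∂μ‖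
      ≤ M * (‖ψ - φ‖ * ‖ψ‖ + ‖ψ - φ‖ * ‖φ‖) := by
    intro ψ
    have i1 := hB.integrable (Lp.memLp ψ)
    have i2 := hB.integrable (Lp.memLp φ)
    have m1 : MemLp (fun t => ψ t - φ t) 2 μ := (Lp.memLp ψ).sub (Lp.memLp φ)
    have e1 : ‖m1.toLp _‖ = ‖ψ - φ‖ := by
      congr 1
      rw [Lp.ext_iff]
      exact m1.coeFn_toLp.trans (Lp.coeFn_sub ψ φ).symm
    have b1 := integral_norm_mul_le m1 (Lp.memLp ψ)
    have b2 := integral_norm_mul_le m1 (Lp.memLp φ)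
    rw [e1, Lp.toLp_coeFn] at b1 b2
    have j1 : Integrable (fun t => ‖ψ t - φ t‖ * ‖ψ t‖) μ :=
      m1.norm.integrable_mul (Lp.memLp ψ).norm
    have j2 : Integrable (fun t => ‖ψ t - φ t‖ * ‖φ t‖) μ :=
      m1.norm.integrable_mul (Lp.memLp φ).norm
    rw [← integral_sub i1 i2]
    calc ‖∫ t, (B t (ψ t) - B t (φ t)) ∂μ‖
        ≤ ∫ t, M * (‖ψ t - φ t‖ * ‖ψ t‖ + ‖ψ t - φ t‖ * ‖φ t‖) ∂μ := by
          refine norm_integral_le_of_norm_le ((j1.add j2).const_mul M) ?_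
          filter_upwards [hB.lip] with t ht
          rw [← mul_add]
          exact ht _ _
      _ = M * ((∫ t, ‖ψ t - φ t‖ * ‖ψ t‖ ∂μ) + ∫ t, ‖ψ t - φ t‖ * ‖φ t‖ ∂μ) := by
          rw [integral_const_mul, integral_add j1 j2]
      _ ≤ _ := mul_le_mul_of_nonneg_left (add_le_add b1 b2) hM
  refine squeeze_zero (fun _ => norm_nonneg _) key ?_
  have c : Continuous fun ψ : Lp X 2 μ => M * (‖ψ - φ‖ * ‖ψ‖ + ‖ψ - φ‖ * ‖φ‖) := by fun_prop
  have := c.tendsto φ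
  simpa using this

end IsQuadFamily

/-- The quadratic form `x ↦ ∫ k(t, ·) x²` on `L²(ν)`. -/
def quad (ν : Measure ℝ) (k : ℝ → ℝ → ℝ) (t : ℝ) (x : Lp ℝ 2 ν) : ℝ := ∫ r, k t r * x r ^ 2 ∂ν

section

variable {ν : Measure ℝ} {k : ℝ → ℝ → ℝ} {t M : ℝ}

/-- Polarisation: the difference is the inner product of `x + y` with `k (x - y)`. -/
theorem abs_quad_sub_le (hk : AEStronglyMeasurable (k t) ν) (hM : ∀ᵐ r ∂ν, |k t r| ≤ M)
    (x y : Lp ℝ 2 ν) : |quad ν k t x - quad ν k t y| ≤ M * (‖x - y‖ * (‖x‖ + ‖y‖)) := by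
  have hz : ∀ z : Lp ℝ 2 ν, MemLp (fun r => k t r * z r) 2 ν := fun z =>
    MemLp.of_le_mul (c := M) (Lp.memLp z) (hk.mul (Lp.memLp z).1) (by
      filter_upwards [hM] with r hr
      rw [norm_mul]
      exact mul_le_mul_of_nonneg_right hr (norm_nonneg _))
  have hi : ∀ z : Lp ℝ 2 ν, Integrable (fun r => k t r * z r ^ 2) ν := fun z => by
    refine ((hz z).integrable_mul (Lp.memLp z)).congr (Eventually.of_forall fun r => ?_)
    simp only [Pi.mul_apply]
    ring
  have e : quad ν k t x - quad ν k t y = inner ℝ (x + y) ((hz (x - y)).toLp _) := by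
    rw [quad, quad, ← integral_sub (hi x) (hi y), L2.inner_def]
    refine integral_congr_ae ?_
    filter_upwards [Lp.coeFn_add x y, Lp.coeFn_sub x y, (hz (x - y)).coeFn_toLp] with r h1 h2 h3
    rw [h1, h3, h2]
    simp only [Pi.add_apply, Pi.sub_apply, RCLike.inner_apply, conj_trivial]
    ring
  have hn : ‖(hz (x - y)).toLp _‖ ≤ M * ‖x - y‖ := by
    refine Lp.norm_le_mul_norm_of_ae_le_mul ?_
    filter_upwards [(hz (x - y)).coeFn_toLp, hM] with r h3 hr
    rw [h3, norm_mul]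
    exact mul_le_mul_of_nonneg_right hr (norm_nonneg _)
  rw [e]
  calc |inner ℝ (x + y) ((hz (x - y)).toLp _)| ≤ ‖x + y‖ * ‖(hz (x - y)).toLp _‖ :=
        abs_real_inner_le_norm _ _
    _ ≤ (‖x‖ + ‖y‖) * (M * ‖x - y‖) :=
        mul_le_mul (norm_add_le _ _) hn (norm_nonneg _) (by positivity)
    _ = _ := by ring

theorem quad_zero (ν : Measure ℝ) (k : ℝ → ℝ → ℝ) (t : ℝ) : quad ν k t 0 = 0 := by
  have : (fun r => k t r * (0 : Lp ℝ 2 ν) r ^ 2) =ᵐ[ν] fun _ => 0 := by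
    filter_upwards [Lp.coeFn_zero ℝ 2 ν] with r hr
    rw [hr]
    simp
  rw [quad, integral_congr_ae this, integral_zero]

theorem isQuadFamily_quad [SFinite ν] {μ : Measure ℝ} [SFinite μ]
    (hk : AEStronglyMeasurable (Function.uncurry k) (μ.prod ν))
    (hM : ∀ᵐ t ∂μ, ∀ᵐ r ∂ν, |k t r| ≤ M) {X : Type*} [NormedAddCommGroup X] [NormedSpace ℝ X]
    (A : X →L[ℝ] Lp ℝ 2 ν) (hM0 : 0 ≤ M) :
    IsQuadFamily μ (fun t x => quad ν k t (A x)) (M * ‖A‖ ^ 2) where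
  meas x := by
    have h : AEStronglyMeasurable (fun p : ℝ × ℝ => k p.1 p.2 * (A x) p.2 ^ 2) (μ.prod ν) :=
      hk.mul (((Lp.memLp (A x)).1.comp_snd).pow 2)
    exact h.integral_prod_right'
  lip := by
    filter_upwards [hM, hk.prodMk_left] with t h1 h2 x y
    refine (abs_quad_sub_le h2 h1 (A x) (A y)).trans ?_
    rw [mul_assoc]
    refine mul_le_mul_of_nonneg_left ?_ hM0
    rw [← map_sub]
    calc ‖A (x - y)‖ * (‖A x‖ + ‖A y‖) ≤ (‖A‖ * ‖x - y‖) * (‖A‖ * ‖x‖ + ‖A‖ * ‖y‖) :=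
          mul_le_mul (A.le_opNorm _) (add_le_add (A.le_opNorm _) (A.le_opNorm _)) (by positivity)
            (by positivity)
      _ = _ := by ring
  zero t := by simp only [map_zero, quad_zero]

end

/-! ### Density of separated solutions among weak solutions. -/

/-- A bounded symmetric injective operator that leaves a closed subspace invariant reflects
membership in the subspace. -/
theorem mem_of_sq_mem {X : Type*} [NormedAddCommGroup X] [InnerProductSpace ℝ X]
    (W : Submodule ℝ X) [W.HasOrthogonalProjection] (A : X →ₗ[ℝ] X)
    (hsym : ∀ x y, inner ℝ (A x) y = inner ℝ x (A y)) (hinj : ∀ x, A x = 0 → x = 0)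
    (hW : ∀ x ∈ W, A x ∈ W) {x : X} (hx : A (A x) ∈ W) : x ∈ W := by
  obtain ⟨y, hy, z, hz, rfl⟩ := W.exists_add_mem_mem_orthogonal x
  -- By symmetry the orthogonal complement is invariant too, so the square of `A` maps the
  -- orthogonal part of `x` into `W ∩ Wᗮ = 0`. Injectivity then removes that part.
  have hW' : ∀ u ∈ Wᗮ, A u ∈ Wᗮ := fun u hu => by
    rw [Submodule.mem_orthogonal] at hu ⊢
    intro w hw
    rw [← hsym]
    exact hu _ (hW w hw)
  have h1 : A (A z) ∈ W := by
    have := W.sub_mem hx (hW _ (hW _ hy))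
    simpa only [map_add, add_sub_cancel_left] using this
  have h2 : A (A z) = 0 := by
    have h := (Submodule.mem_orthogonal _ _).1 (hW' _ (hW' _ hz)) _ h1
    exact inner_self_eq_zero.1 h
  rw [hinj _ (hinj _ h2), add_zero]
  exact hy

/-- `L²(0, T; X)`. -/
abbrev LT (T : ℝ) (X : Type*) [NormedAddCommGroup X] : Type _ :=
  Lp X 2 (volume.restrict (Ioo 0 T))

theorem memLp_of_continuous {X : Type*} [NormedAddCommGroup X] (T : ℝ) {c : ℝ → X}
    (hc : Continuous c) : MemLp c 2 (volume.restrict (Ioo 0 T)) := by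
  obtain ⟨M, hM⟩ := (isCompact_Icc (a := 0) (b := T)).exists_bound_of_continuousOn hc.continuousOn
  refine MemLp.of_bound hc.aestronglyMeasurable M ?_
  filter_upwards [ae_restrict_mem measurableSet_Ioo] with r hr
  exact hM r (Ioo_subset_Icc_self hr)

theorem integrableOn_of_memLp {X : Type*} [NormedAddCommGroup X] {T : ℝ} {c : ℝ → X}
    (hc : MemLp c 2 (volume.restrict (Ioo 0 T))) : IntegrableOn c (Ioo 0 T) :=
  hc.integrable (by norm_num)

section tensor

variable {X Y : Type*} [NormedAddCommGroup X] [NormedSpace ℝ X] [NormedAddCommGroup Y]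
  [NormedSpace ℝ Y] {T : ℝ} {c : ℝ → ℝ}

/-- The function `t ↦ c t • x` in `L²(0, T; X)`. -/
def tensor (T : ℝ) (hc : Continuous c) : X →L[ℝ] LT T X :=
  ((ContinuousLinearMap.lsmul ℝ ℝ).flip.compLpL₂ 2 (volume.restrict (Ioo 0 T))).flip
    ((memLp_of_continuous T hc).toLp c)

theorem coeFn_tensor (hc : Continuous c) (x : X) :
    tensor T hc x =ᵐ[volume.restrict (Ioo 0 T)] fun t => c t • x := by
  filter_upwards [ContinuousLinearMap.coeFn_compLp ((ContinuousLinearMap.lsmul ℝ ℝ).flip x)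
    ((memLp_of_continuous T hc).toLp c), (memLp_of_continuous T hc).coeFn_toLp] with t h1 h2
  refine h1.trans ?_
  rw [h2]
  rfl

theorem compLpL_tensor (L : X →L[ℝ] Y) (hc : Continuous c) (x : X) :
    L.compLpL 2 _ (tensor T hc x) = tensor T hc (L x) := by
  rw [Lp.ext_iff]
  filter_upwards [L.coeFn_compLpL (tensor T hc x), coeFn_tensor (T := T) hc x,
    coeFn_tensor (T := T) hc (L x)] with t h1 h2 h3
  rw [h1, h2, h3, map_smul]

variable [CompleteSpace X]

theorem memLp_primitive (z : LT T X) :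
    MemLp (fun t => ∫ s in Ioo 0 t, z s) 2 (volume.restrict (Ioo 0 T)) := by
  have hc := continuous_primitive (integrableOn_of_memLp (Lp.memLp z))
  obtain ⟨M, hM⟩ := isCompact_Icc.exists_bound_of_continuousOn hc
  refine MemLp.of_bound ((hc.mono Ioo_subset_Icc_self).aestronglyMeasurable measurableSet_Ioo) M ?_
  filter_upwards [ae_restrict_mem measurableSet_Ioo] with r hr
  exact hM r (Ioo_subset_Icc_self hr)

/-- `z ↦ ∫_0^t z` on `L²(0, T; X)`. -/
def primitiveL (T : ℝ) (X : Type*) [NormedAddCommGroup X] [NormedSpace ℝ X] [CompleteSpace X] :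
    LT T X →L[ℝ] LT T X := by
  have hm := memLp_primitive (T := T) (X := X)
  have hsub : ∀ {t}, t ∈ Ioo 0 T → Ioo 0 t ⊆ Ioo 0 T := fun ht => Ioo_subset_Ioo_right ht.2.le
  have hi : ∀ z : LT T X, IntegrableOn z (Ioo 0 T) := fun z => integrableOn_of_memLp (Lp.memLp z)
  -- Cauchy-Schwarz against the constant `1` bounds the primitive uniformly in `t`, and a uniform
  -- bound is an `L²` bound on a finite interval.
  refine LinearMap.mkContinuous
    { toFun := fun z => (hm z).toLp _
      map_add' := fun y z => ?_
      map_smul' := fun c z => ?_ }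
    ((measureUnivNNReal (volume.restrict (Ioo 0 T)) : ℝ) ^ (2 : ℝ≥0∞).toReal⁻¹
      * ‖(memLp_of_continuous T (continuous_const (y := (1 : ℝ)))).toLp _‖) fun z => ?_
  · rw [Lp.ext_iff]
    filter_upwards [(hm (y + z)).coeFn_toLp, (hm y).coeFn_toLp, (hm z).coeFn_toLp,
      Lp.coeFn_add ((hm y).toLp _) ((hm z).toLp _), ae_restrict_mem measurableSet_Ioo]
      with t h1 h2 h3 h4 ht
    rw [h1, h4, Pi.add_apply, h2, h3, ← integral_add ((hi y).mono_set (hsub ht))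
      ((hi z).mono_set (hsub ht))]
    refine integral_congr_ae ?_
    exact ae_restrict_of_ae_restrict_of_subset (hsub ht) (Lp.coeFn_add y z)
  · rw [Lp.ext_iff]
    filter_upwards [(hm (c • z)).coeFn_toLp, (hm z).coeFn_toLp,
      Lp.coeFn_smul c ((hm z).toLp _), ae_restrict_mem measurableSet_Ioo]
      with t h1 h3 h4 ht
    rw [h1, RingHom.id_apply, h4, Pi.smul_apply, h3, ← integral_smul]
    refine integral_congr_ae ?_
    exact ae_restrict_of_ae_restrict_of_subset (hsub ht) (Lp.coeFn_smul c z)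
  · have hb : ∀ t ∈ Ioo 0 T, ‖∫ s in Ioo 0 t, z s‖
        ≤ ‖(memLp_of_continuous T (continuous_const (y := (1 : ℝ)))).toLp _‖ * ‖z‖ := by
      intro t ht
      calc ‖∫ s in Ioo 0 t, z s‖ ≤ ∫ s in Ioo 0 t, ‖z s‖ := norm_integral_le_integral_norm _
        _ ≤ ∫ s in Ioo 0 T, ‖z s‖ := setIntegral_mono_set (hi z).norm
            (Eventually.of_forall fun _ => norm_nonneg _) (hsub ht).eventuallyLE
        _ = ∫ s in Ioo 0 T, ‖(1 : ℝ)‖ * ‖‖z s‖‖ := by simp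
        _ ≤ _ := by
            have h := IsQuadFamily.integral_norm_mul_le
              (memLp_of_continuous T (continuous_const (y := (1 : ℝ)))) (Lp.memLp z).norm
            refine h.trans_eq ?_
            rw [Lp.norm_toLp (fun t => ‖z t‖), eLpNorm_norm, Lp.norm_def z]
    have h := Lp.norm_le_of_ae_bound (f := (hm z).toLp _) (mul_nonneg (norm_nonneg _) (norm_nonneg _)) (by
      filter_upwards [(hm z).coeFn_toLp, ae_restrict_mem measurableSet_Ioo] with t h1 ht
      rw [h1]
      exact hb t ht)
    rw [mul_assoc]
    exact h

theorem coeFn_primitiveL (z : LT T X) :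
    primitiveL T X z =ᵐ[volume.restrict (Ioo 0 T)] fun t => ∫ s in Ioo 0 t, z s :=
  (memLp_primitive z).coeFn_toLp

theorem primitiveL_tensor (hc : Continuous c) {C : ℝ → ℝ} (hC : Continuous C)
    (h : ∀ t, C t = ∫ s in (0 : ℝ)..t, c s) (x : X) :
    primitiveL T X (tensor T hc x) = tensor T hC x := by
  rw [Lp.ext_iff]
  filter_upwards [coeFn_primitiveL (tensor T hc x), coeFn_tensor (T := T) hC x,
    ae_restrict_mem measurableSet_Ioo] with t h1 h2 ht
  rw [h1, h2, h, intervalIntegral.integral_of_le ht.1.le, integral_Ioc_eq_integral_Ioo,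
    ← integral_smul_const]
  exact integral_congr_ae (ae_restrict_of_ae_restrict_of_subset (Ioo_subset_Ioo_right ht.2.le)
    (coeFn_tensor hc x))

end tensor

/-- An integrable function on `(0, T)` whose inner products with constant vectors integrate to
zero against test functions vanishes. -/
theorem ae_eq_zero_of_forall_integral_inner {X : Type*} [NormedAddCommGroup X]
    [InnerProductSpace ℝ X] [CompleteSpace X] {T : ℝ} {p : ℝ → X} (hp : IntegrableOn p (Ioo 0 T))
    (h : ∀ χ : ℝ → ℝ, ContDiff ℝ ∞ χ → ∀ x, ∫ t in Ioo 0 T, χ t * inner ℝ x (p t) = 0) :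
    ∀ᵐ t ∂(volume.restrict (Ioo 0 T)), p t = 0 := by
  rw [ae_restrict_iff' measurableSet_Ioo]
  refine isOpen_Ioo.ae_eq_zero_of_integral_contDiff_smul_eq_zero hp.locallyIntegrableOn
    (fun χ h1 h2 h3 => ?_)
  have e : ∫ x, χ x • p x = ∫ x in Ioo 0 T, χ x • p x := by
    refine (setIntegral_eq_integral_of_forall_compl_eq_zero fun x hx => ?_).symm
    rw [image_eq_zero_of_notMem_tsupport fun hmem => hx (h3 hmem), zero_smul]
  rw [e]
  refine ext_inner_left ℝ fun x => ?_
  rw [inner_zero_right, ← integral_inner (integrableOn_smul_of_continuous h1.continuous hp)]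
  refine Eq.trans (integral_congr_ae (Eventually.of_forall fun t => ?_)) (h χ h1 x)
  exact inner_smul_right _ _ _

/-- The products of smooth functions and vectors are total in `L²(0, T; X)`. -/
theorem mem_of_forall_tensor_mem {X : Type*} [NormedAddCommGroup X] [InnerProductSpace ℝ X]
    [CompleteSpace X] {T : ℝ} (W : Submodule ℝ (LT T X)) (hW : IsClosed (W : Set (LT T X)))
    (h : ∀ (c : ℝ → ℝ) (hc : Continuous c) (x : X), tensor T hc x ∈ W) (z : LT T X) : z ∈ W := by
  have h1 : Wᗮ = ⊥ := by
    rw [Submodule.eq_bot_iff]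
    intro p hp
    rw [Submodule.mem_orthogonal] at hp
    have h0 := ae_eq_zero_of_forall_integral_inner (integrableOn_of_memLp (Lp.memLp p))
      (fun χ hχ x => by
        refine Eq.trans ?_ ((L2.inner_def _ _).symm.trans (hp _ (h χ hχ.continuous x)))
        refine integral_congr_ae ?_
        filter_upwards [coeFn_tensor (T := T) hχ.continuous x] with t ht
        rw [ht, inner_smul_left]
        rfl)
    rw [Lp.ext_iff]
    filter_upwards [h0, Lp.coeFn_zero X 2 (volume.restrict (Ioo 0 T))] with t h2 h3
    rw [h2, h3, Pi.zero_apply]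
  have h2 := Submodule.topologicalClosure_eq_top_iff.2 h1
  rw [hW.submodule_topologicalClosure_eq] at h2
  rw [h2]
  trivial

section density

variable {V H : Type*} [NormedAddCommGroup V] [InnerProductSpace ℝ V] [CompleteSpace V]
  [NormedAddCommGroup H] [InnerProductSpace ℝ H] [CompleteSpace H]
  (ι : V →L[ℝ] H) (T N : ℝ)

/-- The pair of a separated function `c ⊗ ι* g` and of the right-hand side of the parabolic
equation it solves. -/
def graphPair {c : ℝ → ℝ} (hc : ContDiff ℝ 1 c) (g : H) : WithLp 2 (LT T V × LT T H) :=
  WithLp.toLp 2 (tensor T hc.continuous (ι.adjoint g),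
    tensor T (hc.continuous_deriv le_rfl) (ι (ι.adjoint g)) + tensor T hc.continuous g
      + (N - 1) • tensor T hc.continuous (ι (ι.adjoint g)))

/-- The span of the pairs `graphPair c g` for `g ∈ D`. -/
def graphSpan (D : Set H) : Submodule ℝ (WithLp 2 (LT T V × LT T H)) :=
  Submodule.span ℝ {p | ∃ (c : ℝ → ℝ) (hc : ContDiff ℝ 1 c), ∃ g ∈ D, p = graphPair ι T N hc g}

variable {ι T N}

/-- The pair depends continuously on `g`. Classical regularity is needed only for `g` in a dense
set, while the closure contains all data, in particular those that smoothing produces. -/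
theorem graphPair_mem_closure {D : Set H} (hD : Dense D) {c : ℝ → ℝ} (hc : ContDiff ℝ 1 c) (g : H) :
    graphPair ι T N hc g ∈ (graphSpan ι T N D).topologicalClosure := by
  have hcont : Continuous fun g => graphPair ι T N hc g := by
    unfold graphPair
    refine (WithLp.prod_continuous_toLp 2 _ _).comp ?_
    fun_prop
  have hcl : IsClosed {g | graphPair ι T N hc g ∈ (graphSpan ι T N D).topologicalClosure} :=
    (Submodule.isClosed_topologicalClosure _).preimage hcont
  have hsub : D ⊆ {g | graphPair ι T N hc g ∈ (graphSpan ι T N D).topologicalClosure} :=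
    fun g hg => Submodule.le_topologicalClosure _ (Submodule.subset_span ⟨c, hc, g, hg, rfl⟩)
  have h := hcl.closure_subset_iff.2 hsub
  rw [hD.closure_eq] at h
  exact h (mem_univ g)

variable (ι T) in
/-- The smoothing operator `(ι* ι, ι ι*)`. -/
def smoothing : WithLp 2 (LT T V × LT T H) →L[ℝ] WithLp 2 (LT T V × LT T H) :=
  (WithLp.prodContinuousLinearEquiv 2 ℝ _ _).symm.toContinuousLinearMap ∘L
    (((ι.adjoint ∘L ι).compLpL 2 _).prodMap ((ι ∘L ι.adjoint).compLpL 2 _)) ∘L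
    (WithLp.prodContinuousLinearEquiv 2 ℝ _ _).toContinuousLinearMap

theorem smoothing_apply (p : WithLp 2 (LT T V × LT T H)) :
    smoothing ι T p = WithLp.toLp 2 ((ι.adjoint ∘L ι).compLpL 2 _ p.fst,
      (ι ∘L ι.adjoint).compLpL 2 _ p.snd) := rfl

theorem smoothing_graphPair {c : ℝ → ℝ} (hc : ContDiff ℝ 1 c) (g : H) :
    smoothing ι T (graphPair ι T N hc g) = graphPair ι T N hc (ι (ι.adjoint g)) := by
  rw [smoothing_apply]
  refine congrArg (WithLp.toLp 2) (Prod.ext ?_ ?_)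
  · exact compLpL_tensor _ _ _
  · change (ι ∘L ι.adjoint).compLpL 2 _ (tensor T (hc.continuous_deriv le_rfl) (ι (ι.adjoint g))
      + tensor T hc.continuous g + (N - 1) • tensor T hc.continuous (ι (ι.adjoint g))) = _
    simp only [map_add, map_smul, compLpL_tensor, ContinuousLinearMap.comp_apply]

theorem inner_compLpL {X : Type*} [NormedAddCommGroup X] [InnerProductSpace ℝ X] {μ : Measure ℝ}
    {L : X →L[ℝ] X} (hL : ∀ x y, inner ℝ (L x) y = inner ℝ x (L y)) (u v : Lp X 2 μ) :
    inner ℝ (L.compLpL 2 μ u) v = inner ℝ u (L.compLpL 2 μ v) := by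
  rw [L2.inner_def, L2.inner_def]
  refine integral_congr_ae ?_
  filter_upwards [L.coeFn_compLpL u, L.coeFn_compLpL v] with t h1 h2
  rw [h1, h2, hL]

theorem compLpL_eq_zero {X Y : Type*} [NormedAddCommGroup X] [NormedSpace ℝ X]
    [NormedAddCommGroup Y] [NormedSpace ℝ Y] {μ : Measure ℝ}
    {L : X →L[ℝ] Y} (hL : ∀ x, L x = 0 → x = 0) {u : Lp X 2 μ} (h : L.compLpL 2 μ u = 0) :
    u = 0 := by
  rw [Lp.ext_iff] at h ⊢
  filter_upwards [h, L.coeFn_compLpL u, Lp.coeFn_zero Y 2 μ, Lp.coeFn_zero X 2 μ] with t h1 h2 h3 h4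
  rw [h4]
  refine hL _ ?_
  rw [← h2, h1, h3]
  rfl

theorem smoothing_symm (p q : WithLp 2 (LT T V × LT T H)) :
    inner ℝ (smoothing ι T p) q = inner ℝ p (smoothing ι T q) := by
  rw [WithLp.prod_inner_apply, WithLp.prod_inner_apply]
  refine congrArg₂ (· + ·) (inner_compLpL (fun x y => ?_) _ _) (inner_compLpL (fun x y => ?_) _ _)
  · simp only [ContinuousLinearMap.comp_apply, ContinuousLinearMap.adjoint_inner_left,
      ContinuousLinearMap.adjoint_inner_right]
  · exact (ContinuousLinearMap.adjoint_inner_right ι _ _).symm.trans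
      (ContinuousLinearMap.adjoint_inner_left ι _ _)

/-- Both components are compositions of `ι` and `ι*`, and injectivity carries over pointwise in
time. -/
theorem smoothing_injective (h1 : Function.Injective ι) (h2 : Function.Injective ι.adjoint)
    (p : WithLp 2 (LT T V × LT T H)) (hp : smoothing ι T p = 0) : p = 0 := by
  rw [smoothing_apply] at hp
  have e1 : (ι.adjoint ∘L ι).compLpL 2 _ p.fst = 0 := congrArg WithLp.fst hp
  have e2 : (ι ∘L ι.adjoint).compLpL 2 _ p.snd = 0 := congrArg WithLp.snd hp
  have f1 := compLpL_eq_zero (fun x hx => h1 (h2 (by simpa using hx))) e1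
  have f2 := compLpL_eq_zero (fun x hx => h2 (h1 (by simpa using hx))) e2
  refine (WithLp.ext_iff 2).2 ?_
  exact Prod.ext f1 f2

/-- Smoothing commutes with the parabolic operator: it sends the separated pair of `g` to that of `ι
ι* g`. This is the invariance required by `mem_of_sq_mem`. -/
theorem smoothing_mem_closure {D : Set H} (hD : Dense D)
    {p : WithLp 2 (LT T V × LT T H)} (hp : p ∈ (graphSpan ι T N D).topologicalClosure) :
    smoothing ι T p ∈ (graphSpan ι T N D).topologicalClosure := by
  have h : (graphSpan ι T N D).topologicalClosure ≤
      (graphSpan ι T N D).topologicalClosure.comap (smoothing ι T).toLinearMap := by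
    refine Submodule.topologicalClosure_minimal _ (Submodule.span_le.2 ?_)
      ((Submodule.isClosed_topologicalClosure _).preimage (smoothing ι T).continuous)
    rintro _ ⟨c, hc, g, -, rfl⟩
    rw [SetLike.mem_coe, Submodule.mem_comap, ContinuousLinearMap.coe_coe, smoothing_graphPair]
    exact graphPair_mem_closure hD hc _
  exact h hp

variable (ι T N) in
/-- The solution with prescribed time derivative and zero initial value, with its right-hand
side. -/
def solPair : LT T H →L[ℝ] WithLp 2 (LT T V × LT T H) :=
  (WithLp.prodContinuousLinearEquiv 2 ℝ _ _).symm.toContinuousLinearMap ∘L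
    ((ι.adjoint.compLpL 2 _ ∘L primitiveL T H).prod
      ((ι ∘L ι.adjoint).compLpL 2 _ + primitiveL T H
        + (N - 1) • ((ι ∘L ι.adjoint).compLpL 2 _ ∘L primitiveL T H)))

theorem solPair_apply (z : LT T H) : solPair ι T N z
    = WithLp.toLp 2 (ι.adjoint.compLpL 2 _ (primitiveL T H z),
      (ι ∘L ι.adjoint).compLpL 2 _ z + primitiveL T H z
        + (N - 1) • (ι ∘L ι.adjoint).compLpL 2 _ (primitiveL T H z)) := rfl

/-- The map is linear and continuous in `z`, so it suffices to take `z = c ⊗ g`. Then the pair is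
the separated one whose time factor is the primitive of `c`. -/
theorem solPair_mem_closure {D : Set H} (hD : Dense D) (z : LT T H) :
    solPair ι T N z ∈ (graphSpan ι T N D).topologicalClosure := by
  refine mem_of_forall_tensor_mem
    ((graphSpan ι T N D).topologicalClosure.comap (solPair ι T N).toLinearMap)
    ((Submodule.isClosed_topologicalClosure _).preimage (solPair ι T N).continuous)
    (fun c hc g => ?_) z
  rw [Submodule.mem_comap, ContinuousLinearMap.coe_coe]
  have hd : ∀ t, HasDerivAt (fun t => ∫ s in (0 : ℝ)..t, c s) (c t) t := fun t =>
    (hc.integral_hasStrictDerivAt 0 t).hasDerivAt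
  have hderiv : deriv (fun t => ∫ s in (0 : ℝ)..t, c s) = c := funext fun t => (hd t).deriv
  have hC : ContDiff ℝ 1 fun t => ∫ s in (0 : ℝ)..t, c s := by
    rw [contDiff_one_iff_deriv, hderiv]
    exact ⟨fun t => (hd t).differentiableAt, hc⟩
  have e : solPair ι T N (tensor T hc g) = graphPair ι T N hC g := by
    rw [solPair_apply, primitiveL_tensor hc hC.continuous (fun _ => rfl), graphPair]
    simp only [compLpL_tensor, ContinuousLinearMap.comp_apply, hderiv]
  rw [e]
  exact graphPair_mem_closure hD hC g

/-- Weak solutions of `(ι* ι φ)' + φ + (N - 1) ι* ι φ = ι* f` lie in the closure of the span of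
separated solutions. -/
theorem mem_closure_graphSpan {D : Set H} (hD : Dense D) (hT : 0 < T)
    (h1 : Function.Injective ι) (h2 : Function.Injective ι.adjoint)
    {φ ψ : ℝ → V} {f : ℝ → H} (hφ : MemLp φ 2 (volume.restrict (Ioo 0 T)))
    (hψ : MemLp ψ 2 (volume.restrict (Ioo 0 T))) (hf : MemLp f 2 (volume.restrict (Ioo 0 T)))
    (hd : ∀ χ : ℝ → ℝ, ContDiff ℝ ∞ χ → HasCompactSupport χ → tsupport χ ⊆ Ioo 0 T →
      ∫ t in Ioo 0 T, deriv χ t • ι.adjoint (ι (φ t)) = -∫ t in Ioo 0 T, χ t • ψ t)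
    (he : ∀ᵐ t ∂(volume.restrict (Ioo 0 T)),
      ψ t + φ t + (N - 1) • ι.adjoint (ι (φ t)) = ι.adjoint (f t)) :
    (WithLp.toLp 2 (hφ.toLp φ, hf.toLp f) : WithLp 2 (LT T V × LT T H))
      ∈ (graphSpan ι T N D).topologicalClosure := by
  refine mem_of_sq_mem _ (smoothing ι T).toLinearMap smoothing_symm
    (smoothing_injective h1 h2) (fun _ => smoothing_mem_closure hD) ?_
  obtain ⟨y0, hy0⟩ := exists_eq_primitive_of_weakDeriv hT
    ((ι.adjoint ∘L ι).integrable_comp (integrableOn_of_memLp hφ))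
    (integrableOn_of_memLp hψ) hd
  have hz : MemLp (fun t => ι (ψ t)) 2 (volume.restrict (Ioo 0 T)) := hψ.continuousLinearMap_comp ι
  -- Two smoothings turn `φ` into `ι* Y` with `Y = ι ι* ι φ`. The derivative of `Y` is `ι ψ`, which
  -- lies in `L²(0, T; H)`, and its initial value is `ι y0`. The twice smoothed pair is therefore a
  -- constant-in-time separated pair plus a pair with zero initial value.
  have hmem := Submodule.add_mem _
    (graphPair_mem_closure (ι := ι) (T := T) (N := N) hD (contDiff_const (c := (1 : ℝ))) (ι y0))
    (solPair_mem_closure (ι := ι) (N := N) hD (hz.toLp _))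
  refine (congrArg (· ∈ (graphSpan ι T N D).topologicalClosure) ?_).mpr hmem
  have hprim : ∀ᵐ t ∂(volume.restrict (Ioo 0 T)),
      ι (ι.adjoint (ι (φ t))) = ι y0 + ∫ s in Ioo 0 t, (hz.toLp _ : LT T H) s := by
    filter_upwards [hy0, ae_restrict_mem measurableSet_Ioo] with t ht htT
    have hs : Ioo 0 t ⊆ Ioo 0 T := Ioo_subset_Ioo_right htT.2.le
    have ht' : ι.adjoint (ι (φ t)) = y0 + ∫ s in Ioo 0 t, ψ s := ht
    rw [ht', map_add, ← ι.integral_comp_comm ((integrableOn_of_memLp hψ).mono_set hs)]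
    congr 1
    exact integral_congr_ae (ae_restrict_of_ae_restrict_of_subset hs hz.coeFn_toLp.symm)
  rw [solPair_apply, graphPair]
  change smoothing ι T (smoothing ι T _) = _
  rw [smoothing_apply, smoothing_apply]
  refine (WithLp.ext_iff 2).2 (Prod.ext ?_ ?_)
  · change (ι.adjoint ∘L ι).compLpL 2 _ ((ι.adjoint ∘L ι).compLpL 2 _ (hφ.toLp φ))
      = tensor T (c := fun _ => (1 : ℝ)) continuous_const (ι.adjoint (ι y0))
        + ι.adjoint.compLpL 2 _ (primitiveL T H (hz.toLp _))
    rw [Lp.ext_iff]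
    refine EventuallyEq.trans ?_ (Lp.coeFn_add _ _).symm
    filter_upwards [hprim, hφ.coeFn_toLp, (ι.adjoint ∘L ι).coeFn_compLpL (hφ.toLp φ),
      (ι.adjoint ∘L ι).coeFn_compLpL ((ι.adjoint ∘L ι).compLpL 2 _ (hφ.toLp φ)),
      coeFn_tensor (T := T) (c := fun _ => 1) continuous_const (ι.adjoint (ι y0)),
      ι.adjoint.coeFn_compLpL (primitiveL T H (hz.toLp _)),
      coeFn_primitiveL (T := T) (hz.toLp _)] with t e1 e2 e3 e4 e5 e6 e7
    rw [Pi.add_apply, e4, e5, e6, e7, e3, e2, one_smul, ← map_add, ← e1]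
    rfl
  · change (ι ∘L ι.adjoint).compLpL 2 _ ((ι ∘L ι.adjoint).compLpL 2 _ (hf.toLp f))
      = (tensor T (contDiff_const (c := (1 : ℝ)).continuous_deriv le_rfl) (ι (ι.adjoint (ι y0)))
          + tensor T (c := fun _ => (1 : ℝ)) continuous_const (ι y0)
          + (N - 1) • tensor T (c := fun _ => (1 : ℝ)) continuous_const (ι (ι.adjoint (ι y0))))
        + ((ι ∘L ι.adjoint).compLpL 2 _ (hz.toLp _) + primitiveL T H (hz.toLp _)
          + (N - 1) • (ι ∘L ι.adjoint).compLpL 2 _ (primitiveL T H (hz.toLp _)))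
    have d0 : tensor T (contDiff_const (c := (1 : ℝ)).continuous_deriv le_rfl)
        (ι (ι.adjoint (ι y0))) = 0 := by
      rw [Lp.ext_iff]
      filter_upwards [coeFn_tensor (T := T) (contDiff_const (c := (1 : ℝ)).continuous_deriv le_rfl)
        (ι (ι.adjoint (ι y0))), Lp.coeFn_zero H 2 (volume.restrict (Ioo 0 T))] with t e1 e2
      rw [e1, e2, deriv_const, zero_smul, Pi.zero_apply]
    have y1 : tensor T (c := fun _ => (1 : ℝ)) continuous_const (ι y0) + primitiveL T H (hz.toLp _)
        = (ι ∘L ι.adjoint ∘L ι).compLpL 2 _ (hφ.toLp φ) := by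
      rw [Lp.ext_iff]
      refine (Lp.coeFn_add _ _).trans ?_
      filter_upwards [hprim, hφ.coeFn_toLp, (ι ∘L ι.adjoint ∘L ι).coeFn_compLpL (hφ.toLp φ),
        coeFn_tensor (T := T) (c := fun _ => 1) continuous_const (ι y0),
        coeFn_primitiveL (T := T) (hz.toLp _)] with t e1 e2 e3 e4 e5
      rw [Pi.add_apply, e3, e4, e5, e2, one_smul, ← e1]
      rfl
    -- The equation composed with `ι`. Composing once more with `ι ι*` gives the second component of
    -- the sum above.
    have y2 : (ι ∘L ι.adjoint).compLpL 2 _ (hf.toLp f)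
        = hz.toLp _ + ι.compLpL 2 _ (hφ.toLp φ)
          + (N - 1) • (ι ∘L ι.adjoint ∘L ι).compLpL 2 _ (hφ.toLp φ) := by
      rw [Lp.ext_iff]
      refine EventuallyEq.trans ?_ (Lp.coeFn_add _ _).symm
      filter_upwards [he, hφ.coeFn_toLp, hf.coeFn_toLp, hz.coeFn_toLp,
        (ι ∘L ι.adjoint).coeFn_compLpL (hf.toLp f), ι.coeFn_compLpL (hφ.toLp φ),
        (ι ∘L ι.adjoint ∘L ι).coeFn_compLpL (hφ.toLp φ),
        Lp.coeFn_add (hz.toLp _) (ι.compLpL 2 _ (hφ.toLp φ)),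
        Lp.coeFn_smul (N - 1) ((ι ∘L ι.adjoint ∘L ι).compLpL 2 _ (hφ.toLp φ))]
        with t e0 e1 e2 e3 e4 e5 e6 e7 e8
      rw [Pi.add_apply, e7, e8, Pi.add_apply, Pi.smul_apply, e3, e4, e5, e6, e1, e2]
      have := congrArg ι e0
      simp only [map_add, map_smul] at this
      exact this.symm
    have y3 : (ι ∘L ι.adjoint).compLpL 2 _ (ι.compLpL 2 _ (hφ.toLp φ))
        = (ι ∘L ι.adjoint ∘L ι).compLpL 2 _ (hφ.toLp φ) := by
      rw [Lp.ext_iff]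
      filter_upwards [(ι ∘L ι.adjoint).coeFn_compLpL (ι.compLpL 2 _ (hφ.toLp φ)),
        ι.coeFn_compLpL (hφ.toLp φ), (ι ∘L ι.adjoint ∘L ι).coeFn_compLpL (hφ.toLp φ)]
        with t e1 e2 e3
      rw [e1, e2, e3]
      rfl
    have y4 : (ι ∘L ι.adjoint).compLpL 2 _ (tensor T (c := fun _ => (1 : ℝ)) continuous_const (ι y0))
        = tensor T (c := fun _ => (1 : ℝ)) continuous_const (ι (ι.adjoint (ι y0))) :=
      compLpL_tensor _ _ _
    rw [y2, map_add, map_add, map_smul, y3, d0, ← y4, ← y1, map_add, smul_add]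
    abel

end density

/-! ### Boundedness and measurability of the Carleman weights. -/

/-- The weight of the radial derivative. -/
def kernelGrad (s T γ : ℝ) (η : ℝ → ℝ) (t r : ℝ) : ℝ := s * Theta T t * conjWeight s T γ η t r ^ 2

/-- The weight of the zeroth order term. -/
def kernelFun (α s T γ : ℝ) (η : ℝ → ℝ) (t r : ℝ) : ℝ :=
  (s * Theta T t) ^ 3 * r ^ (2 - α) * conjWeight s T γ η t r ^ 2

/-- The weight of the right-hand side. -/
def kernelRhs (s T γ : ℝ) (η : ℝ → ℝ) (t r : ℝ) : ℝ := conjWeight s T γ η t r ^ 2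

/-- The weight of the observation. -/
def kernelObs (a b s T γ : ℝ) (η : ℝ → ℝ) (t r : ℝ) : ℝ :=
  (Ioo a b).indicator (fun r => (s * Theta T t) ^ 3 * conjWeight s T γ η t r ^ 2) r

section

variable {α a b s T γ : ℝ} {η : ℝ → ℝ}

theorem Theta_pos {t : ℝ} (ht : t ∈ Ioo 0 T) : 0 < Theta T t := by
  have := time_pos ht
  rw [Theta]
  positivity

/-- The `+ 1` in `γ` gives `γ - η ≥ 1`, hence exponential decay in `X = sΘ`. This beats every power
of `X`, so the weights stay bounded as `t` tends to `0` or `T`. -/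
theorem conjWeight_sq_le (hs : 0 < s) (hη : ∀ r ∈ Icc (0 : ℝ) 1, 1 ≤ γ - η r) {t r : ℝ}
    (ht : t ∈ Ioo 0 T) (hr : r ∈ Ioo (0 : ℝ) 1) :
    conjWeight s T γ η t r ^ 2 ≤ Real.exp (-(s * Theta T t)) := by
  have hX : 0 < s * Theta T t := mul_pos hs (Theta_pos ht)
  have h1 := hη r (Ioo_subset_Icc_self hr)
  rw [conjWeight, ← Real.exp_nat_mul, Real.exp_le_exp]
  push_cast
  nlinarith

theorem pow_mul_exp_neg_le {x : ℝ} (hx : 0 < x) (k : ℕ) :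
    x ^ k * Real.exp (-x) ≤ k.factorial := by
  have h := Real.pow_div_factorial_le_exp x hx.le k
  rw [div_le_iff₀ (by positivity)] at h
  rw [Real.exp_neg, ← div_eq_mul_inv, div_le_iff₀ (Real.exp_pos x)]
  linarith

theorem abs_kernelRhs_le (hs : 0 < s) (hη : ∀ r ∈ Icc (0 : ℝ) 1, 1 ≤ γ - η r) {t r : ℝ}
    (ht : t ∈ Ioo 0 T) (hr : r ∈ Ioo (0 : ℝ) 1) :
    |kernelRhs s T γ η t r| ≤ Real.exp (-(s * Theta T t)) := by
  rw [kernelRhs, abs_of_nonneg (sq_nonneg _)]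
  exact conjWeight_sq_le hs hη ht hr

theorem abs_kernelGrad_le (hs : 0 < s) (hη : ∀ r ∈ Icc (0 : ℝ) 1, 1 ≤ γ - η r) {t r : ℝ}
    (ht : t ∈ Ioo 0 T) (hr : r ∈ Ioo (0 : ℝ) 1) : |kernelGrad s T γ η t r| ≤ 6 := by
  have hX : 0 < s * Theta T t := mul_pos hs (Theta_pos ht)
  rw [kernelGrad, abs_of_nonneg (by positivity)]
  have h1 := mul_le_mul_of_nonneg_left (conjWeight_sq_le hs hη ht hr) hX.le
  have h2 := pow_mul_exp_neg_le hX 1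
  rw [pow_one] at h2
  norm_num at h2
  linarith

theorem cube_mul_conjWeight_sq_le (hs : 0 < s) (hη : ∀ r ∈ Icc (0 : ℝ) 1, 1 ≤ γ - η r) {t r : ℝ}
    (ht : t ∈ Ioo 0 T) (hr : r ∈ Ioo (0 : ℝ) 1) :
    (s * Theta T t) ^ 3 * conjWeight s T γ η t r ^ 2 ≤ 6 := by
  have hX : 0 < s * Theta T t := mul_pos hs (Theta_pos ht)
  have h1 := mul_le_mul_of_nonneg_left (conjWeight_sq_le hs hη ht hr) (pow_pos hX 3).le
  have h2 := pow_mul_exp_neg_le hX 3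
  norm_num [Nat.factorial] at h2
  linarith

theorem abs_kernelFun_le (hα1 : α < 1) (hs : 0 < s) (hη : ∀ r ∈ Icc (0 : ℝ) 1, 1 ≤ γ - η r)
    {t r : ℝ} (ht : t ∈ Ioo 0 T) (hr : r ∈ Ioo (0 : ℝ) 1) : |kernelFun α s T γ η t r| ≤ 6 := by
  have hX : 0 < s * Theta T t := mul_pos hs (Theta_pos ht)
  have h0 := Real.rpow_nonneg hr.1.le (2 - α)
  rw [kernelFun, abs_of_nonneg (by positivity)]
  have h1 := cube_mul_conjWeight_sq_le hs hη ht hr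
  have h2 : r ^ (2 - α) ≤ 1 := Real.rpow_le_one hr.1.le hr.2.le (by linarith)
  have h3 : 0 ≤ (s * Theta T t) ^ 3 * conjWeight s T γ η t r ^ 2 := by positivity
  nlinarith

theorem abs_kernelObs_le (hs : 0 < s) (hη : ∀ r ∈ Icc (0 : ℝ) 1, 1 ≤ γ - η r)
    {t r : ℝ} (ht : t ∈ Ioo 0 T) (hr : r ∈ Ioo (0 : ℝ) 1) : |kernelObs a b s T γ η t r| ≤ 6 := by
  have hX : 0 < s * Theta T t := mul_pos hs (Theta_pos ht)
  have h1 := cube_mul_conjWeight_sq_le hs hη ht hr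
  rw [kernelObs]
  by_cases h : r ∈ Ioo a b
  · rw [indicator_of_mem h, abs_of_nonneg (by positivity)]
    exact h1
  · rw [indicator_of_notMem h]
    norm_num

theorem continuousOn_conjWeight (hη : ContinuousOn η (Icc 0 1)) :
    ContinuousOn (fun x : ℝ × ℝ => conjWeight s T γ η x.1 x.2) (Ioo 0 T ×ˢ Ioo (0 : ℝ) 1) := by
  have c1 : ContinuousOn (fun x : ℝ × ℝ => Theta T x.1) (Ioo 0 T ×ˢ Ioo (0 : ℝ) 1) :=
    continuousOn_Theta.comp continuousOn_fst fun _ hx => hx.1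
  have c2 : ContinuousOn (fun x : ℝ × ℝ => η x.2) (Ioo 0 T ×ˢ Ioo (0 : ℝ) 1) :=
    hη.comp continuousOn_snd fun _ hx => Ioo_subset_Icc_self hx.2
  exact Real.continuous_exp.comp_continuousOn
    ((continuousOn_const.mul c1).mul (continuousOn_const.sub c2)).neg

theorem continuousOn_Theta_fst :
    ContinuousOn (fun x : ℝ × ℝ => Theta T x.1) (Ioo 0 T ×ˢ Ioo (0 : ℝ) 1) :=
  continuousOn_Theta.comp continuousOn_fst fun _ hx => hx.1

theorem aestronglyMeasurable_rect {k : ℝ × ℝ → ℝ}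
    (hk : ContinuousOn k (Ioo 0 T ×ˢ Ioo (0 : ℝ) 1)) :
    AEStronglyMeasurable k ((volume.restrict (Ioo 0 T)).prod (volume.restrict (Ioo (0 : ℝ) 1))) := by
  rw [Measure.prod_restrict]
  exact hk.aestronglyMeasurable (measurableSet_Ioo.prod measurableSet_Ioo)

theorem aestronglyMeasurable_kernelGrad (hη : ContinuousOn η (Icc 0 1)) :
    AEStronglyMeasurable (Function.uncurry (kernelGrad s T γ η))
      ((volume.restrict (Ioo 0 T)).prod (volume.restrict (Ioo (0 : ℝ) 1))) :=
  aestronglyMeasurable_rect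
    ((continuousOn_const.mul continuousOn_Theta_fst).mul ((continuousOn_conjWeight hη).pow 2))

theorem aestronglyMeasurable_kernelRhs (hη : ContinuousOn η (Icc 0 1)) :
    AEStronglyMeasurable (Function.uncurry (kernelRhs s T γ η))
      ((volume.restrict (Ioo 0 T)).prod (volume.restrict (Ioo (0 : ℝ) 1))) :=
  aestronglyMeasurable_rect ((continuousOn_conjWeight hη).pow 2)

theorem aestronglyMeasurable_kernelFun (hα1 : α < 1) (hη : ContinuousOn η (Icc 0 1)) :
    AEStronglyMeasurable (Function.uncurry (kernelFun α s T γ η))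
      ((volume.restrict (Ioo 0 T)).prod (volume.restrict (Ioo (0 : ℝ) 1))) := by
  have c : Continuous fun x : ℝ × ℝ => x.2 ^ (2 - α) :=
    (Real.continuous_rpow_const (by linarith)).comp continuous_snd
  exact aestronglyMeasurable_rect
    ((((continuousOn_const.mul continuousOn_Theta_fst).pow 3).mul c.continuousOn).mul
      ((continuousOn_conjWeight hη).pow 2))

theorem aestronglyMeasurable_kernelObs (hη : ContinuousOn η (Icc 0 1)) :
    AEStronglyMeasurable (Function.uncurry (kernelObs a b s T γ η))
      ((volume.restrict (Ioo 0 T)).prod (volume.restrict (Ioo (0 : ℝ) 1))) := by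
  have h := (aestronglyMeasurable_rect
    (((continuousOn_const (c := s)).mul continuousOn_Theta_fst).pow 3 |>.mul
      ((continuousOn_conjWeight (s := s) (γ := γ) (T := T) hη).pow 2))).indicator
      (measurable_snd (α := ℝ) (measurableSet_Ioo (a := a) (b := b)))
  refine h.congr (Eventually.of_forall fun x => ?_)
  simp only [Function.uncurry, kernelObs, indicator, mem_preimage]
  rfl

instance : SFinite (weightMeasure α) := by
  unfold weightMeasure
  infer_instance

theorem isQuadFamily_of_kernel {k : ℝ → ℝ → ℝ} {M : ℝ} (hM : 0 ≤ M)
    (hk : AEStronglyMeasurable (Function.uncurry k)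
      ((volume.restrict (Ioo 0 T)).prod (volume.restrict (Ioo (0 : ℝ) 1))))
    (hb : ∀ t ∈ Ioo 0 T, ∀ r ∈ Ioo (0 : ℝ) 1, |k t r| ≤ M)
    {X : Type*} [NormedAddCommGroup X] [NormedSpace ℝ X] (A : X →L[ℝ] L2) :
    IsQuadFamily (volume.restrict (Ioo 0 T)) (fun t x => quad _ k t (A x)) (M * ‖A‖ ^ 2) := by
  refine isQuadFamily_quad hk ?_ A hM
  filter_upwards [ae_restrict_mem measurableSet_Ioo] with t ht
  filter_upwards [ae_restrict_mem measurableSet_Ioo] with r hr using hb t ht r hr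

theorem isQuadFamily_of_kernel_weight {k : ℝ → ℝ → ℝ} {M : ℝ} (hM : 0 ≤ M)
    (hk : AEStronglyMeasurable (Function.uncurry k)
      ((volume.restrict (Ioo 0 T)).prod (volume.restrict (Ioo (0 : ℝ) 1))))
    (hb : ∀ t ∈ Ioo 0 T, ∀ r ∈ Ioo (0 : ℝ) 1, |k t r| ≤ M)
    {X : Type*} [NormedAddCommGroup X] [NormedSpace ℝ X] (A : X →L[ℝ] L2w α) :
    IsQuadFamily (volume.restrict (Ioo 0 T)) (fun t x => quad _ k t (A x)) (M * ‖A‖ ^ 2) := by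
  refine isQuadFamily_quad (hk.mono_ac ?_) ?_ A hM
  · exact Measure.AbsolutelyContinuous.rfl.prod (withDensity_absolutelyContinuous _ _)
  filter_upwards [ae_restrict_mem measurableSet_Ioo] with t ht
  rw [ae_weightMeasure_iff]
  filter_upwards [ae_restrict_mem measurableSet_Ioo] with r hr using hb t ht r hr

end

/-! ### The inequality for separated sums with compact support in time. -/

/-- The Carleman inequality with constant `C` for a function and a right-hand side. -/
def CarlemanIneq (α a b s T γ C : ℝ) (η : ℝ → ℝ) (φ : ℝ → H01 α) (f : ℝ → L2) : Prop :=
  (∫ t in Ioo 0 T, quad _ (kernelGrad s T γ η) t (dr α (φ t)))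
      + (∫ t in Ioo 0 T, quad _ (kernelFun α s T γ η) t (toL2 α (φ t)))
    ≤ C * ((∫ t in Ioo 0 T, quad _ (kernelRhs s T γ η) t (f t))
      + ∫ t in Ioo 0 T, quad _ (kernelObs a b s T γ η) t (toL2 α (φ t)))

/-- The Carleman inequality for all classical solutions. -/
def CarlemanClassical (α a b s T γ N C : ℝ) (η : ℝ → ℝ) : Prop :=
  ∀ φ Q φt Qt Qr : ℝ → ℝ → ℝ, IsClassical α T φ Q φt Qt Qr →
    (∫ t in Ioo 0 T, ∫ r in Ioo (0 : ℝ) 1,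
        s * Theta T t * ((r ^ α)⁻¹ * Q t r ^ 2) * conjWeight s T γ η t r ^ 2)
      + (∫ t in Ioo 0 T, ∫ r in Ioo (0 : ℝ) 1,
        (s * Theta T t) ^ 3 * (r ^ (2 - α) * φ t r ^ 2) * conjWeight s T γ η t r ^ 2)
    ≤ C * ((∫ t in Ioo 0 T, ∫ r in Ioo (0 : ℝ) 1,
          (conjWeight s T γ η t r * (φt t r - Qr t r + N * φ t r)) ^ 2)
        + (∫ t in Ioo 0 T, ∫ r in Ioo a b,
          (s * Theta T t) ^ 3 * φ t r ^ 2 * conjWeight s T γ η t r ^ 2))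

/-- The elements of `L²(Λ)` with a representative that is continuous on `[0, 1]`. -/
def continuousReps : Set L2 :=
  {g | ∃ γ : ℝ → ℝ, ContinuousOn γ (Icc 0 1) ∧ g =ᵐ[volume.restrict (Ioo (0 : ℝ) 1)] γ}

/-- Continuous data are the ones for which the static solution is classical. -/
theorem dense_continuousReps : Dense continuousReps := by
  have h := BoundedContinuousFunction.toLp_denseRange (E := ℝ) (p := 2) (𝕜 := ℝ)
    (μ := volume.restrict (Ioo (0 : ℝ) 1)) (by norm_num)
  refine h.mono ?_
  rintro _ ⟨g, rfl⟩
  exact ⟨g, g.continuous.continuousOn, BoundedContinuousFunction.coeFn_toLp 2 _ ℝ g⟩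

theorem coeFn_sum_smul {ν : Measure ℝ} {ι : Type*} (F : Finset ι) (a : ι → ℝ) {x : ι → Lp ℝ 2 ν}
    {h : ι → ℝ → ℝ} (hx : ∀ i, x i =ᵐ[ν] h i) :
    (∑ i ∈ F, a i • x i : Lp ℝ 2 ν) =ᵐ[ν] fun r => ∑ i ∈ F, a i * h i r := by
  classical
  induction F using Finset.induction_on with
  | empty =>
    simp only [Finset.sum_empty]
    exact Lp.coeFn_zero ℝ 2 ν
  | insert i F hi ih =>
    rw [Finset.sum_insert hi]
    filter_upwards [Lp.coeFn_add (a i • x i) (∑ i ∈ F, a i • x i), ih, hx i,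
      Lp.coeFn_smul (a i) (x i)] with r h1 h2 h3 h4
    rw [h1, Pi.add_apply, h2, h4, Pi.smul_apply, h3, Finset.sum_insert hi, smul_eq_mul]

section separated

variable {α a b s T γ N C : ℝ} {η : ℝ → ℝ} {ι : Type*} (F : Finset ι) {c : ι → ℝ → ℝ} {g : ι → L2}

variable (α c g) in
/-- A finite sum of separated functions. -/
def sepFun (t : ℝ) : H01 α := ∑ i ∈ F, c i t • solOp α (g i)

variable (α N c g) in
/-- The right-hand side of the equation for a finite sum of separated functions. -/
def sepRhs (t : ℝ) : L2 :=
  ∑ i ∈ F, deriv (c i) t • toL2 α (solOp α (g i)) + ∑ i ∈ F, c i t • g i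
    + (N - 1) • ∑ i ∈ F, c i t • toL2 α (solOp α (g i))

/-- A translation between equivalence classes and classical representatives. The divergence of the
flux of `v_i` is `v_i - G_i`, which explains the coefficient `N - 1` in `sepRhs`. -/
theorem carlemanIneq_sepFun_of_compact (hα0 : 0 < α) (hα1 : α < 1) (hT : 0 < T) (ha : 0 < a)
    (hb : b ≤ 1) (hC : CarlemanClassical α a b s T γ N C η) (hg : ∀ i, g i ∈ continuousReps)
    (hc : ∀ i, ContDiff ℝ 1 (c i)) (hcs : ∀ i, HasCompactSupport (c i))
    (hcT : ∀ i, tsupport (c i) ⊆ Ioo 0 T) :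
    CarlemanIneq α a b s T γ C η (sepFun α F c g) (sepRhs α N F c g) := by
  choose G hG hgG using hg
  choose v q hv hv1 hv2 using fun i => exists_isClassicalStatic hα0 hα1 (g i) (hG i) (hgG i)
  have h := hC _ _ _ _ _ (isClassical_sum F hT hc hcs hcT hv)
  have e1 : ∀ t, toL2 α (sepFun α F c g t) =ᵐ[volume.restrict (Ioo (0 : ℝ) 1)]
      fun r => ∑ i ∈ F, c i t * v i r := fun t => by
    rw [sepFun, map_sum]
    simp only [map_smul]
    exact coeFn_sum_smul F _ hv1
  have e2 : ∀ t, dr α (sepFun α F c g t) =ᵐ[weightMeasure α]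
      fun r => ∑ i ∈ F, c i t * ((r ^ α)⁻¹ * q i r) := fun t => by
    rw [sepFun, map_sum]
    simp only [map_smul]
    exact coeFn_sum_smul F _ fun i => ae_weightMeasure_iff.2 (hv2 i)
  have e3 : ∀ t, sepRhs α N F c g t =ᵐ[volume.restrict (Ioo (0 : ℝ) 1)]
      fun r => ∑ i ∈ F, deriv (c i) t * v i r - ∑ i ∈ F, c i t * (v i r - G i r)
        + N * ∑ i ∈ F, c i t * v i r := fun t => by
    rw [sepRhs]
    set A : L2 := ∑ i ∈ F, deriv (c i) t • toL2 α (solOp α (g i)) with hA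
    set B : L2 := ∑ i ∈ F, c i t • g i with hB
    set D : L2 := ∑ i ∈ F, c i t • toL2 α (solOp α (g i)) with hD
    filter_upwards [coeFn_sum_smul F (fun i => deriv (c i) t) hv1,
      coeFn_sum_smul F (fun i => c i t) hgG, coeFn_sum_smul F (fun i => c i t) hv1,
      Lp.coeFn_add (A + B) ((N - 1) • D), Lp.coeFn_add A B, Lp.coeFn_smul (N - 1) D]
      with r h1 h2 h3 h4 h5 h6
    rw [h4, Pi.add_apply, h5, h6, Pi.add_apply, Pi.smul_apply, hA, hB, hD, h1, h2, h3, smul_eq_mul]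
    simp only [mul_sub, Finset.sum_sub_distrib]
    ring
  rw [CarlemanIneq]
  convert h using 2
  · refine integral_congr_ae (Eventually.of_forall fun t => ?_)
    simp only [quad]
    rw [integral_weightMeasure]
    refine integral_congr_ae ?_
    filter_upwards [ae_weightMeasure_iff.1 (e2 t), ae_restrict_mem measurableSet_Ioo] with r h1 hr
    have hw := (Real.rpow_pos_of_pos hr.1 α).ne'
    have e : ∑ i ∈ F, c i t * ((r ^ α)⁻¹ * q i r) = (r ^ α)⁻¹ * ∑ i ∈ F, c i t * q i r := by
      rw [Finset.mul_sum]
      exact Finset.sum_congr rfl fun i _ => by ring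
    rw [h1, e, kernelGrad]
    field_simp
  · refine integral_congr_ae (Eventually.of_forall fun t => integral_congr_ae ?_)
    filter_upwards [e1 t] with r h1
    rw [h1, kernelFun]
    ring
  · congr 1
    · refine integral_congr_ae (Eventually.of_forall fun t => integral_congr_ae ?_)
      filter_upwards [e3 t] with r h1
      rw [h1, kernelRhs]
      ring
    · refine integral_congr_ae (Eventually.of_forall fun t => ?_)
      simp only [quad, kernelObs]
      have hsub : Ioo (0 : ℝ) 1 ∩ Ioo a b = Ioo a b :=
        inter_eq_right.2 (Ioo_subset_Ioo ha.le hb)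
      rw [← hsub, ← setIntegral_indicator measurableSet_Ioo]
      refine integral_congr_ae ?_
      filter_upwards [e1 t] with r h1
      rw [h1]
      by_cases hr : r ∈ Ioo a b
      · simp only [indicator_of_mem hr, hsub]
        ring
      · simp [indicator_of_notMem hr, hsub]

end separated

/-! ### Removal of the time cutoff. -/

/-- Smooth cutoff functions with compact support in `(0, T)`. -/
def timeCutoff (T : ℝ) (n : ℕ) (t : ℝ) : ℝ := Real.smoothTransition (n * (t * (T - t)) - 1)

theorem exists_abs_deriv_smoothTransition_le :
    ∃ M, 0 ≤ M ∧ (∀ x, |deriv Real.smoothTransition x| ≤ M) ∧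
      ∀ x, 1 < x → deriv Real.smoothTransition x = 0 := by
  have h0 : ∀ x, x < 0 → deriv Real.smoothTransition x = 0 := fun x hx => by
    have : Real.smoothTransition =ᶠ[𝓝 x] fun _ => 0 := by
      filter_upwards [Iio_mem_nhds hx] with y hy
        using Real.smoothTransition.zero_of_nonpos (le_of_lt hy)
    rw [this.deriv_eq, deriv_const]
  have h1 : ∀ x, 1 < x → deriv Real.smoothTransition x = 0 := fun x hx => by
    have : Real.smoothTransition =ᶠ[𝓝 x] fun _ => 1 := by
      filter_upwards [Ioi_mem_nhds hx] with y hy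
        using Real.smoothTransition.one_of_one_le (le_of_lt hy)
    rw [this.deriv_eq, deriv_const]
  have hc : Continuous (deriv Real.smoothTransition) :=
    (Real.smoothTransition.contDiff (n := 1)).continuous_deriv le_rfl
  obtain ⟨M, hM⟩ := (isCompact_Icc (a := (0 : ℝ)) (b := 1)).exists_bound_of_continuousOn
    hc.continuousOn
  have hM0 : 0 ≤ M := (norm_nonneg _).trans (hM 0 (by simp))
  refine ⟨M, hM0, fun x => ?_, h1⟩
  rcases lt_or_ge x 0 with hx | hx
  · rw [h0 x hx, abs_zero]
    exact hM0
  rcases lt_or_ge 1 x with hx1 | hx1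
  · rw [h1 x hx1, abs_zero]
    exact hM0
  · exact hM x ⟨hx, hx1⟩

section cutoff

variable {T : ℝ} {n : ℕ} {t : ℝ}

theorem contDiff_timeCutoff : ContDiff ℝ 1 (timeCutoff T n) := by
  unfold timeCutoff
  exact Real.smoothTransition.contDiff.comp (by fun_prop)

theorem tsupport_timeCutoff_subset : tsupport (timeCutoff T n) ⊆ {t | 1 ≤ n * (t * (T - t))} := by
  refine closure_minimal (fun t ht => ?_) (isClosed_le (by fun_prop) (by fun_prop))
  by_contra h
  rw [Set.mem_ofPred_eq, not_le] at h
  exact ht (Real.smoothTransition.zero_of_nonpos (by linarith))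

theorem tsupport_timeCutoff_subset_Ioo (hT : 0 < T) : tsupport (timeCutoff T n) ⊆ Ioo 0 T := by
  refine tsupport_timeCutoff_subset.trans fun t (ht : 1 ≤ n * (t * (T - t))) => ?_
  have hp : 0 < t * (T - t) := by
    by_contra h
    have : (n : ℝ) * (t * (T - t)) ≤ 0 :=
      mul_nonpos_of_nonneg_of_nonpos n.cast_nonneg (not_lt.1 h)
    linarith
  rcases pos_and_pos_or_neg_and_neg_of_mul_pos hp with ⟨h1, h2⟩ | ⟨h1, h2⟩
  · exact ⟨h1, by linarith⟩
  · linarith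

theorem hasCompactSupport_timeCutoff (hT : 0 < T) : HasCompactSupport (timeCutoff T n) :=
  isCompact_Icc.of_isClosed_subset (isClosed_tsupport _)
    ((tsupport_timeCutoff_subset_Ioo hT).trans Ioo_subset_Icc_self)

theorem abs_timeCutoff_le : |timeCutoff T n t| ≤ 1 := by
  rw [timeCutoff, abs_of_nonneg (Real.smoothTransition.nonneg _)]
  exact Real.smoothTransition.le_one _

theorem deriv_timeCutoff : deriv (timeCutoff T n) t
    = deriv Real.smoothTransition (n * (t * (T - t)) - 1) * (n * (T - 2 * t)) := by
  have h1 : HasDerivAt (fun t => (n : ℝ) * (t * (T - t)) - 1) (n * (T - 2 * t)) t :=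
    ((hasDerivAt_time T t).const_mul _).sub_const 1
  have h2 := ((Real.smoothTransition.contDiff (n := 1)).differentiable one_ne_zero
    ((n : ℝ) * (t * (T - t)) - 1)).hasDerivAt
  exact (h2.comp t h1).deriv

theorem eventually_timeCutoff (ht : t ∈ Ioo 0 T) :
    ∀ᶠ n : ℕ in atTop, timeCutoff T n t = 1 ∧ deriv (timeCutoff T n) t = 0 := by
  have hp := time_pos ht
  have h := tendsto_natCast_atTop_atTop (R := ℝ) |>.atTop_mul_const hp
  filter_upwards [h.eventually_gt_atTop 2] with n hn
  refine ⟨Real.smoothTransition.one_of_one_le (by linarith), ?_⟩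
  obtain ⟨M, -, -, hM⟩ := exists_abs_deriv_smoothTransition_le
  rw [deriv_timeCutoff, hM _ (by linarith), zero_mul]

/-- The derivative vanishes once `n t (T - t) > 2`. Elsewhere the factor `n` is at most `2 / (t (T -
t))`, which makes the bound uniform in `n`. -/
theorem exists_abs_deriv_timeCutoff_le (T : ℝ) : ∃ M, 0 ≤ M ∧
    ∀ n : ℕ, ∀ t ∈ Ioo 0 T, |deriv (timeCutoff T n) t| ≤ M / (t * (T - t)) := by
  obtain ⟨M, hM0, hM, h1⟩ := exists_abs_deriv_smoothTransition_le
  refine ⟨M * (2 * |T|), by positivity, fun n t ht => ?_⟩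
  have hp := time_pos ht
  have hT : 0 < T := ht.1.trans ht.2
  rw [deriv_timeCutoff, le_div_iff₀ hp, abs_mul, abs_of_pos hT]
  rcases lt_or_ge 2 ((n : ℝ) * (t * (T - t))) with h | h
  · rw [h1 _ (by linarith), abs_zero, zero_mul, zero_mul]
    positivity
  · have h2 : |(n : ℝ) * (T - 2 * t)| ≤ n * T := by
      rw [abs_mul, abs_of_nonneg (n.cast_nonneg : (0 : ℝ) ≤ n)]
      refine mul_le_mul_of_nonneg_left ?_ n.cast_nonneg
      rw [abs_le]
      constructor <;> linarith [ht.1, ht.2]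
    calc |deriv Real.smoothTransition (n * (t * (T - t)) - 1)| * |(n : ℝ) * (T - 2 * t)|
          * (t * (T - t)) ≤ M * (n * T) * (t * (T - t)) :=
          mul_le_mul_of_nonneg_right (mul_le_mul (hM _) h2 (abs_nonneg _) hM0) hp.le
      _ = M * T * (n * (t * (T - t))) := by ring
      _ ≤ M * T * 2 := mul_le_mul_of_nonneg_left h (by positivity)
      _ = _ := by ring

theorem tendsto_integral_timeCutoff_sq {h : ℝ → ℝ} (hh : IntegrableOn h (Ioo 0 T)) :
    Tendsto (fun n : ℕ => ∫ t in Ioo 0 T, timeCutoff T n t ^ 2 * h t) atTop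
      (𝓝 (∫ t in Ioo 0 T, h t)) := by
  refine tendsto_integral_of_dominated_convergence (fun t => |h t|)
    (fun n => ((contDiff_timeCutoff.continuous.pow 2).aestronglyMeasurable).mul hh.1) hh.abs
    (fun n => Eventually.of_forall fun t => ?_) ?_
  · rw [norm_mul, norm_pow]
    exact mul_le_of_le_one_left (abs_nonneg _) (pow_le_one₀ (abs_nonneg _) abs_timeCutoff_le)
  · filter_upwards [ae_restrict_mem measurableSet_Ioo] with t ht
    refine tendsto_const_nhds.congr' ?_
    filter_upwards [eventually_timeCutoff ht] with n hn
    rw [hn.1, one_pow, one_mul]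

end cutoff

theorem quad_smul (ν : Measure ℝ) (k : ℝ → ℝ → ℝ) (t a : ℝ) (x : Lp ℝ 2 ν) :
    quad ν k t (a • x) = a ^ 2 * quad ν k t x := by
  rw [quad, quad, ← integral_const_mul]
  refine integral_congr_ae ?_
  filter_upwards [Lp.coeFn_smul a x] with r hr
  rw [hr, Pi.smul_apply, smul_eq_mul]
  ring

section separated

variable {α a b s T γ N C : ℝ} {η : ℝ → ℝ} {ι : Type*} (F : Finset ι) {c : ι → ℝ → ℝ} {g : ι → L2}

theorem continuous_sepFun (hc : ∀ i, ContDiff ℝ 1 (c i)) : Continuous (sepFun α F c g) :=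
  continuous_finsetSum F fun i _ => (hc i).continuous.smul continuous_const

theorem continuous_sepRhs (hc : ∀ i, ContDiff ℝ 1 (c i)) : Continuous (sepRhs α N F c g) := by
  have h0 : ∀ i, Continuous (c i) := fun i => (hc i).continuous
  have h1 : ∀ i, Continuous (deriv (c i)) := fun i => (hc i).continuous_deriv le_rfl
  unfold sepRhs
  fun_prop

theorem sepFun_mul (χ : ℝ → ℝ) (t : ℝ) :
    sepFun α F (fun i t => χ t * c i t) g t = χ t • sepFun α F c g t := by
  simp only [sepFun, Finset.smul_sum, mul_smul]

theorem sepRhs_mul {χ : ℝ → ℝ} (hχ : ContDiff ℝ 1 χ) (hc : ∀ i, ContDiff ℝ 1 (c i)) (t : ℝ) :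
    sepRhs α N F (fun i t => χ t * c i t) g t
      = χ t • sepRhs α N F c g t + deriv χ t • toL2 α (sepFun α F c g t) := by
  have hd : ∀ i, deriv (fun t => χ t * c i t) t = deriv χ t * c i t + χ t * deriv (c i) t :=
    fun i => deriv_fun_mul (hχ.differentiable one_ne_zero t) ((hc i).differentiable one_ne_zero t)
  simp only [sepRhs, sepFun, hd, map_sum, map_smul, Finset.smul_sum, mul_smul, add_smul, smul_add,
    Finset.sum_add_distrib, smul_comm (N - 1) (χ t)]
  abel

/-- Cutting off adds the commutator `χ_n' y` to the right-hand side. It tends to `0` pointwise, and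
its square grows at most like `(t (T - t))⁻²`, which the factor `e^{-sΘ}` dominates. -/
theorem tendsto_integral_kernelRhs_timeCutoff (hη : ContinuousOn η (Icc 0 1))
    (hη1 : ∀ r ∈ Icc (0 : ℝ) 1, 1 ≤ γ - η r) (hs : 0 < s) {f y : ℝ → L2} (hf : Continuous f)
    (hy : Continuous y) :
    Tendsto (fun n : ℕ => ∫ t in Ioo 0 T, quad _ (kernelRhs s T γ η) t
      (timeCutoff T n t • f t + deriv (timeCutoff T n) t • y t)) atTop
      (𝓝 (∫ t in Ioo 0 T, quad _ (kernelRhs s T γ η) t (f t))) := by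
  obtain ⟨M, hM0, hM⟩ := exists_abs_deriv_timeCutoff_le T
  obtain ⟨M1, hM1⟩ := (isCompact_Icc (a := 0) (b := T)).exists_bound_of_continuousOn hf.continuousOn
  obtain ⟨M2, hM2⟩ := (isCompact_Icc (a := 0) (b := T)).exists_bound_of_continuousOn hy.continuousOn
  have hB := isQuadFamily_of_kernel (M := 1) (k := kernelRhs s T γ η) zero_le_one
    (aestronglyMeasurable_kernelRhs hη)
    (fun t ht r hr => (abs_kernelRhs_le hs hη1 ht hr).trans
      (Real.exp_le_one_iff.2 (neg_nonpos.2 (mul_pos hs (Theta_pos ht)).le)))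
    (ContinuousLinearMap.id ℝ L2)
  refine tendsto_integral_of_dominated_convergence
    (fun _ => 2 * M1 ^ 2 + 2 * (M ^ 2 * (1 + 1 / s)) * M2 ^ 2) (fun n => ?_) (integrable_const _)
    (fun n => ?_) ?_
  · exact hB.aestronglyMeasurable ((contDiff_timeCutoff.continuous.smul hf).add
      ((contDiff_timeCutoff.continuous_deriv le_rfl).smul hy)).aestronglyMeasurable
  · filter_upwards [ae_restrict_mem measurableSet_Ioo,
      (aestronglyMeasurable_kernelRhs (s := s) (T := T) (γ := γ) hη).prodMk_left] with t ht hmeas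
    have hp := time_pos ht
    have hX : 0 < s * Theta T t := mul_pos hs (Theta_pos ht)
    have hq := abs_quad_sub_le (M := Real.exp (-(s * Theta T t))) hmeas (by
      filter_upwards [ae_restrict_mem measurableSet_Ioo] with r hr
        using abs_kernelRhs_le hs hη1 ht hr) (timeCutoff T n t • f t + deriv (timeCutoff T n) t • y t) 0
    rw [quad_zero, sub_zero, sub_zero, norm_zero, add_zero, ← sq] at hq
    refine hq.trans ?_
    have n1 : ‖timeCutoff T n t • f t‖ ≤ M1 := by
      rw [norm_smul]
      exact (mul_le_of_le_one_left (norm_nonneg _) abs_timeCutoff_le).trans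
        (hM1 t (Ioo_subset_Icc_self ht))
    have n2 : ‖deriv (timeCutoff T n) t • y t‖ ≤ M / (t * (T - t)) * M2 := by
      rw [norm_smul]
      exact mul_le_mul (hM n t ht) (hM2 t (Ioo_subset_Icc_self ht)) (norm_nonneg _) (by positivity)
    have n3 : ‖timeCutoff T n t • f t + deriv (timeCutoff T n) t • y t‖ ^ 2
        ≤ 2 * M1 ^ 2 + 2 * (M / (t * (T - t)) * M2) ^ 2 := by
      have h1 := norm_add_le (timeCutoff T n t • f t) (deriv (timeCutoff T n) t • y t)
      calc _ ≤ (M1 + M / (t * (T - t)) * M2) ^ 2 :=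
            pow_le_pow_left₀ (norm_nonneg _) (h1.trans (add_le_add n1 n2)) 2
        _ ≤ _ := by linarith only [sq_nonneg (M1 - M / (t * (T - t)) * M2)]
    have e1 : Real.exp (-(s * Theta T t)) ≤ 1 := Real.exp_le_one_iff.2 (neg_nonpos.2 hX.le)
    have e2 := pow_mul_exp_neg_le hX 1
    rw [pow_one, Nat.factorial_one, Nat.cast_one] at e2
    -- `Θ` is the square of the left side, and `x ≤ 1 + x²`.
    have e3 : (1 / (t * (T - t))) ^ 2 ≤ 1 + Theta T t := by
      have : Theta T t = ((1 / (t * (T - t))) ^ 2) ^ 2 := by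
        rw [Theta]
        field_simp
      rw [this]
      linarith only [sq_nonneg ((1 / (t * (T - t))) ^ 2 - 1), sq_nonneg ((1 / (t * (T - t))) ^ 2)]
    have e4 : Real.exp (-(s * Theta T t)) * (1 / (t * (T - t))) ^ 2 ≤ 1 + 1 / s := by
      have h1 : Real.exp (-(s * Theta T t)) * Theta T t ≤ 1 / s := by
        rw [le_div_iff₀ hs]
        linarith
      have h2 := mul_le_mul_of_nonneg_left e3 (Real.exp_pos (-(s * Theta T t))).le
      linarith
    calc Real.exp (-(s * Theta T t)) * ‖_‖ ^ 2
        ≤ Real.exp (-(s * Theta T t)) * (2 * M1 ^ 2 + 2 * (M / (t * (T - t)) * M2) ^ 2) :=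
          mul_le_mul_of_nonneg_left n3 (Real.exp_pos _).le
      _ = Real.exp (-(s * Theta T t)) * (2 * M1 ^ 2)
          + (Real.exp (-(s * Theta T t)) * (1 / (t * (T - t))) ^ 2) * (2 * M ^ 2 * M2 ^ 2) := by
          ring
      _ ≤ 1 * (2 * M1 ^ 2) + (1 + 1 / s) * (2 * M ^ 2 * M2 ^ 2) := by gcongr
      _ = _ := by ring
  · filter_upwards [ae_restrict_mem measurableSet_Ioo] with t ht
    refine tendsto_const_nhds.congr' ?_
    filter_upwards [eventually_timeCutoff ht] with n hn
    rw [hn.1, hn.2, one_smul, zero_smul, add_zero]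

theorem carlemanIneq_sepFun (hα0 : 0 < α) (hα1 : α < 1) (hT : 0 < T) (ha : 0 < a)
    (hb : b ≤ 1) (hs : 0 < s) (hη : ContinuousOn η (Icc 0 1))
    (hη1 : ∀ r ∈ Icc (0 : ℝ) 1, 1 ≤ γ - η r)
    (hC : CarlemanClassical α a b s T γ N C η) (hg : ∀ i, g i ∈ continuousReps)
    (hc : ∀ i, ContDiff ℝ 1 (c i)) :
    CarlemanIneq α a b s T γ C η (sepFun α F c g) (sepRhs α N F c g) := by
  have hn := fun n : ℕ => carlemanIneq_sepFun_of_compact F hα0 hα1 hT ha hb hC hg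
    (c := fun i t => timeCutoff T n t * c i t)
    (fun i => contDiff_timeCutoff.mul (hc i))
    (fun i => (hasCompactSupport_timeCutoff hT).mul_right)
    (fun i => (tsupport_mul_subset_left).trans (tsupport_timeCutoff_subset_Ioo hT))
  simp only [CarlemanIneq, sepFun_mul, sepRhs_mul F contDiff_timeCutoff hc, map_smul,
    quad_smul] at hn
  have hu : MemLp (sepFun α F c g) 2 (volume.restrict (Ioo 0 T)) :=
    memLp_of_continuous T (continuous_sepFun F hc)
  have i1 := (isQuadFamily_of_kernel_weight (by norm_num) (aestronglyMeasurable_kernelGrad hη)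
    (fun t ht r hr => abs_kernelGrad_le hs hη1 ht hr) (dr α)).integrable hu
  have i2 := (isQuadFamily_of_kernel (by norm_num) (aestronglyMeasurable_kernelFun hα1 hη)
    (fun t ht r hr => abs_kernelFun_le hα1 hs hη1 ht hr) (toL2 α)).integrable hu
  have i3 := (isQuadFamily_of_kernel (by norm_num) (aestronglyMeasurable_kernelObs hη)
    (fun t ht r hr => abs_kernelObs_le (a := a) (b := b) hs hη1 ht hr) (toL2 α)).integrable hu
  have l4 := tendsto_integral_kernelRhs_timeCutoff (T := T) hη hη1 hs
    (continuous_sepRhs (α := α) (N := N) F (g := g) hc)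
    ((toL2 α).continuous.comp (continuous_sepFun F (g := g) hc))
  exact le_of_tendsto_of_tendsto' ((tendsto_integral_timeCutoff_sq i1).add
    (tendsto_integral_timeCutoff_sq i2))
    ((l4.add (tendsto_integral_timeCutoff_sq i3)).const_mul C) hn

end separated

/-! ### Passage to weak solutions. -/

theorem coeFn_finsetSum {X : Type*} [NormedAddCommGroup X] {μ : Measure ℝ} {ι : Type*}
    (F : Finset ι) (u : ι → Lp X 2 μ) : (∑ i ∈ F, u i : Lp X 2 μ) =ᵐ[μ] fun t => ∑ i ∈ F, u i t := by
  classical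
  induction F using Finset.induction_on with
  | empty =>
    simp only [Finset.sum_empty]
    exact Lp.coeFn_zero X 2 μ
  | insert i F hi ih =>
    rw [Finset.sum_insert hi]
    filter_upwards [Lp.coeFn_add (u i) (∑ i ∈ F, u i), ih] with t h1 h2
    rw [h1, Pi.add_apply, h2, Finset.sum_insert hi]

section

variable {α a b s T γ N C : ℝ} {η : ℝ → ℝ}

theorem exists_sepFun_of_mem_graphSpan {p : WithLp 2 (LT T (H01 α) × LT T L2)}
    (hp : p ∈ graphSpan (toL2 α) T N continuousReps) :
    ∃ (n : ℕ) (c : Fin n → ℝ → ℝ) (g : Fin n → L2), (∀ i, ContDiff ℝ 1 (c i)) ∧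
      (∀ i, g i ∈ continuousReps) ∧
      p.fst =ᵐ[volume.restrict (Ioo 0 T)] sepFun α Finset.univ c g ∧
      p.snd =ᵐ[volume.restrict (Ioo 0 T)] sepRhs α N Finset.univ c g := by
  obtain ⟨n, w, q, rfl⟩ := Submodule.mem_span_set'.1 hp
  choose c hc g hg hq using fun i => (q i).2
  refine ⟨n, fun i t => w i * c i t, g, fun i => contDiff_const.mul (hc i), hg, ?_, ?_⟩
  · have e : (∑ i, w i • (q i : WithLp 2 (LT T (H01 α) × LT T L2))).fst
        = ∑ i, w i • tensor T (hc i).continuous (solOp α (g i)) := by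
      refine (map_sum (WithLp.fstL 2 ℝ (LT T (H01 α)) (LT T L2)) _ _).trans ?_
      refine Finset.sum_congr rfl fun i _ => ?_
      rw [hq i]
      rfl
    rw [e]
    refine (coeFn_finsetSum _ _).trans ?_
    have h1 : ∀ᵐ t ∂(volume.restrict (Ioo 0 T)), ∀ i,
        (w i • tensor T (hc i).continuous (solOp α (g i)) : LT T (H01 α)) t
          = w i • tensor T (hc i).continuous (solOp α (g i)) t :=
      ae_all_iff.2 fun i => Lp.coeFn_smul _ _
    have h2 : ∀ᵐ t ∂(volume.restrict (Ioo 0 T)), ∀ i,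
        tensor T (hc i).continuous (solOp α (g i)) t = c i t • solOp α (g i) :=
      ae_all_iff.2 fun i => coeFn_tensor _ _
    filter_upwards [h1, h2] with t e1 e2
    rw [sepFun]
    refine Finset.sum_congr rfl fun i _ => ?_
    rw [e1, e2, mul_smul]
  · have e : (∑ i, w i • (q i : WithLp 2 (LT T (H01 α) × LT T L2))).snd
        = ∑ i, w i • tensor T ((hc i).continuous_deriv le_rfl) (toL2 α (solOp α (g i)))
          + ∑ i, w i • tensor T (hc i).continuous (g i)
          + (N - 1) • ∑ i, w i • tensor T (hc i).continuous (toL2 α (solOp α (g i))) := by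
      refine (map_sum (WithLp.sndL 2 ℝ (LT T (H01 α)) (LT T L2)) _ _).trans ?_
      rw [Finset.smul_sum, ← Finset.sum_add_distrib, ← Finset.sum_add_distrib]
      refine Finset.sum_congr rfl fun i _ => ?_
      rw [hq i, smul_comm (N - 1), ← smul_add, ← smul_add]
      rfl
    rw [e]
    have sm : ∀ {k : Fin n → ℝ → ℝ} (hk : ∀ i, Continuous (k i)) (x : Fin n → L2),
        (∑ i, w i • tensor T (hk i) (x i) : LT T L2) =ᵐ[volume.restrict (Ioo 0 T)]
          fun t => ∑ i, (w i * k i t) • x i := by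
      intro k hk x
      refine (coeFn_finsetSum _ _).trans ?_
      have h1 : ∀ᵐ t ∂(volume.restrict (Ioo 0 T)), ∀ i,
          (w i • tensor T (hk i) (x i) : LT T L2) t = w i • tensor T (hk i) (x i) t :=
        ae_all_iff.2 fun i => Lp.coeFn_smul _ _
      have h2 : ∀ᵐ t ∂(volume.restrict (Ioo 0 T)), ∀ i,
          tensor T (hk i) (x i) t = k i t • x i :=
        ae_all_iff.2 fun i => coeFn_tensor _ _
      filter_upwards [h1, h2] with t e1 e2
      refine Finset.sum_congr rfl fun i _ => ?_
      rw [e1, e2, mul_smul]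
    have s1 := sm (fun i => (hc i).continuous_deriv le_rfl) fun i => toL2 α (solOp α (g i))
    have s2 := sm (fun i => (hc i).continuous) g
    have s3 := sm (fun i => (hc i).continuous) fun i => toL2 α (solOp α (g i))
    set A : LT T L2 := ∑ i, w i • tensor T ((hc i).continuous_deriv le_rfl) (toL2 α (solOp α (g i)))
    set B : LT T L2 := ∑ i, w i • tensor T (hc i).continuous (g i)
    set D : LT T L2 := ∑ i, w i • tensor T (hc i).continuous (toL2 α (solOp α (g i)))
    filter_upwards [s1, s2, s3, Lp.coeFn_add (A + B) ((N - 1) • D), Lp.coeFn_add A B,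
      Lp.coeFn_smul (N - 1) D] with t e1 e2 e3 e4 e5 e6
    rw [e4, Pi.add_apply, e5, e6, Pi.add_apply, Pi.smul_apply, e1, e2, e3, sepRhs]
    have hd : ∀ i, deriv (fun t => w i * c i t) t = w i * deriv (c i) t := fun i =>
      deriv_const_mul _ ((hc i).differentiable one_ne_zero t)
    simp only [hd]

theorem CarlemanIneq.congr {φ ψ : ℝ → H01 α} {f h : ℝ → L2}
    (hi : CarlemanIneq α a b s T γ C η φ f) (h1 : φ =ᵐ[volume.restrict (Ioo 0 T)] ψ)
    (h2 : f =ᵐ[volume.restrict (Ioo 0 T)] h) : CarlemanIneq α a b s T γ C η ψ h := by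
  have e : ∀ {X : Type} (B : ℝ → X → ℝ) {u v : ℝ → X}, u =ᵐ[volume.restrict (Ioo 0 T)] v →
      ∫ t in Ioo 0 T, B t (u t) = ∫ t in Ioo 0 T, B t (v t) := fun B u v huv => by
    refine integral_congr_ae ?_
    filter_upwards [huv] with t ht
    rw [ht]
  rw [CarlemanIneq] at hi ⊢
  rwa [e (fun t x => quad _ (kernelGrad s T γ η) t (dr α x)) h1,
    e (fun t x => quad _ (kernelFun α s T γ η) t (toL2 α x)) h1,
    e (fun t x => quad _ (kernelRhs s T γ η) t x) h2,
    e (fun t x => quad _ (kernelObs a b s T γ η) t (toL2 α x)) h1] at hi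

/-- All four integrals are continuous in the pair, so the inequality is a closed condition, and it
holds on the span. -/
theorem carlemanIneq_of_mem_closure (hα0 : 0 < α) (hα1 : α < 1) (hT : 0 < T) (ha : 0 < a)
    (hb : b ≤ 1) (hs : 0 < s) (hη : ContinuousOn η (Icc 0 1))
    (hη1 : ∀ r ∈ Icc (0 : ℝ) 1, 1 ≤ γ - η r)
    (hC : CarlemanClassical α a b s T γ N C η)
    {p : WithLp 2 (LT T (H01 α) × LT T L2)}
    (hp : p ∈ (graphSpan (toL2 α) T N continuousReps).topologicalClosure) :
    CarlemanIneq α a b s T γ C η p.fst p.snd := by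
  have c1 := (isQuadFamily_of_kernel_weight (M := 6) (T := T) (by norm_num)
    (aestronglyMeasurable_kernelGrad hη)
    (fun t ht r hr => abs_kernelGrad_le hs hη1 ht hr) (dr α)).continuous_integral (by positivity)
  have c2 := (isQuadFamily_of_kernel (M := 6) (T := T) (by norm_num)
    (aestronglyMeasurable_kernelFun hα1 hη)
    (fun t ht r hr => abs_kernelFun_le hα1 hs hη1 ht hr) (toL2 α)).continuous_integral
    (by positivity)
  have c3 := (isQuadFamily_of_kernel (M := 1) (T := T) zero_le_one
    (aestronglyMeasurable_kernelRhs hη)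
    (fun t ht r hr => (abs_kernelRhs_le hs hη1 ht hr).trans
      (Real.exp_le_one_iff.2 (neg_nonpos.2 (mul_pos hs (Theta_pos ht)).le)))
    (ContinuousLinearMap.id ℝ L2)).continuous_integral (by positivity)
  have c4 := (isQuadFamily_of_kernel (M := 6) (T := T) (by norm_num)
    (aestronglyMeasurable_kernelObs hη)
    (fun t ht r hr => abs_kernelObs_le (a := a) (b := b) hs hη1 ht hr) (toL2 α)).continuous_integral
    (by positivity)
  have f1 : Continuous fun p : WithLp 2 (LT T (H01 α) × LT T L2) => p.fst :=
    (WithLp.fstL 2 ℝ (LT T (H01 α)) (LT T L2)).continuous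
  have f2 : Continuous fun p : WithLp 2 (LT T (H01 α) × LT T L2) => p.snd :=
    (WithLp.sndL 2 ℝ (LT T (H01 α)) (LT T L2)).continuous
  have hcl : IsClosed {p : WithLp 2 (LT T (H01 α) × LT T L2) |
      CarlemanIneq α a b s T γ C η p.fst p.snd} :=
    isClosed_le ((c1.comp f1).add (c2.comp f1))
      (((c3.comp f2).add (c4.comp f1)).const_mul C)
  refine hcl.closure_subset_iff.2 (fun q hq => ?_) hp
  obtain ⟨n, c, g, hc, hg, e1, e2⟩ := exists_sepFun_of_mem_graphSpan hq
  exact (carlemanIneq_sepFun Finset.univ hα0 hα1 hT ha hb hs hη hη1 hC hg hc).congr e1.symm e2.symm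

/-- The Riesz isomorphism from `H⁻¹` to `H₀¹`. -/
def riesz (α : ℝ) : Hneg α →L[ℝ] H01 α :=
  LinearMap.mkContinuous
    { toFun := fun l => (InnerProductSpace.toDual ℝ (H01 α)).symm (show StrongDual ℝ (H01 α) from l)
      map_add' := fun l m => map_add (InnerProductSpace.toDual ℝ (H01 α)).symm
        (show StrongDual ℝ (H01 α) from l) (show StrongDual ℝ (H01 α) from m)
      map_smul' := fun c l => map_smulₛₗ (InnerProductSpace.toDual ℝ (H01 α)).symm c
        (show StrongDual ℝ (H01 α) from l) } 1
    fun l => ((InnerProductSpace.toDual ℝ (H01 α)).symm.norm_map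
        (show StrongDual ℝ (H01 α) from l)).le.trans_eq (one_mul _).symm

theorem riesz_inner (l : Hneg α) (v : H01 α) : inner ℝ (riesz α l) v = pairing l v :=
  InnerProductSpace.toDual_symm_apply

/-- Under the Riesz isomorphism the embedding of `H₀¹` into its dual becomes `ι* ι`, which brings
the weak formulation into the abstract form of `mem_closure_graphSpan`. -/
theorem riesz_toHneg (u : H01 α) : riesz α (toHneg α u) = (toL2 α).adjoint (toL2 α u) := by
  refine ext_inner_right ℝ fun v => ?_
  rw [riesz_inner, ContinuousLinearMap.adjoint_inner_left]
  rfl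

theorem IsWeakSolution.mem_closure {n : ℕ} {f : ℝ → L2} {φ0 : L2} {φ : ℝ → H01 α}
    (hα0 : 0 < α) (hα1 : α < 1) (hT : 0 < T)
    (h : IsWeakSolution α T n f φ0 φ) (hf : MemLp f 2 (volume.restrict (Ioo 0 T))) :
    (WithLp.toLp 2 (h.memLp.toLp φ, hf.toLp f) : WithLp 2 (LT T (H01 α) × LT T L2))
      ∈ (graphSpan (toL2 α) T ((n : ℝ) ^ 2) continuousReps).topologicalClosure := by
  obtain ⟨g, hg, hd, he⟩ := h.equation
  have hφ := h.memLp
  have hψ : MemLp (fun t => riesz α (g t)) 2 (volume.restrict (Ioo 0 T)) :=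
    hg.continuousLinearMap_comp (riesz α)
  refine mem_closure_graphSpan dense_continuousReps hT (toL2_injective hα1)
    (solOp_injective hα0) hφ hψ hf (fun χ h1 h2 h3 => ?_) ?_
  · have e := congrArg (riesz α) (hd χ h1 h2 h3)
    have i1 : IntegrableOn (fun t => deriv χ t • toHneg α (φ t)) (Ioo 0 T) :=
      integrableOn_smul_of_continuous (h1.continuous_deriv (by simp))
        ((toHneg α).integrable_comp (integrableOn_of_memLp hφ))
    have i2 : IntegrableOn (fun t => χ t • g t) (Ioo 0 T) :=
      integrableOn_smul_of_continuous h1.continuous (integrableOn_of_memLp hg)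
    rw [map_neg, ← (riesz α).integral_comp_comm i1, ← (riesz α).integral_comp_comm i2] at e
    simpa only [map_smul, riesz_toHneg] using e
  · have m1 : MemLp (fun t => (toL2 α).adjoint (toL2 α (φ t))) 2 (volume.restrict (Ioo 0 T)) :=
      ((toL2 α).adjoint ∘L toL2 α).comp_memLp' hφ
    have m2 : MemLp (fun t => (toL2 α).adjoint (f t)) 2 (volume.restrict (Ioo 0 T)) :=
      (toL2 α).adjoint.comp_memLp' hf
    have m3 : MemLp (fun t => ((n : ℝ) ^ 2 - 1) • (toL2 α).adjoint (toL2 α (φ t))) 2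
        (volume.restrict (Ioo 0 T)) :=
      m1.const_smul ((n : ℝ) ^ 2 - 1)
    have m4 : MemLp (fun t => riesz α (g t) + φ t) 2 (volume.restrict (Ioo 0 T)) := hψ.add hφ
    have m5 : MemLp (fun t => riesz α (g t) + φ t
        + ((n : ℝ) ^ 2 - 1) • (toL2 α).adjoint (toL2 α (φ t))) 2
        (volume.restrict (Ioo 0 T)) := m4.add m3
    have m6 : MemLp (fun t => riesz α (g t) + φ t
        + ((n : ℝ) ^ 2 - 1) • (toL2 α).adjoint (toL2 α (φ t)) - (toL2 α).adjoint (f t)) 2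
        (volume.restrict (Ioo 0 T)) := m5.sub m2
    -- The exceptional null set of times in the weak formulation depends on `v`. Integrating against
    -- `χ(t) v` first gives an identity in `H₀¹` valid at almost every time.
    have hz := ae_eq_zero_of_forall_integral_inner (integrableOn_of_memLp m6) (fun χ hχ v => by
      refine integral_eq_zero_of_ae ?_
      filter_upwards [he v] with t ht
      have e : inner ℝ (riesz α (g t) + φ t
          + ((n : ℝ) ^ 2 - 1) • (toL2 α).adjoint (toL2 α (φ t)) - (toL2 α).adjoint (f t)) v = 0 := by
        rw [inner_sub_left, inner_add_left, inner_add_left, real_inner_smul_left, riesz_inner,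
          ContinuousLinearMap.adjoint_inner_left, ContinuousLinearMap.adjoint_inner_left, H01_inner]
        linarith only [ht]
      rw [real_inner_comm, e, mul_zero]
      rfl)
    filter_upwards [hz] with t ht using sub_eq_zero.1 ht

end

/-- The glued weight may replace `η` because the two agree on `(0, 1)`, where all the integrals
live. -/
theorem carlemanIneq_iff {α a b s T C : ℝ} {η ηt : ℝ → ℝ} (ha : 0 < a) (hb : b ≤ 1)
    (he : ∀ r ∈ Ioo (0 : ℝ) 1, ηt r = η r) {φ : ℝ → H01 α} {f : ℝ → L2} :
    CarlemanIneq α a b s T (gam η) C ηt φ f ↔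
      s * (∫ t in Ioo 0 T, ∫ r in Ioo (0 : ℝ) 1,
            Theta T t * r ^ α * (dr α (φ t) r) ^ 2 * Real.exp (-2 * s * xi T η r t))
          + s ^ 3 * (∫ t in Ioo 0 T, ∫ r in Ioo (0 : ℝ) 1,
            Theta T t ^ 3 * r ^ (2 - α) * (toL2 α (φ t) r) ^ 2 * Real.exp (-2 * s * xi T η r t))
        ≤ C * (∫ t in Ioo 0 T, ∫ r in Ioo (0 : ℝ) 1, (Real.exp (-s * xi T η r t) * f t r) ^ 2)
          + C * s ^ 3 * (∫ t in Ioo 0 T, ∫ r in Ioo a b,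
            Theta T t ^ 3 * (toL2 α (φ t) r) ^ 2 * Real.exp (-2 * s * xi T η r t)) := by
  have hw : ∀ t, ∀ r ∈ Ioo (0 : ℝ) 1,
      conjWeight s T (gam η) ηt t r = Real.exp (-s * xi T η r t) := fun t r hr => by
    rw [conjWeight, he r hr, xi]
    congr 1
    ring
  have hw2 : ∀ t, ∀ r ∈ Ioo (0 : ℝ) 1,
      conjWeight s T (gam η) ηt t r ^ 2 = Real.exp (-2 * s * xi T η r t) := fun t r hr => by
    rw [hw t r hr, ← Real.exp_nat_mul]
    congr 1
    push_cast
    ring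
  have hsub : Ioo (0 : ℝ) 1 ∩ Ioo a b = Ioo a b := inter_eq_right.2 (Ioo_subset_Ioo ha.le hb)
  have e1 : ∫ t in Ioo 0 T, quad _ (kernelGrad s T (gam η) ηt) t (dr α (φ t))
      = s * ∫ t in Ioo 0 T, ∫ r in Ioo (0 : ℝ) 1,
          Theta T t * r ^ α * (dr α (φ t) r) ^ 2 * Real.exp (-2 * s * xi T η r t) := by
    rw [← integral_const_mul]
    refine integral_congr_ae (Eventually.of_forall fun t => ?_)
    simp only [quad]
    rw [integral_weightMeasure, ← integral_const_mul]
    refine setIntegral_congr_fun measurableSet_Ioo fun r hr => ?_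
    simp only [kernelGrad, hw2 t r hr]
    ring
  have e2 : ∫ t in Ioo 0 T, quad _ (kernelFun α s T (gam η) ηt) t (toL2 α (φ t))
      = s ^ 3 * ∫ t in Ioo 0 T, ∫ r in Ioo (0 : ℝ) 1,
          Theta T t ^ 3 * r ^ (2 - α) * (toL2 α (φ t) r) ^ 2 * Real.exp (-2 * s * xi T η r t) := by
    rw [← integral_const_mul]
    refine integral_congr_ae (Eventually.of_forall fun t => ?_)
    simp only [quad]
    rw [← integral_const_mul]
    refine setIntegral_congr_fun measurableSet_Ioo fun r hr => ?_
    simp only [kernelFun, hw2 t r hr]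
    ring
  have e3 : ∫ t in Ioo 0 T, quad _ (kernelRhs s T (gam η) ηt) t (f t)
      = ∫ t in Ioo 0 T, ∫ r in Ioo (0 : ℝ) 1, (Real.exp (-s * xi T η r t) * f t r) ^ 2 := by
    refine integral_congr_ae (Eventually.of_forall fun t => ?_)
    refine setIntegral_congr_fun measurableSet_Ioo fun r hr => ?_
    simp only [kernelRhs, hw t r hr]
    ring
  have e4 : ∫ t in Ioo 0 T, quad _ (kernelObs a b s T (gam η) ηt) t (toL2 α (φ t))
      = s ^ 3 * ∫ t in Ioo 0 T, ∫ r in Ioo a b,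
          Theta T t ^ 3 * (toL2 α (φ t) r) ^ 2 * Real.exp (-2 * s * xi T η r t) := by
    rw [← integral_const_mul]
    refine integral_congr_ae (Eventually.of_forall fun t => ?_)
    simp only [quad]
    rw [← integral_const_mul, ← hsub, ← setIntegral_indicator measurableSet_Ioo]
    refine setIntegral_congr_fun measurableSet_Ioo fun r hr => ?_
    by_cases h : r ∈ Ioo a b
    · simp only [kernelObs, indicator_of_mem h, hw2 t r hr]
      ring
    · simp [kernelObs, indicator_of_notMem h]
  rw [CarlemanIneq, e1, e2, e3, e4, mul_add, mul_assoc C (s ^ 3)]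

end DegenerateCarleman

end

/-! ### Choice of the constants and conclusion. -/

theorem theorem4p1 (α a b : ℝ) (hα0 : 0 < α) (hα1 : α < 1) (ha : 0 < a) (hab : a < b) (hb : b ≤ 1)
    (η : ℝ → ℝ) (hη : DegenerateCarleman.IsEta α a b η) :
    ∃ C s₀ : ℝ, 0 < C ∧ 1 ≤ s₀ ∧
      ∀ T : ℝ, 0 < T → ∀ n : ℕ, ∀ s : ℝ, s₀ * max 1 (T ^ 16) ≤ s →
      ∀ (f : ℝ → DegenerateCarleman.L2) (φ0 : DegenerateCarleman.L2)
        (φ : ℝ → DegenerateCarleman.H01 α),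
        MemLp f 2 (volume.restrict (Ioo 0 T)) →
        DegenerateCarleman.IsWeakSolution α T n f φ0 φ →
        s * (∫ t in Ioo 0 T, ∫ r in Ioo (0 : ℝ) 1,
            DegenerateCarleman.Theta T t * r ^ α * (DegenerateCarleman.dr α (φ t) r) ^ 2
              * Real.exp (-2 * s * DegenerateCarleman.xi T η r t))
          + s ^ 3 * (∫ t in Ioo 0 T, ∫ r in Ioo (0 : ℝ) 1,
            DegenerateCarleman.Theta T t ^ 3 * r ^ (2 - α)
              * (DegenerateCarleman.toL2 α (φ t) r) ^ 2
              * Real.exp (-2 * s * DegenerateCarleman.xi T η r t))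
        ≤ C * (∫ t in Ioo 0 T, ∫ r in Ioo (0 : ℝ) 1,
              (Real.exp (-s * DegenerateCarleman.xi T η r t) * f t r) ^ 2)
          + C * s ^ 3 * (∫ t in Ioo 0 T, ∫ r in Ioo a b,
            DegenerateCarleman.Theta T t ^ 3 * (DegenerateCarleman.toL2 α (φ t) r) ^ 2
              * Real.exp (-2 * s * DegenerateCarleman.xi T η r t)) := by
  obtain ⟨ηt, m, p1, p2, ζ, ζ1, κ0, K0, Cb, he, hW⟩ :=
    DegenerateCarleman.exists_spatialWeight hα0 hα1 ha hab hb hη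
  have hκ := hW.κ0_pos
  have hK := hW.K0_pos
  have hCb : 0 < Cb := lt_of_lt_of_le one_pos hW.one_le_Cb
  have hα : 0 < 1 - α := sub_pos.2 hα1
  -- With `s₀ = 22 E` the small parameter `22 / s₀` is `1 / E`. The last two summands are the two
  -- smallness conditions on it, and the `1` gives `s₀ ≥ 22`. Neither `T` nor `n` enters.
  obtain ⟨E, hE⟩ : ∃ E, E = 1 + (5 * Cb + 2 * Cb / κ0) / κ0 + 4 * Cb / (κ0 * (1 - α) ^ 2) := ⟨_, rfl⟩
  have hE1 : 0 < (5 * Cb + 2 * Cb / κ0) / κ0 := by positivity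
  have hE2 : 0 < 4 * Cb / (κ0 * (1 - α) ^ 2) := by positivity
  have hE0 : 0 < E := by linarith
  have h22 : 22 / (22 * E) = 1 / E := by field_simp
  refine ⟨(2 * Cb + 1) * (2 + (16 * K0 ^ 2 + 6 * K0 + 24 * K0 * Cb)) / κ0, 22 * E, by positivity,
    by linarith, fun T hT n s hs f φ0 φ hf hφ => ?_⟩
  have hs0 : 0 < s := by
    have h1 : (1 : ℝ) ≤ max 1 (T ^ 16) := le_max_left _ _
    have : 0 < 22 * E * max 1 (T ^ 16) := by positivity
    linarith
  have hcl : DegenerateCarleman.CarlemanClassical α a b s T (DegenerateCarleman.gam η)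
      ((n : ℝ) ^ 2) ((2 * Cb + 1) * (2 + (16 * K0 ^ 2 + 6 * K0 + 24 * K0 * Cb)) / κ0) ηt := by
    intro φ Q φt Qt Qr hc
    refine DegenerateCarleman.carleman_classical hW hα0 hα1 ha hb (by positivity) hT
      (by linarith) ?_ ?_ hs hc
    · rw [h22]
      have e : 5 * (1 / E) * Cb + 2 * Cb * (1 / E) / κ0 = (5 * Cb + 2 * Cb / κ0) / E := by
        field_simp
      rw [e, div_le_iff₀ hE0, ← div_le_iff₀' hκ]
      linarith
    · rw [h22]
      have e : 4 * (1 / E) * Cb = 4 * Cb / E := by field_simp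
      rw [e, div_le_iff₀ hE0, ← div_le_iff₀' (by positivity)]
      linarith
  have h := DegenerateCarleman.carlemanIneq_of_mem_closure hα0 hα1 hT ha hb hs0 hW.η_cont
    hW.one_le hcl (hφ.mem_closure hα0 hα1 hT hf)
  exact (DegenerateCarleman.carlemanIneq_iff ha hb he).1
    (h.congr hφ.memLp.coeFn_toLp hf.coeFn_toLp)
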